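/- \textbf{$k$-Move Push Fight Mate-in-1 is in NP.} \emph{Game states.} A board is a polyomino (a finite, non-empty, connected set of unit squares of the grid), some of whose boundary edges carry side rails. Each square of the board is empty or holds one piece: a white or black pawn or king. At most one king carries the anchor. It is Black's turn if the anchor is on a white king; it is White's turn if the anchor is on a black king or has not been placed. \emph{Moves and pushes.} In a move, the player moves one of their pieces along a simple path of orthogonally adjacent empty squares. In a push, the player moves one of their kings into an adjacent occupied square. The piece there is pushed one square in the same direction, and so on recursively, until a piece is pushed into an unoccupied square or off the board. A push is illegal if it would push a piece through a side rail or would push the anchored king. A push wins if it is legal and pushes a piece of the other player off the board. \emph{Problem.} Given a game state and a positive integer $k$, can the player whose turn it is win this turn by making at most $k$ moves followed by one push? The input is a string over a finite alphabet: $k$ in binary, followed by an array of grid cells, row by row, covering a rectangle that contains the board (for instance its bounding box). For each cell the array says whether it is a square of the board and, if so, which of its edges carry side rails and which piece (with or without the anchor) it holds. \emph{Claim.} The language of all strings that describe a yes-instance of this problem is in NP. That is, there are a finite certificate alphabet, a polynomial $p$, and a deterministic Turing machine that decides a set of pairs $(x,y)$ of strings in time polynomial in $|x|+|y|$, such that $x$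 is in the language if and only if some certificate $y$ with $|y|\le p(|x|)$ makes the machine accept $(x,y)$. -/

import Mathlib

/-!
Generalized Push Fight, the mate-in-1 problem with the number of moves in the input, and the
class NP over Mathlib's polynomial-time (multi-stack) Turing machines.
-/

namespace PushFight

/-! ### The class NP -/

/-- A language `L` over an alphabet `Γ` is in NP if there are a finite certificate alphabet `Δ`, a
polynomial `p` and a Boolean verifier `V` on all pairs (string over `Γ`, string over `Δ`), computed
by a Turing machine in time polynomial in the length of the pair, such that `x` is in `L` exactly
when `V` accepts `(x, y)` for some certificate `y` of length at most `p |x|`.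
(A pair of strings is presented to the machine as their concatenation over the disjoint union of
the alphabets.) -/
def InNP {Γ : Type} (L : Language Γ) : Prop :=
  ∃ (Δ : Type) (_ : Fintype Δ) (p : Polynomial ℕ) (V : List Γ × List Δ → Bool),
    Nonempty (Turing.TM2ComputableInPolyTime
      (Computability.encodingProd (Computability.encodingList Γ)
        (Computability.encodingList Δ)).encode
      Computability.encodingBoolBool.encode V) ∧
    ∀ x : List Γ, x ∈ L ↔ ∃ y : List Δ, y.length ≤ p.eval x.length ∧ V (x, y) = true

/-! ### Boards -/

/-- Squares of the infinite square grid, as (row, column); rows are numbered downwards. -/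
abbrev Pos : Type := ℤ × ℤ

inductive Direction
  | up | down | left | right
  deriving DecidableEq

instance : Fintype Direction :=
  ⟨{.up, .down, .left, .right}, fun d => by cases d <;> decide⟩

/-- The unit step in a direction. -/
def Direction.vec : Direction → Pos
  | up => (-1, 0)
  | down => (1, 0)
  | left => (0, -1)
  | right => (0, 1)

/-- Orthogonal adjacency of squares. -/
def Adjacent (p q : Pos) : Prop := ∃ d : Direction, q = p + d.vec

/-- A board: a polyomino, some of whose boundary edges have side rails. The edge of the square `p`
in direction `d` is written `(p, d)`; it is a boundary edge if `p` is a square of the board and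
its neighbour in direction `d` is not. -/
structure Board where
  squares : Finset Pos
  rails : Finset (Pos × Direction)
  nonempty : squares.Nonempty
  connected : ∀ p ∈ squares, ∀ q ∈ squares,
    Relation.ReflTransGen (fun a b => Adjacent a b ∧ b ∈ squares) p q
  rails_boundary : ∀ e ∈ rails, e.1 ∈ squares ∧ e.1 + e.2.vec ∉ squares

/-! ### Pieces and game states -/

inductive Color
  | white | black
  deriving DecidableEq

instance : Fintype Color :=
  ⟨{.white, .black}, fun c => by cases c <;> decide⟩

/-- An `anchoredKing` is a king on which the anchor has been placed. -/
inductive Kind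
  | pawn | king | anchoredKing
  deriving DecidableEq

instance : Fintype Kind :=
  ⟨{.pawn, .king, .anchoredKing}, fun k => by cases k <;> decide⟩

structure Piece where
  color : Color
  kind : Kind
  deriving DecidableEq, Fintype

/-- What stands on each square; `none` means that no piece does. -/
abbrev Placement : Type := Pos → Option Piece

/-- A game state: a board and a placement of pieces on squares of the board, with at most one
anchor. -/
structure GameState where
  board : Board
  piece : Placement
  piece_mem : ∀ p, piece p ≠ none → p ∈ board.squares
  anchor_unique : ∀ p q a b, piece p = some a → piece q = some b →
    a.kind = Kind.anchoredKing → b.kind = Kind.anchoredKing → p = q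

/-- The player whose turn it is: Black if the anchor is on a white king, and White if it is on a
black king or has not been placed. -/
def GameState.turn (s : GameState) : Color :=
  if ∃ p ∈ s.board.squares, s.piece p = some ⟨Color.white, Kind.anchoredKing⟩ then Color.black
  else Color.white

/-! ### Moves and pushes -/

/-- `Move B c P P'`: on the board `B`, the player `c` can turn the placement `P` into `P'` by one
move, i.e. by moving one of their pieces along a simple path of orthogonally adjacent empty
squares. The piece starts at `p`; `path` lists the squares it runs through, ending at `q`. -/
def Move (B : Board) (c : Color) (P P' : Placement) : Prop :=
  ∃ (p q : Pos) (a : Piece) (path : List Pos),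
    P p = some a ∧ a.color = c ∧
    (p :: path).IsChain Adjacent ∧ (p :: path).Nodup ∧
    (∀ r ∈ path, r ∈ B.squares ∧ P r = none) ∧
    path.getLast? = some q ∧
    P' = Function.update (Function.update P p none) q (some a)

/-- `LegalPush B c P p d m`: in the placement `P` the player `c` can push with the king on `p` in
direction `d`, and this pushes exactly the `m` pieces on the squares `p + d, …, p + m d`.
At least one piece is pushed, none of the pushed pieces is the anchored king, and the last one goes
to an unoccupied square of the board or off the board through a boundary edge without a rail. -/
def LegalPush (B : Board) (c : Color) (P : Placement) (p : Pos) (d : Direction) (m : ℕ) : Prop :=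
  (∃ a, P p = some a ∧ a.color = c ∧ a.kind ≠ Kind.pawn) ∧
  1 ≤ m ∧
  (∀ i : ℕ, 1 ≤ i → i ≤ m → ∃ b, P (p + i • d.vec) = some b ∧ b.kind ≠ Kind.anchoredKing) ∧
  P (p + (m + 1) • d.vec) = none ∧
  (p + (m + 1) • d.vec ∉ B.squares → (p + m • d.vec, d) ∉ B.rails)

/-- The push is legal and pushes a piece of the other player off the board. -/
def WinningPush (B : Board) (c : Color) (P : Placement) (p : Pos) (d : Direction) (m : ℕ) : Prop :=
  LegalPush B c P p d m ∧
  p + (m + 1) • d.vec ∉ B.squares ∧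
  ∃ b, P (p + m • d.vec) = some b ∧ b.color ≠ c

/-- The player whose turn it is can win this turn by making up to `k` moves and one push. -/
def GameState.MateInOne (s : GameState) (k : ℕ) : Prop :=
  ∃ (l : ℕ) (C : ℕ → Placement), l ≤ k ∧ C 0 = s.piece ∧
    (∀ i < l, Move s.board s.turn (C i) (C (i + 1))) ∧
    ∃ p d m, WinningPush s.board s.turn (C l) p d m

/-! ### Instances as strings -/

/-- The finite input alphabet: binary digits, a grid cell that is not a square of the board, a
square of the board with its side rails and its occupant (if any), and an end-of-row mark. -/
inductive Symbol
  | bit (b : Bool)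
  | offBoard
  | square (rail : Direction → Bool) (occupant : Option Piece)
  | endRow
  deriving DecidableEq, Fintype

/-- The symbol that describes one grid cell in a game state. -/
def GameState.symbolAt (s : GameState) (p : Pos) : Symbol :=
  if p ∈ s.board.squares then
    Symbol.square (fun d => decide ((p, d) ∈ s.board.rails)) (s.piece p)
  else Symbol.offBoard

/-- The description of a game state and a number `k`: the number in binary (least significant
digit first), followed by the `h × w` array of grid cells with top left corner `o`, row by row. -/
def GameState.describe (s : GameState) (k : ℕ) (o : Pos) (h w : ℕ) : List Symbol :=
  (Computability.encodeNat k).map Symbol.bit ++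
    (List.range h).flatMap fun i =>
      (List.range w).map (fun j => s.symbolAt (o.1 + i, o.2 + j)) ++ [Symbol.endRow]

/-- The `h × w` rectangle of grid cells with top left corner `o` contains the whole board. -/
def GameState.FitsIn (s : GameState) (o : Pos) (h w : ℕ) : Prop :=
  ∀ p ∈ s.board.squares, ∃ i < h, ∃ j < w, p = (o.1 + (i : ℤ), o.2 + (j : ℤ))

/-- `k`-Move Push Fight Mate-in-1, as a language: all descriptions (by any rectangle that contains
the board, in particular by its bounding box) of a game state and a positive integer `k` such that
the player whose turn it is can win this turn by making up to `k` moves and one push. -/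
def kMoveMateInOne : Language Symbol :=
  {x | ∃ (s : GameState) (k : ℕ) (o : Pos) (h w : ℕ),
    0 < k ∧ s.FitsIn o h w ∧ x = s.describe k o h w ∧ s.MateInOne k}

end PushFight

/-! The obstacle to guessing the winning moves is that `k` is given in binary, so that `k` moves may
be exponentially many. But polynomially many moves always suffice (`GameState.mateInOne_iff`). The
player to move never owns the anchored king (`GameState.movePreserved`). Hence whether a push wins
depends only on the opponent's pieces, which the moves do not touch, on the square of the pushing
king, and on the set of squares of the player's other pieces (`WinningPush.of_matches`). So the
moves amount to steps of one distinguished token and several indistinguishable ones on the graph `W`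
of the `n` squares that are free of the opponent.

Fix the place `v` of the distinguished token. In each component of `W` without `v`, the other tokens
can be brought from any set of places to any other one of the same size (`within_rearrange`),
because a token that is blocked by another one hands its journey over to it (`within_slide`). Such a
component either contains one of the four neighbours of `v` or is a whole component of `W`, whose
number of tokens never changes. Therefore `v` and the four numbers of tokens in the components next
to `v` determine a reachable configuration up to `n * n` steps (`within_of_tokenKey_eq`). There are
at most `n * (n + 1) ^ 4` such keys. Cutting a walk short between its visits to the same key
(`within_of_key`) leaves at most `tokenBound n` steps, each of which is a move.

It remains to check a guess by a machine. A language is in NP if its words are those from which a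
rewriting system with regular step and final relations accepts, and polynomially many steps suffice
(`inNP_of_accepts`). The certificate lists the successive words, and a machine with four stacks
compares each word with the previous one while running two finite automata on the pairs of letters.

The game becomes such a system by steps that change at most two adjacent cells and a binary counter
(`VerifierStep`). Marks on the cells certify that the board is connected, that rails are on boundary
edges, and that a push wins. Soundness rests on the invariants `BoardMarks` and `GameMarks`,
completeness on `GameState.exists_verified`. In a word that lists an array row by row, horizontal
adjacency is visible to a finite automaton. Vertical adjacency becomes visible by marks on all cells
of one column, which further rewriting steps move from column to column. At the end these marks have
to be exactly on the ends of the rows, which shows that all rows have the same length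
(`mem_of_accepts`). -/

/-! ### Rewriting systems over finite alphabets with regular step relations -/

namespace RegularRewriting

open Turing StateTransition

/-- `Accepts R F n u`: the word `u` can be rewritten `n` times by the relation `R` and then once by
the relation `F`; a relation between words of equal length is given by the language of its pairs,
read as words of pairs. -/
inductive Accepts {Δ : Type} (R F : Language (Δ × Δ)) : ℕ → List Δ → Prop
  | final (z : List (Δ × Δ)) : z ∈ F → Accepts R F 0 (z.map Prod.fst)
  | step {n : ℕ} (z : List (Δ × Δ)) :
      z ∈ R → Accepts R F n (z.map Prod.snd) → Accepts R F (n + 1) (z.map Prod.fst)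

/-! ### A stack machine that checks a sequence of words with two automata -/

section Machine

variable {Γ Δ σ₁ σ₂ : Type} (ι : Γ → Δ) (M : DFA (Δ × Δ) σ₁) (N : DFA (Δ × Δ) σ₂)

open scoped Classical in
/-- Reads a certificate: `b` is the part of the previous block that has not been compared yet and
`acc` the part of the current block read so far, in reverse. -/
noncomputable def check : List Δ → List Δ → σ₁ → σ₂ → List (Option Δ) → Bool
  | b, _, _, r, [] => decide (b = [] ∧ r ∈ N.accept)
  | [], _, _, _, some _ :: _ => false
  | c :: b, acc, q, r, some d :: y => check b (d :: acc) (M.step q (c, d)) (N.step r (c, d)) y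
  | b, acc, q, _, none :: y =>
      if b = [] ∧ q ∈ M.accept then check acc.reverse [] M.start N.start y else false

/-- `input` holds the unread part of the pair of strings, `right` the part of the previous word that
has not been compared, and `left` the part of the current word read so far, in reverse. -/
inductive Stack
  | input | left | right | output
  deriving DecidableEq

instance : Fintype Stack :=
  ⟨{.input, .left, .right, .output}, fun k => by cases k <;> decide⟩

/-- `load` brings the translated first string to `left`, `turn` reverses `left` onto `right` and
restarts both automata, `compare` reads a block of the certificate, and `clean` empties the stacks
before the answer is written. -/
inductive Phase
  | load | turn | compare | clean (b : Bool)
  deriving DecidableEq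

instance : Fintype Phase :=
  ⟨{.load, .turn, .compare, .clean true, .clean false}, fun k => by
    rcases k with _ | _ | _ | _ | _ <;> decide⟩

/-- The alphabets of the four stacks. -/
abbrev StackSymbol (Γ Δ : Type) : Stack → Type
  | .input => Γ ⊕ Option Δ
  | .left => Δ
  | .right => Δ
  | .output => Bool

/-- The memory of the verifier: two automaton states and two symbols read last. -/
abbrev Memory (Γ Δ σ₁ σ₂ : Type) : Type := (σ₁ × σ₂) × (Option (Γ ⊕ Option Δ) × Option Δ)

open TM2.Stmt in
open scoped Classical in
/-- The program of the verifier. -/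
noncomputable def program [Inhabited Δ] :
    Phase → TM2.Stmt (StackSymbol Γ Δ) Phase (Memory Γ Δ σ₁ σ₂)
  | .load =>
      peek .input (fun m s => (m.1, s, m.2.2)) <|
      branch (fun m => m.2.1.any Sum.isLeft)
        (pop .input (fun m _ => m) <|
          push .left (fun m => m.2.1.elim default (Sum.elim ι fun _ => default)) <|
          goto fun _ => .load)
        (goto fun _ => .turn)
  | .turn =>
      pop .left (fun m s => (m.1, m.2.1, s)) <|
      branch (fun m => m.2.2.isSome)
        (push .right (fun m => m.2.2.getD default) <| goto fun _ => .turn)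
        (load (fun m => ((M.start, N.start), m.2)) <| goto fun _ => .compare)
  | .compare =>
      pop .input (fun m s => (m.1, s, m.2.2)) <|
      pop .right (fun m s => (m.1, m.2.1, s)) <|
      branch (fun m => m.2.1.any fun s => s.elim (fun _ => false) Option.isSome)
        (branch (fun m => m.2.2.isSome)
          (push .left (fun m => m.2.1.elim default (Sum.elim ι fun d => d.getD default)) <|
            load (fun m =>
              let p := (m.2.2.getD default,
                m.2.1.elim default (Sum.elim ι fun d => d.getD default))
              ((M.step m.1.1 p, N.step m.1.2 p), m.2)) <|
            goto fun _ => .compare)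
          (goto fun _ => .clean false))
        (branch (fun m => m.2.1.isSome)
          (goto fun m => if m.2.2 = none ∧ m.1.1 ∈ M.accept then .turn else .clean false)
          (goto fun m => .clean (decide (m.2.2 = none ∧ m.1.2 ∈ N.accept))))
  | .clean b =>
      pop .input (fun m s => (m.1, s, m.2.2)) <|
      branch (fun m => m.2.1.isSome) (goto fun _ => .clean b) <|
      pop .left (fun m s => (m.1, m.2.1, s)) <|
      branch (fun m => m.2.2.isSome) (goto fun _ => .clean b) <|
      pop .right (fun m s => (m.1, m.2.1, s)) <|
      branch (fun m => m.2.2.isSome) (goto fun _ => .clean b) <|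
      push .output (fun _ => b) <| load (fun _ => ((M.start, N.start), none, none)) halt

/-- The verifier as a Turing machine. -/
noncomputable def machine [Inhabited Δ] [Fintype Γ] [Fintype Δ] [Fintype σ₁] [Fintype σ₂] :
    FinTM2 where
  K := Stack
  k₀ := .input
  k₁ := .output
  Γ := StackSymbol Γ Δ
  Λ := Phase
  main := .load
  σ := Memory Γ Δ σ₁ σ₂
  initialState := ((M.start, N.start), none, none)
  Γk₀Fin := inferInstanceAs (Fintype (Γ ⊕ Option Δ))
  m := program ι M N

/-- The contents of the four stacks. -/
def contents (i : List (Γ ⊕ Option Δ)) (a b : List Δ) (o : List Bool) :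
    ∀ k, List (StackSymbol Γ Δ k)
  | .input => i
  | .left => a
  | .right => b
  | .output => o

variable (i i' : List (Γ ⊕ Option Δ)) (a b a' : List Δ) (o o' : List Bool)

@[simp] theorem contents_input : contents i a b o .input = i := rfl
@[simp] theorem contents_left : contents i a b o .left = a := rfl
@[simp] theorem contents_right : contents i a b o .right = b := rfl
@[simp] theorem contents_output : contents i a b o .output = o := rfl

@[simp] theorem update_contents_input :
    Function.update (contents i a b o) .input i' = contents i' a b o := by
  funext k; cases k <;> simp [Function.update, contents]

@[simp] theorem update_contents_left :
    Function.update (contents i a b o) .left a' = contents i a' b o := by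
  funext k; cases k <;> simp [Function.update, contents]

@[simp] theorem update_contents_right :
    Function.update (contents i a b o) .right a' = contents i a a' o := by
  funext k; cases k <;> simp [Function.update, contents]

@[simp] theorem update_contents_output :
    Function.update (contents i a b o) .output o' = contents i a b o' := by
  funext k; cases k <;> simp [Function.update, contents]

/-- The machine runs from one configuration to another in at most `n` steps. -/
def Runs {C : Type} (f : C → Option C) (n : ℕ) (c c' : C) : Prop :=
  Nonempty (EvalsToInTime f c (some c') n)

theorem Runs.refl {C : Type} {f : C → Option C} {n : ℕ} (c : C) : Runs f n c c :=
  ⟨⟨EvalsTo.refl f c, Nat.zero_le n⟩⟩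

theorem Runs.head {C : Type} {f : C → Option C} {n m : ℕ} {c c' c'' : C} (h : f c = some c')
    (h' : Runs f n c' c'') (hm : n + 1 ≤ m) : Runs f m c c'' := by
  obtain ⟨e⟩ := h'
  refine ⟨⟨⟨e.steps + 1, ?_⟩, (Nat.succ_le_succ e.steps_le_m).trans hm⟩⟩
  have he := e.evals_in_steps
  rw [← h] at he
  rwa [Function.iterate_succ_apply]

theorem Runs.trans {C : Type} {f : C → Option C} {n m k : ℕ} {c c' c'' : C} (h : Runs f n c c')
    (h' : Runs f m c' c'') (hk : n + m ≤ k) : Runs f k c c'' := by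
  obtain ⟨e⟩ := h
  obtain ⟨e'⟩ := h'
  have e'' := EvalsToInTime.trans f n m c c' _ e e'
  exact ⟨⟨e''.toEvalsTo, e''.steps_le_m.trans (by omega)⟩⟩

variable [Inhabited Δ]

local notation "run" => Runs (TM2.step (program ι M N))

/-- A halting configuration must have the initial memory and no stack contents except for the
output, so the leftovers of an early rejection have to be removed. Each step removes one symbol, and
a last step writes the answer. -/
theorem runs_clean (res : Bool) (m : Memory Γ Δ σ₁ σ₂) (k : ℕ)
    (hk : i.length + a.length + b.length + 1 ≤ k) :
    run k ⟨some (.clean res), m, contents i a b []⟩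
      ⟨none, ((M.start, N.start), none, none), contents [] [] [] [res]⟩ := by
  induction k generalizing i a b m with
  | zero => omega
  | succ k ih =>
    cases i with
    | cons s i =>
      refine Runs.head (n := k) ?_ (ih i a b (m.1, some s, m.2.2) (by simp at hk; omega)) le_rfl
      simp [program]
    | nil =>
      cases a with
      | cons s a =>
        refine Runs.head (n := k) ?_ (ih [] a b (m.1, none, some s) (by simp at hk ⊢; omega)) le_rfl
        simp [program]
      | nil =>
        cases b with
        | cons s b =>
          refine Runs.head (n := k) ?_ (ih [] [] b (m.1, none, some s) (by simp at hk ⊢; omega)) le_rfl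
          simp [program]
        | nil =>
          refine Runs.head (n := 0) ?_ (Runs.refl _) (by omega)
          simp [program]

theorem runs_load (x : List Γ) (y : List (Option Δ)) (m : Memory Γ Δ σ₁ σ₂) :
    ∃ m', run (x.length + 1)
      ⟨some .load, m, contents (x.map Sum.inl ++ y.map Sum.inr) a b []⟩
      ⟨some .turn, m', contents (y.map Sum.inr) ((x.map ι).reverse ++ a) b []⟩ := by
  induction x generalizing a m with
  | nil =>
    cases y with
    | nil => exact ⟨_, Runs.head (n := 0) (by simp [program]; rfl) (Runs.refl _) (by simp)⟩
    | cons s y => exact ⟨_, Runs.head (n := 0) (by simp [program]; rfl) (Runs.refl _) (by simp)⟩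
  | cons g x ih =>
    obtain ⟨m', h⟩ := ih (ι g :: a) (m.1, some (Sum.inl g), m.2.2)
    refine ⟨m', Runs.head (n := x.length + 1) ?_ (by simpa using h) (by simp)⟩
    simp [program]

theorem runs_turn (m : Memory Γ Δ σ₁ σ₂) :
    ∃ m', run (a.length + 1) ⟨some .turn, m, contents i a b []⟩
      ⟨some .compare, ((M.start, N.start), m'), contents i [] (a.reverse ++ b) []⟩ := by
  induction a generalizing b m with
  | nil => exact ⟨_, Runs.head (n := 0) (by simp [program]; rfl) (Runs.refl _) (by simp)⟩
  | cons d a ih =>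
    obtain ⟨m', h⟩ := ih (d :: b) (m.1, m.2.1, some d)
    refine ⟨m', Runs.head (n := a.length + 1) ?_ (by simpa using h) (by simp)⟩
    simp [program]

/-- The bound is a potential. Comparing a letter shortens `y` and `b` and lengthens `a`, which
lowers it by two. A separator turns `a` into the next `b` and lowers it by `a.length + 3`, which
pays for the reversal. What remains at the end pays for cleaning. -/
theorem runs_compare (y : List (Option Δ)) (q : σ₁) (r : σ₂) (m) :
    run (3 * y.length + 2 * a.length + b.length + 2)
      ⟨some .compare, ((q, r), m), contents (y.map Sum.inr) a b []⟩
      ⟨none, ((M.start, N.start), none, none), contents [] [] [] [check M N b a q r y]⟩ := by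
  classical
  induction y generalizing a b q r m with
  | nil =>
    refine Runs.head ?_ (runs_clean ι M N [] a b.tail _ ((q, r), none, b.head?) _ le_rfl) ?_
    · cases b <;> simp [program, check]
    · simp; omega
  | cons s y ih =>
    rcases s with _ | d
    · by_cases hb : b = [] ∧ q ∈ M.accept
      · obtain ⟨m', h⟩ := runs_turn ι M N (y.map Sum.inr) a []
          ((q, r), some (Sum.inr none), none)
        have h_check : check M N b a q r (none :: y) =
            check M N (a.reverse ++ []) [] M.start N.start y := by simp [check, hb]
        rw [h_check]
        refine Runs.head ?_ (Runs.trans h (ih [] (a.reverse ++ []) M.start N.start m') le_rfl) ?_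
        · obtain ⟨rfl, hq⟩ := hb
          simp [program, hq]
        · simp; omega
      · have h_check : check M N b a q r (none :: y) = false := by
          cases b <;> simp_all [check]
        rw [h_check]
        refine Runs.head ?_ (runs_clean ι M N (y.map Sum.inr) a b.tail false
          ((q, r), some (Sum.inr none), b.head?) _ le_rfl) ?_
        · cases b <;> simp_all [program]
        · simp; omega
    · cases b with
      | nil =>
        refine Runs.head ?_ (runs_clean ι M N (y.map Sum.inr) a [] false
          ((q, r), some (Sum.inr (some d)), none) _ le_rfl) ?_
        · simp [program]
        · simp; omega
      | cons c b =>
        refine Runs.head ?_ (ih (d :: a) b (M.step q (c, d)) (N.step r (c, d))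
          (some (Sum.inr (some d)), some c)) ?_
        · simp [program]
        · simp; omega

end Machine

/-! ### Certificates and runs of the rewriting system -/

section Correctness

variable {Δ σ₁ σ₂ : Type} (M : DFA (Δ × Δ) σ₁) (N : DFA (Δ × Δ) σ₂)

/-- Both automata run over every block, since only what follows the block, a separator or the end,
tells whether it is a step of the first relation or the final pair word. -/
theorem check_append (z : List (Δ × Δ)) (b acc : List Δ) (q : σ₁) (r : σ₂) (y : List (Option Δ)) :
    check M N (z.map Prod.fst ++ b) acc q r (z.map (fun p => some p.2) ++ y) =
      check M N b ((z.map Prod.snd).reverse ++ acc) (M.evalFrom q z) (N.evalFrom r z) y := by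
  induction z generalizing acc q r with
  | nil => simp
  | cons p z ih => simp [check, ih]

/-- The certificate consists of the second components of the successive pair words, separated by
`none`. The first components are already known: they form the input or the previous block. -/
theorem exists_check_of_accepts {n : ℕ} {u : List Δ} (h : Accepts M.accepts N.accepts n u) :
    ∃ y : List (Option Δ), y.length ≤ (n + 1) * (u.length + 1) ∧
      check M N u [] M.start N.start y = true := by
  induction h with
  | final z hz =>
    refine ⟨z.map (fun p => some p.2), by simp, ?_⟩
    have h := check_append M N z [] [] M.start N.start []
    rw [List.append_nil, List.append_nil] at h
    rw [h]
    have hr : N.evalFrom N.start z ∈ N.accept := hz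
    simpa [check] using hr
  | @step n z hz _ ih =>
    obtain ⟨y, hy, h⟩ := ih
    refine ⟨z.map (fun p => some p.2) ++ none :: y, ?_, ?_⟩
    · simp at hy ⊢
      ring_nf at hy ⊢
      omega
    · have h' := check_append M N z [] [] M.start N.start (none :: y)
      rw [List.append_nil] at h'
      have hq : M.evalFrom M.start z ∈ M.accept := hz
      rw [h']
      simpa [check, hq] using h

/-- The induction on the certificate needs a statement about half-read blocks: `z` pairs the rest
`b` of the previous word with the rest of the current one, whose beginning is `acc` in reverse. -/
theorem accepts_of_check (y : List (Option Δ)) (b acc : List Δ) (q : σ₁) (r : σ₂)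
    (h : check M N b acc q r y = true) :
    ∃ z : List (Δ × Δ), z.map Prod.fst = b ∧ (N.evalFrom r z ∈ N.accept ∨
      (M.evalFrom q z ∈ M.accept ∧
        ∃ n, Accepts M.accepts N.accepts n (acc.reverse ++ z.map Prod.snd))) := by
  induction y generalizing b acc q r with
  | nil =>
    simp only [check, decide_eq_true_eq] at h
    exact ⟨[], by simp [h.1], Or.inl (by simpa using h.2)⟩
  | cons s y ih =>
    rcases s with _ | d
    · simp only [check] at h
      split_ifs at h with hb
      refine ⟨[], by simp [hb.1], Or.inr ⟨by simpa using hb.2, ?_⟩⟩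
      obtain ⟨z, hz, hz'⟩ := ih _ _ _ _ h
      simp only [List.map_nil, List.append_nil, ← hz]
      rcases hz' with hz' | ⟨hz', n, hn⟩
      · exact ⟨0, .final z hz'⟩
      · exact ⟨n + 1, .step z hz' (by simpa using hn)⟩
    · cases b with
      | nil => simp [check] at h
      | cons c b =>
        obtain ⟨z, hz, hz'⟩ := ih _ _ _ _ (by simpa only [check] using h)
        exact ⟨(c, d) :: z, by simp [hz], by simpa using hz'⟩

theorem exists_accepts_of_check {u : List Δ} {y : List (Option Δ)}
    (h : check M N u [] M.start N.start y = true) :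
    ∃ n, Accepts M.accepts N.accepts n u := by
  obtain ⟨z, rfl, hz | ⟨hz, n, hn⟩⟩ := accepts_of_check M N y _ _ _ _ h
  · exact ⟨0, .final z hz⟩
  · exact ⟨n + 1, .step z hz hn⟩

end Correctness

/-- A language is in NP if its words are those from which a rewriting system with regular step
relations reaches acceptance, and polynomially many steps suffice. -/
theorem inNP_of_accepts {Γ Δ : Type} [Fintype Γ] [Fintype Δ] [Inhabited Δ] {L : Language Γ}
    (ι : Γ → Δ) {R F : Language (Δ × Δ)} (hR : R.IsRegular) (hF : F.IsRegular) (p : Polynomial ℕ)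
    (sound : ∀ x n, Accepts R F n (x.map ι) → x ∈ L)
    (complete : ∀ x ∈ L, ∃ n ≤ p.eval x.length, Accepts R F n (x.map ι)) :
    PushFight.InNP L := by
  obtain ⟨σ₁, _, M, rfl⟩ := hR
  obtain ⟨σ₂, _, N, rfl⟩ := hF
  -- A run of `n` steps is certified by `n + 1` blocks, each of which has length at most `|x| + 1`
  -- including its separator.
  refine ⟨Option Δ, inferInstance, (p + 1) * (Polynomial.X + 1),
    fun xy => check M N (xy.1.map ι) [] M.start N.start xy.2, ⟨?_⟩, fun x => ⟨fun hx => ?_, ?_⟩⟩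
  · refine
      { tm := machine ι M N
        inputAlphabet := Equiv.refl _
        outputAlphabet := Equiv.refl _
        -- Loading and turning take `|x| + 1` steps each, and comparing takes `3 |y| + |x| + 2`.
        time := 3 * Polynomial.X + 4
        outputsFun := fun ⟨x, y⟩ => Classical.choice ?_ }
    obtain ⟨m, h₁⟩ := runs_load ι M N [] [] x y ((M.start, N.start), none, none)
    obtain ⟨m', h₂⟩ := runs_turn ι M N (y.map Sum.inr) ((x.map ι).reverse ++ []) [] m
    have h₃ := runs_compare ι M N [] (((x.map ι).reverse ++ []).reverse ++ []) y M.start N.start m'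
    have h := (h₁.trans h₂ le_rfl).trans h₃ (k := 3 * (x.length + y.length) + 4)
      (by simp; omega)
    have h_init : initList (machine ι M N) (x.map Sum.inl ++ y.map Sum.inr) =
        ⟨some .load, ((M.start, N.start), none, none),
          contents (x.map Sum.inl ++ y.map Sum.inr) [] [] []⟩ := by
      simp only [initList]
      congr 1
      funext k
      cases k <;> rfl
    have h_halt : ∀ res : Bool, haltList (machine ι M N) [res] =
        ⟨none, ((M.start, N.start), none, none), contents [] [] [] [res]⟩ := by
      intro res
      simp only [haltList]
      congr 1
      funext k
      cases k <;> rfl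
    have h_enc : (Computability.encodingProd (Computability.encodingList Γ)
        (Computability.encodingList (Option Δ))).encode (x, y) =
        x.map Sum.inl ++ y.map Sum.inr := rfl
    have h_out : Computability.encodingBoolBool.encode
        (check M N (x.map ι) [] M.start N.start y) =
        [check M N (x.map ι) [] M.start N.start y] := rfl
    rw [h_enc, h_out]
    have h_in : List.map (Equiv.refl ((machine ι M N).Γ (machine ι M N).k₀)).invFun
        (x.map Sum.inl ++ y.map Sum.inr) = x.map Sum.inl ++ y.map Sum.inr := List.map_id _
    have h_res : List.map (Equiv.refl ((machine ι M N).Γ (machine ι M N).k₁)).invFun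
        [check M N (x.map ι) [] M.start N.start y] =
        [check M N (x.map ι) [] M.start N.start y] := List.map_id _
    simp only [TM2OutputsInTime]
    have h_time : (3 * Polynomial.X + 4 : Polynomial ℕ).eval
        (x.map Sum.inl ++ y.map Sum.inr : List (Γ ⊕ Option Δ)).length =
        3 * (x.length + y.length) + 4 := by simp
    simp only [List.append_nil, List.reverse_reverse] at h
    rw [h_time]
    refine Eq.mpr (congrArg Nonempty (congrArg₂ (fun c c' =>
      EvalsToInTime (machine ι M N).step c c' _)
      ((congrArg (initList (machine ι M N)) h_in).trans h_init)
      (congrArg some ((congrArg (haltList (machine ι M N)) h_res).trans (h_halt _))))) h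
  · obtain ⟨n, hn, h⟩ := complete x hx
    obtain ⟨y, hy, h'⟩ := exists_check_of_accepts M N h
    refine ⟨y, hy.trans ?_, h'⟩
    simp only [List.length_map, Polynomial.eval_mul, Polynomial.eval_add, Polynomial.eval_one,
      Polynomial.eval_X]
    gcongr
  · rintro ⟨y, -, hy⟩
    obtain ⟨n, hn⟩ := exists_accepts_of_check M N hy
    exact sound x n hn

end RegularRewriting

/-! ### Closure properties of regular languages -/

namespace RegularRewriting

variable {α : Type}

/-- A subset construction: after reading `x`, the automaton knows the state of `M` and the set of
the states that `N` reaches on those `z` with `x = y ++ z` for which `M` accepts `y`. -/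
theorem isRegular_mul {L K : Language α} (hL : L.IsRegular) (hK : K.IsRegular) :
    (L * K).IsRegular := by
  classical
  obtain ⟨σ, _, M, rfl⟩ := hL
  obtain ⟨τ, _, N, rfl⟩ := hK
  let restart : σ → Set τ := fun q => {r | q ∈ M.accept ∧ r = N.start}
  let P : DFA α (σ × Set τ) :=
    { step := fun s a => (M.step s.1 a, (fun r => N.step r a) '' s.2 ∪ restart (M.step s.1 a))
      start := (M.start, restart M.start)
      accept := {s | ∃ r ∈ s.2, r ∈ N.accept} }
  have key : ∀ x : List α, P.eval x =
      (M.eval x, {r | ∃ y z, y ++ z = x ∧ y ∈ M.accepts ∧ r = N.eval z}) := by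
    intro x
    induction x using List.reverseRecOn with
    | nil =>
      simp only [DFA.eval_nil, List.append_eq_nil_iff]
      refine Prod.ext rfl (Set.ext fun r => ?_)
      constructor
      · rintro ⟨h, rfl⟩
        exact ⟨[], [], ⟨rfl, rfl⟩, h, rfl⟩
      · rintro ⟨_, _, ⟨rfl, rfl⟩, h, rfl⟩
        exact ⟨h, rfl⟩
    | append_singleton x a ih =>
      rw [DFA.eval_append_singleton, ih, DFA.eval_append_singleton]
      refine Prod.ext rfl (Set.ext fun r => ?_)
      constructor
      · rintro (⟨_, ⟨y, z, rfl, hy, rfl⟩, rfl⟩ | ⟨h, rfl⟩)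
        · exact ⟨y, z ++ [a], by simp, hy, by simp⟩
        · refine ⟨x ++ [a], [], by simp, ?_, rfl⟩
          rwa [← DFA.eval_append_singleton] at h
      · rintro ⟨y, z, hyz, hy, rfl⟩
        rcases List.eq_nil_or_concat z with rfl | ⟨z, b, rfl⟩
        · rw [List.append_nil] at hyz
          subst hyz
          refine Or.inr ⟨?_, rfl⟩
          rw [← DFA.eval_append_singleton]
          exact hy
        · rw [List.concat_eq_append, ← List.append_assoc] at hyz
          rw [List.concat_eq_append]
          obtain ⟨rfl, hb⟩ := List.append_inj' hyz rfl
          obtain rfl : b = a := by simpa using hb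
          exact Or.inl ⟨N.eval z, ⟨y, z, rfl, hy, rfl⟩, by simp⟩
  refine ⟨σ × Set τ, inferInstance, P, ?_⟩
  ext x
  rw [DFA.mem_accepts, key, Language.mem_mul]
  constructor
  · rintro ⟨_, ⟨y, z, rfl, hy, rfl⟩, hz⟩
    exact ⟨y, hy, z, hz, rfl⟩
  · rintro ⟨y, hy, z, hz, rfl⟩
    exact ⟨_, ⟨y, z, rfl, hy, rfl⟩, hz⟩

/-- The words all of whose letters satisfy `P`. -/
def allLetters (P : α → Prop) : Language α := {z | ∀ a ∈ z, P a}

/-- The words that consist of one letter, which satisfies `P`. -/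
def oneLetter (P : α → Prop) : Language α := {z | ∃ a, z = [a] ∧ P a}

/-- The words in which any two consecutive letters are related by `Q`. -/
def chainLetters (Q : α → α → Prop) : Language α := {z | z.IsChain Q}

theorem isRegular_allLetters (P : α → Prop) : (allLetters P).IsRegular := by
  classical
  let M : DFA α Bool := { step := fun s a => s && decide (P a), start := true, accept := {true} }
  have key : ∀ (x : List α) (s : Bool), M.evalFrom s x = (s && decide (∀ a ∈ x, P a)) := by
    intro x
    induction x with
    | nil => simp
    | cons a x ih =>
      intro s
      rw [DFA.evalFrom_cons, ih]
      simp [M, Bool.and_assoc]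
  refine ⟨Bool, inferInstance, M, ?_⟩
  ext x
  change M.evalFrom true x = true ↔ ∀ a ∈ x, P a
  rw [key]
  simp

/-- The automaton remembers the last letter. Its state `some none` means that nothing has been read,
and the outer `none` that two consecutive letters have violated `Q`. -/
theorem isRegular_chainLetters [Fintype α] (Q : α → α → Prop) : (chainLetters Q).IsRegular := by
  classical
  let M : DFA α (Option (Option α)) :=
    { step := fun s a => s.bind fun p => if ∀ b ∈ p, Q b a then some (some a) else none
      start := some none
      accept := {none}ᶜ }
  have fail : ∀ x : List α, M.evalFrom none x = none := by
    intro x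
    induction x with
    | nil => rfl
    | cons a x ih => exact ih
  have key : ∀ (x : List α) (p : Option α),
      M.evalFrom (some p) x ≠ none ↔ (∀ b ∈ p, ∀ a ∈ x.head?, Q b a) ∧ x.IsChain Q := by
    intro x
    induction x with
    | nil => simp
    | cons a x ih =>
      intro p
      rw [DFA.evalFrom_cons]
      by_cases h : ∀ b ∈ p, Q b a
      · have h_step : M.step (some p) a = some (some a) := by
          simp only [M, Option.bind_some]
          rw [if_pos h]
        rw [h_step, ih, List.isChain_cons]
        simpa using fun _ _ b hb => h b hb
      · have h_step : M.step (some p) a = none := by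
          simp only [M, Option.bind_some]
          rw [if_neg h]
        rw [h_step, fail]
        simp only [ne_eq, not_true_eq_false, false_iff, not_and]
        intro h'
        exact absurd (fun b hb => h' b hb a (by simp)) h
  refine ⟨Option (Option α), inferInstance, M, ?_⟩
  ext x
  change M.evalFrom (some none) x ≠ none ↔ x.IsChain Q
  rw [key]
  simp

/-- A chain for the empty relation has at most one letter, and a word is non-empty if it is not in
`allLetters` of the false predicate. -/
theorem isRegular_oneLetter [Fintype α] (P : α → Prop) : (oneLetter P).IsRegular := by
  have h_empty : (allLetters fun _ : α => False).IsRegular := isRegular_allLetters _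
  convert (isRegular_allLetters P).inf ((isRegular_chainLetters fun _ _ : α => False).inf
    h_empty.compl) using 1
  ext z
  change (∃ a, z = [a] ∧ P a) ↔ (∀ a ∈ z, P a) ∧ z.IsChain (fun _ _ => False) ∧
    ¬ ∀ a ∈ z, False
  rcases z with _ | ⟨a, _ | ⟨b, z⟩⟩ <;> simp

theorem isRegular_sup {L K : Language α} (hL : L.IsRegular) (hK : K.IsRegular) :
    (L ⊔ K).IsRegular := hL.add hK

/-- The union of a family of languages. -/
def unionLang {ι : Type} (L : ι → Language α) : Language α := {z | ∃ i, z ∈ L i}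

/-- A finite union of regular languages is regular. -/
theorem isRegular_unionLang {ι : Type} [Finite ι] {L : ι → Language α}
    (h : ∀ i, (L i).IsRegular) : (unionLang L).IsRegular := by
  classical
  have := Fintype.ofFinite ι
  have key : ∀ s : Finset ι, ∃ K : Language α, K.IsRegular ∧ ∀ z, z ∈ K ↔ ∃ i ∈ s, z ∈ L i := by
    intro s
    induction s using Finset.induction_on with
    | empty =>
      refine ⟨_, (isRegular_allLetters fun _ : α => False).inf
        (isRegular_allLetters fun _ : α => False).compl, fun z => ?_⟩
      change (_ ∧ ¬ _) ↔ _
      simp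
    | insert i s _ ih =>
      obtain ⟨K, hK, hK'⟩ := ih
      refine ⟨_, (h i).add hK, fun z => ?_⟩
      change (z ∈ L i ∨ z ∈ K) ↔ _
      simp [hK']
  obtain ⟨K, hK, hK'⟩ := key Finset.univ
  have h_eq : unionLang L = K := by
    ext z
    rw [hK']
    change (∃ i, z ∈ L i) ↔ _
    simp
  rwa [h_eq]

end RegularRewriting

namespace PushFight

/-! ### Bounded reachability -/

/-- `Within r n a b`: one gets from `a` to `b` by at most `n` steps of the relation `r`. -/
inductive Within {α : Type*} (r : α → α → Prop) : ℕ → α → α → Prop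
  | refl (n : ℕ) (a : α) : Within r n a a
  | head {n : ℕ} {a b c : α} : r a b → Within r n b c → Within r (n + 1) a c

section Within

variable {α : Type*} {r : α → α → Prop} {n m : ℕ} {a b c : α}

theorem Within.mono (h : Within r n a b) (hm : n ≤ m) : Within r m a b := by
  induction h generalizing m with
  | refl n a => exact .refl _ _
  | head h _ ih =>
    obtain ⟨m, rfl⟩ : ∃ m', m = m' + 1 := ⟨m - 1, by omega⟩
    exact .head h (ih (by omega))

theorem Within.single (h : r a b) : Within r 1 a b := .head h (.refl _ _)

theorem Within.trans (h : Within r n a b) (h' : Within r m b c) : Within r (n + m) a c := by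
  induction h with
  | refl n a => exact h'.mono (by omega)
  | @head n _ _ _ h _ ih => exact (Within.head h (ih h')).mono (by omega)

theorem Within.reflTransGen (h : Within r n a b) : Relation.ReflTransGen r a b := by
  induction h with
  | refl n a => exact .refl
  | head h _ ih => exact .head h ih

/-- If every element of a finite set of tasks can be fulfilled in `n` steps and no step undoes a
fulfilled task, then all of them can be fulfilled. -/
theorem Within.exists_forall {ι : Type*} [DecidableEq ι] (s : Finset ι) (I : α → Prop)
    (T : ι → α → Prop) (h : ∀ i ∈ s, ∀ a, I a → ∃ b, Within r n a b ∧ I b ∧ T i b ∧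
      ∀ j ∈ s, T j a → T j b) (a : α) (ha : I a) :
    ∃ b, Within r (s.card * n) a b ∧ I b ∧ ∀ i ∈ s, T i b := by
  suffices H : ∀ t ⊆ s, ∃ b, Within r (t.card * n) a b ∧ I b ∧ ∀ i ∈ t, T i b from
    H s subset_rfl
  intro t
  induction t using Finset.induction_on with
  | empty => exact fun _ => ⟨a, .refl _ _, ha, by simp⟩
  | insert i t hi ih =>
    intro hs
    obtain ⟨b, hb, hIb, hT⟩ := ih ((Finset.subset_insert i t).trans hs)
    obtain ⟨c, hc, hIc, hTc, hpres⟩ := h i (hs (Finset.mem_insert_self i t)) b hIb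
    refine ⟨c, (hb.trans hc).mono ?_, hIc, fun j hj => ?_⟩
    · rw [Finset.card_insert_of_notMem hi]
      ring_nf
      exact le_rfl
    · rcases Finset.mem_insert.1 hj with rfl | hj
      · exact hTc
      · exact hpres j (hs (Finset.mem_insert_of_mem hj)) (hT j hj)

/-- Cutting out the part of a walk between its first vertex and the last vertex with the same
key. -/
theorem exists_last_key {κ : Type*} {key : α → κ} {K : Set κ} (k : κ)
    (h : Relation.ReflTransGen (fun x y => r x y ∧ key x ∈ K) a b) (hb : key b ∈ K) :
    (∃ z, key z = k ∧ (z = b ∨ ∃ z', r z z' ∧ key b ∈ K \ {k} ∧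
      Relation.ReflTransGen (fun x y => r x y ∧ key x ∈ K \ {k}) z' b) ∧
      Relation.ReflTransGen r a z) ∨
    (key b ∈ K \ {k} ∧ Relation.ReflTransGen (fun x y => r x y ∧ key x ∈ K \ {k}) a b) := by
  induction h using Relation.ReflTransGen.head_induction_on with
  | refl =>
    by_cases hk : key b = k
    · exact Or.inl ⟨b, hk, Or.inl rfl, .refl⟩
    · exact Or.inr ⟨⟨hb, hk⟩, .refl⟩
  | @head x y hxy _ ih =>
    rcases ih with ⟨z, hz, hz', h⟩ | ⟨hb', h⟩
    · exact Or.inl ⟨z, hz, hz', .head hxy.1 h⟩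
    · by_cases hk : key x = k
      · exact Or.inl ⟨x, hk, Or.inr ⟨y, hxy.1, hb', h⟩, .refl⟩
      · exact Or.inr ⟨hb', .head ⟨hxy.1, hxy.2, hk⟩ h⟩

/-- If vertices with the same key are at most `D` steps apart, then a walk can be replaced by one
whose length is bounded in terms of the number of keys. -/
theorem within_of_key {κ : Type*} [DecidableEq κ] {key : α → κ} {I : α → Prop} {D : ℕ}
    (hI : ∀ a b, I a → r a b → I b)
    (hD : ∀ a b, I a → I b → key a = key b → Within r D a b) (K : Finset κ) (ha : I a)
    (h : Relation.ReflTransGen (fun x y => r x y ∧ key x ∈ (K : Set κ)) a b)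
    (hb : key b ∈ (K : Set κ)) : Within r (K.card * (D + 1)) a b := by
  have hI' : ∀ {a b}, I a → Relation.ReflTransGen r a b → I b := by
    intro a b ha h
    induction h with
    | refl => exact ha
    | tail _ h ih => exact hI _ _ ih h
  -- Induction on the number of keys that may occur: go in `D` steps from `a` to the last vertex of
  -- the walk with the key of `a`, and take one step of the walk. The rest of the walk avoids this
  -- key.
  induction hn : K.card generalizing K a with
  | zero =>
    rw [Finset.card_eq_zero] at hn
    subst hn
    simp at hb
  | succ n ih =>
    have ha' : key a ∈ K := by
      rcases h.cases_head with rfl | ⟨_, h, _⟩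
      · exact hb
      · exact h.2
    have hK : ((K.erase (key a) : Finset κ) : Set κ) = (K : Set κ) \ {key a} := by simp
    rcases exists_last_key (key a) h hb with ⟨z, hz, hz', haz⟩ | ⟨hb', h'⟩
    · have h₁ := hD a z ha (hI' ha haz) hz.symm
      rcases hz' with rfl | ⟨z', hzz', hb', h'⟩
      · exact h₁.mono (by ring_nf; omega)
      · rw [← hK] at h' hb'
        have h₂ := ih (K.erase (key a)) (hI _ _ (hI' ha haz) hzz') h' hb'
          (by rw [Finset.card_erase_of_mem ha', hn]; rfl)
        exact (h₁.trans (.head hzz' h₂)).mono (by ring_nf; omega)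
    · rcases h'.cases_head with rfl | ⟨_, h', _⟩
      · exact .refl _ _
      · exact absurd rfl h'.2.2

/-- A walk can be replaced by a simple path. -/
theorem exists_simple_path (h : Relation.ReflTransGen r a b) :
    ∃ l : List α, (a :: l).IsChain r ∧ (a :: l).Nodup ∧ (a :: l).getLast (by simp) = b := by
  induction h using Relation.ReflTransGen.head_induction_on with
  | refl => exact ⟨[], by simp⟩
  | @head x y hxy _ ih =>
    obtain ⟨l, hc, hn, hl⟩ := ih
    -- If the path returns to `x`, everything before that visit is a detour and is dropped.
    by_cases hx : x ∈ y :: l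
    · obtain ⟨s, t, hst⟩ := List.append_of_mem hx
      have hs : (x :: t) <:+ (y :: l) := ⟨s, hst.symm⟩
      refine ⟨t, hc.suffix hs, hn.sublist hs.sublist, ?_⟩
      rw [← hl]
      simp only [hst]
      rw [List.getLast_append_of_ne_nil]
    · refine ⟨y :: l, ?_, List.nodup_cons.2 ⟨hx, hn⟩, ?_⟩
      · exact List.isChain_cons_cons.2 ⟨hxy, hc⟩
      · rw [List.getLast_cons (by simp)]
        exact hl

end Within

/-! ### Moving one distinguished token and several indistinguishable ones -/

theorem Adjacent.symm {p q : Pos} (h : Adjacent p q) : Adjacent q p := by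
  obtain ⟨d, rfl⟩ := h
  refine ⟨match d with | .up => .down | .down => .up | .left => .right | .right => .left, ?_⟩
  cases d <;> ext <;> simp [Direction.vec]

theorem Direction.vec_ne_zero (d : Direction) : d.vec ≠ 0 := by
  cases d <;> simp [Direction.vec]

theorem Adjacent.ne {p q : Pos} (h : Adjacent p q) : p ≠ q := by
  obtain ⟨d, rfl⟩ := h
  intro h
  exact d.vec_ne_zero (by simpa using h)

/-- A step of a token to an adjacent vertex of `W` that carries no token. The first component of a
configuration is the position of the distinguished token, the second the set of positions of the
other ones. -/
inductive TokenStep (W : Finset Pos) : Pos × Finset Pos → Pos × Finset Pos → Prop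
  | main {v u : Pos} {S : Finset Pos} : Adjacent v u → u ∈ W → u ∉ S → TokenStep W (v, S) (u, S)
  | other {v a b : Pos} {S : Finset Pos} : Adjacent a b → b ∈ W → a ∉ S → b ∉ S → b ≠ v →
      TokenStep W (v, insert a S) (v, insert b S)

section Tokens

variable (W : Finset Pos)

/-- The configurations whose tokens are on distinct vertices of `W`. -/
def ValidTokens (x : Pos × Finset Pos) : Prop := x.1 ∈ W ∧ x.2 ⊆ W ∧ x.1 ∉ x.2

variable {W}

theorem ValidTokens.step {x y : Pos × Finset Pos} (hx : ValidTokens W x) (h : TokenStep W x y) :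
    ValidTokens W y := by
  obtain ⟨h₁, h₂, h₃⟩ := hx
  cases h with
  | main _ hu hS => exact ⟨hu, h₂, hS⟩
  | other _ hb ha hbS hv =>
    simp only [Finset.insert_subset_iff, Finset.mem_insert, not_or] at h₂ h₃
    refine ⟨h₁, Finset.insert_subset hb h₂.2, ?_⟩
    simpa using ⟨hv.symm, h₃.2⟩

variable (W) in
/-- Adjacency in the graph on `W` from which the vertices that satisfy `X` are removed. -/
def Link (X : Pos → Prop) (x y : Pos) : Prop :=
  Adjacent x y ∧ (x ∈ W ∧ ¬ X x) ∧ (y ∈ W ∧ ¬ X y)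

variable (W) in
/-- Connectedness in the graph on `W` from which the vertices that satisfy `X` are removed. -/
def Linked (X : Pos → Prop) : Pos → Pos → Prop := Relation.ReflTransGen (Link W X)

theorem Linked.symm {X : Pos → Prop} {x y : Pos} (h : Linked W X x y) : Linked W X y x :=
  Relation.ReflTransGen.head_induction_on h .refl fun h _ ih => ih.tail ⟨h.1.symm, h.2.2, h.2.1⟩

theorem Linked.mem {X : Pos → Prop} {x y : Pos} (h : Linked W X x y) (hx : x ∈ W ∧ ¬ X x) :
    y ∈ W ∧ ¬ X y := by
  induction h with
  | refl => exact hx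
  | tail _ h _ => exact h.2.2

/-- If the next vertex `x` of the path carries a token, that token first makes the rest of the
journey, and then the token on `u` takes its place on `x`. Since the tokens are indistinguishable
the result is the same, and each edge of the path is used at most once. -/
theorem within_slide {v u : Pos} (l : List Pos) {S : Finset Pos}
    (hc : (u :: l).IsChain Adjacent) (hl : ∀ x ∈ l, x ∈ W ∧ x ≠ v) (hu : u ∉ S)
    (hw : (u :: l).getLast (by simp) ∉ S) :
    Within (TokenStep W) l.length (v, insert u S)
      (v, insert ((u :: l).getLast (by simp)) S) := by
  induction l generalizing u S with
  | nil => exact .refl _ _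
  | cons x l ih =>
    rw [List.isChain_cons_cons] at hc
    have hx := hl x (by simp)
    have hl' : ∀ y ∈ l, y ∈ W ∧ y ≠ v := fun y hy => hl y (by simp [hy])
    rw [List.getLast_cons (by simp)] at hw ⊢
    set w := (x :: l).getLast (by simp) with hw_def
    -- The path is not assumed to be simple, so it may be closed; then nothing has to move.
    by_cases hwu : w = u
    · rw [hwu]; exact .refl _ _
    by_cases hxS : x ∈ S
    · obtain ⟨S, hxS', rfl⟩ : ∃ S', x ∉ S' ∧ S = insert x S' :=
        ⟨S.erase x, by simp, (Finset.insert_erase hxS).symm⟩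
      simp only [Finset.mem_insert, not_or] at hu hw
      have h₁ := ih (u := x) (S := insert u S) hc.2 hl'
        (by simpa using ⟨Ne.symm hu.1, hxS'⟩) (by simpa using ⟨hwu, hw.2⟩)
      have h₂ : TokenStep W (v, insert u (insert w S)) (v, insert x (insert w S)) :=
        .other hc.1 hx.1 (by simpa using ⟨Ne.symm hwu, hu.2⟩)
          (by simpa using ⟨Ne.symm hw.1, hxS'⟩) hx.2
      rw [Finset.insert_comm u x, Finset.insert_comm w x]
      rw [← hw_def, Finset.insert_comm w u] at h₁
      exact h₁.trans (.single h₂)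
    · exact .head (.other hc.1 hx.1 hu hxS hx.2) (ih hc.2 hl' hxS hw)

open scoped Classical in
variable (W) in
/-- The number of tokens in the connected component of `x`. -/
noncomputable def tokenCount (X : Pos → Prop) (S : Finset Pos) (x : Pos) : ℕ :=
  (S.filter (Linked W X x)).card

theorem tokenCount_insert {X : Pos → Prop} {S : Finset Pos} {x u : Pos} (hu : u ∉ S) :
    tokenCount W X (insert u S) x = tokenCount W X S x + Set.indicator {u | Linked W X x u} 1 u := by
  classical
  unfold tokenCount
  rw [Finset.filter_insert]
  by_cases h : Linked W X x u
  · rw [if_pos h, Finset.card_insert_of_notMem (by simp [hu])]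
    simp [h]
  · rw [if_neg h]
    simp [h]

theorem tokenCount_congr {X : Pos → Prop} {S : Finset Pos} {x u w : Pos} (hu : u ∉ S) (hw : w ∉ S)
    (h : Linked W X u w) : tokenCount W X (insert u S) x = tokenCount W X (insert w S) x := by
  rw [tokenCount_insert hu, tokenCount_insert hw]
  congr 1
  have h' : Linked W X x u ↔ Linked W X x w := ⟨fun h' => h'.trans h, fun h' => h'.trans h.symm⟩
  by_cases hx : Linked W X x u
  · simp [hx, h'.1 hx]
  · simp [hx, mt h'.2 hx]

theorem tokenCount_eq_of_linked {X : Pos → Prop} {S : Finset Pos} {x y : Pos}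
    (h : Linked W X x y) : tokenCount W X S x = tokenCount W X S y := by
  classical
  unfold tokenCount
  congr 1
  ext z
  simp only [Finset.mem_filter]
  exact and_congr_right fun _ => ⟨fun h' => h.symm.trans h', fun h' => h.trans h'⟩

/-- The tokens on `S \ T` are sent one after another to places of `T \ S` in the same component of
the graph without `v`. Equality of the counts guarantees such a place, and a simple path to it has
at most `W.card` edges. -/
theorem within_rearrange {v : Pos} {S T : Finset Pos} (hS : S ⊆ W) (hT : T ⊆ W) (hvS : v ∉ S)
    (hvT : v ∉ T) (h : ∀ x ∈ W, x ≠ v → tokenCount W (· = v) S x = tokenCount W (· = v) T x) :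
    Within (TokenStep W) ((S \ T).card * W.card) (v, S) (v, T) := by
  classical
  induction hn : (S \ T).card generalizing S with
  | zero =>
    have hST : S ⊆ T := Finset.sdiff_eq_empty_iff_subset.1 (Finset.card_eq_zero.1 hn)
    -- When `S ⊆ T`, equal counts in every component leave no room for a further token of `T`.
    suffices hTS : T ⊆ S by
      rw [Finset.Subset.antisymm hST hTS]
      exact .refl _ _
    intro t ht
    have h' := h t (hT ht) (fun h => hvT (h ▸ ht))
    have h_eq := Finset.eq_of_subset_of_card_le
      (Finset.filter_subset_filter (Linked W (· = v) t) hST) h'.ge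
    have ht' : t ∈ T.filter (Linked W (· = v) t) :=
      Finset.mem_filter.2 ⟨ht, Relation.ReflTransGen.refl⟩
    rw [← h_eq] at ht'
    exact (Finset.mem_filter.1 ht').1
  | succ n ih =>
    obtain ⟨u, hu⟩ : (S \ T).Nonempty := Finset.card_pos.1 (by omega)
    obtain ⟨huS, huT⟩ := Finset.mem_sdiff.1 hu
    have huv : u ≠ v := fun h => hvS (h ▸ huS)
    -- If `S` contained all places of `T` in the component of `u`, the equal counts would make these
    -- parts of `S` and `T` equal, although `u` is not in `T`.
    obtain ⟨w, hwT, huw, hwS⟩ : ∃ w ∈ T, Linked W (· = v) u w ∧ w ∉ S := by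
      by_contra! hcon
      have hsub : T.filter (Linked W (· = v) u) ⊆ S.filter (Linked W (· = v) u) := by
        intro w hw
        rw [Finset.mem_filter] at hw ⊢
        exact ⟨hcon w hw.1 hw.2, hw.2⟩
      have h_eq := Finset.eq_of_subset_of_card_le hsub (h u (hS huS) huv).le
      have hu' : u ∈ S.filter (Linked W (· = v) u) :=
        Finset.mem_filter.2 ⟨huS, Relation.ReflTransGen.refl⟩
      rw [← h_eq] at hu'
      exact huT (Finset.mem_filter.1 hu').1
    obtain ⟨S, huS', rfl⟩ : ∃ S', u ∉ S' ∧ S = insert u S' :=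
      ⟨S.erase u, by simp, (Finset.insert_erase huS).symm⟩
    simp only [Finset.mem_insert, not_or, Finset.insert_subset_iff] at hwS hvS hS
    obtain ⟨l, hc, hnd, hl⟩ := exists_simple_path huw
    have hl' : ∀ x ∈ l, x ∈ W ∧ x ≠ v := by
      intro x hx
      have hc' : (u :: l).IsChain fun _ y => y ∈ W ∧ y ≠ v := hc.imp fun _ _ h => h.2.2
      obtain ⟨s, t, rfl⟩ := List.append_of_mem hx
      rcases List.eq_nil_or_concat s with rfl | ⟨s, y, rfl⟩
      · simp only [List.nil_append, List.isChain_cons_cons] at hc'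
        exact hc'.1
      · have := List.isChain_split.1 (show ((u :: s) ++ y :: (x :: t)).IsChain _ by
          simpa using hc')
        exact (List.isChain_cons_cons.1 this.2).1
    have hlen : l.length ≤ W.card := by
      have hsub : l.toFinset ⊆ W := fun x hx => (hl' x (List.mem_toFinset.1 hx)).1
      have := Finset.card_le_card hsub
      rwa [List.toFinset_card_of_nodup (List.nodup_cons.1 hnd).2] at this
    have h₁ := within_slide (v := v) l (hc.imp fun _ _ h => h.1) hl' huS' (by rw [hl]; exact hwS.2)
    rw [hl] at h₁
    have h₂ := ih (S := insert w S) (Finset.insert_subset (hT hwT) hS.2)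
      (by simpa using ⟨fun h => hvT (h ▸ hwT), hvS.2⟩)
      (fun x hx hxv => by rw [← h x hx hxv, tokenCount_congr huS' hwS.2 huw])
      (by
        have : insert u S \ T = insert u (insert w S \ T) := by
          ext x
          simp only [Finset.mem_sdiff, Finset.mem_insert]
          constructor
          · rintro ⟨rfl | hx, hxT⟩
            · exact Or.inl rfl
            · exact Or.inr ⟨Or.inr hx, hxT⟩
          · rintro (rfl | ⟨rfl | hx, hxT⟩)
            · exact ⟨Or.inl rfl, huT⟩
            · exact absurd hwT hxT
            · exact ⟨Or.inr hx, hxT⟩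
        rw [this, Finset.card_insert_of_notMem] at hn
        · omega
        · simp [huS', Ne.symm hwS.1])
    exact (h₁.trans h₂).mono (by ring_nf; omega)

/-- The number of tokens in every connected component of the graph is invariant. -/
theorem TokenStep.tokenCount_eq {x y : Pos × Finset Pos} (hx : ValidTokens W x)
    (h : TokenStep W x y) (p : Pos) :
    tokenCount W (fun _ => False) (insert y.1 y.2) p =
      tokenCount W (fun _ => False) (insert x.1 x.2) p := by
  have hy := hx.step h
  cases h with
  | @main v u S hvu hu hS =>
    exact (tokenCount_congr hx.2.2 hS (.single ⟨hvu, ⟨hx.1, id⟩, ⟨hu, id⟩⟩)).symm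
  | @other v a b S hab hb ha hbS hv =>
    obtain ⟨h₁, h₂, h₃⟩ := hx
    simp only [Finset.insert_subset_iff, Finset.mem_insert, not_or] at h₁ h₂ h₃ ⊢
    rw [Finset.insert_comm v b, Finset.insert_comm v a]
    exact (tokenCount_congr (by simpa using ⟨Ne.symm h₃.1, ha⟩) (by simpa using ⟨hv, hbS⟩)
      (.single ⟨hab, ⟨h₂.1, id⟩, ⟨hb, id⟩⟩)).symm

/-- The position of the distinguished token and the numbers of tokens in the components that are
adjacent to it. -/
noncomputable def tokenKey (W : Finset Pos) (x : Pos × Finset Pos) : Pos × (Direction → ℕ) :=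
  (x.1, fun d => tokenCount W (· = x.1) x.2 (x.1 + d.vec))

/-- A component of the graph without `v` either contains a neighbour of `v`, and then its count is
part of the key, or it is a component of the whole graph, and then `hc` gives equality of the
counts. So `within_rearrange` applies. -/
theorem within_of_tokenKey_eq {x y : Pos × Finset Pos} (hx : ValidTokens W x)
    (hy : ValidTokens W y) (hk : tokenKey W x = tokenKey W y)
    (hc : ∀ p, tokenCount W (fun _ => False) (insert x.1 x.2) p =
      tokenCount W (fun _ => False) (insert y.1 y.2) p) :
    Within (TokenStep W) (W.card * W.card) x y := by
  classical
  obtain ⟨v, S⟩ := x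
  obtain ⟨v', T⟩ := y
  simp only [tokenKey, Prod.mk.injEq] at hk
  obtain ⟨rfl, hk⟩ := hk
  refine (within_rearrange hx.2.1 hy.2.1 hx.2.2 hy.2.2 fun x hxW hxv => ?_).mono
    (Nat.mul_le_mul_right _ (Finset.card_le_card (Finset.sdiff_subset.trans hx.2.1)))
  by_cases h : ∃ d : Direction, Linked W (· = v) x (v + d.vec)
  · obtain ⟨d, hd⟩ := h
    rw [tokenCount_eq_of_linked hd, tokenCount_eq_of_linked hd]
    exact congrFun hk d
  · push Not at h
    -- The component of `x` does not reach any neighbour of `v`, so it does not grow when `v` is put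
    -- back into the graph.
    have key : ∀ y, Linked W (fun _ => False) x y ↔ Linked W (· = v) x y := by
      refine fun y => ⟨fun hxy => ?_, fun hxy =>
        hxy.lift id fun _ _ h => ⟨h.1, ⟨h.2.1.1, id⟩, ⟨h.2.2.1, id⟩⟩⟩
      induction hxy with
      | refl => exact .refl
      | @tail y z _ hyz ih =>
        have hy := ih.mem ⟨hxW, hxv⟩
        refine ih.tail ⟨hyz.1, hy, hyz.2.2.1, ?_⟩
        rintro rfl
        obtain ⟨d, hd⟩ := hyz.1.symm
        exact h d (hd ▸ ih)
    have hv : ¬ Linked W (fun _ => False) x v := fun hxv' =>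
      (((key v).1 hxv').mem ⟨hxW, hxv⟩).2 rfl
    have h_eq : ∀ U : Finset Pos, v ∉ U → tokenCount W (fun _ => False) (insert v U) x =
        tokenCount W (· = v) U x := by
      intro U hU
      rw [tokenCount_insert hU]
      simp only [Set.mem_ofPred_eq, hv, not_false_eq_true, Set.indicator_of_notMem, add_zero]
      unfold tokenCount
      congr 1
      ext y
      simp [key]
    rw [← h_eq S hx.2.2, ← h_eq T hy.2.2]
    exact hc x

/-- The number of steps that suffice to rearrange tokens on a graph with `n` vertices. -/
def tokenBound (n : ℕ) : ℕ := n * (n + 1) ^ 4 * (n * n + 1)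

/-- A key consists of one of `n` positions and four counts between `0` and `n`. Each of the `n * (n
+ 1) ^ 4` keys accounts for at most `n * n` steps between configurations with this key and one step
that leaves it for good. -/
theorem within_tokenBound {x y : Pos × Finset Pos} (hx : ValidTokens W x)
    (h : Relation.ReflTransGen (TokenStep W) x y) :
    Within (TokenStep W) (tokenBound W.card) x y := by
  classical
  have key_mem : ∀ z, ValidTokens W z → tokenKey W z ∈
      W ×ˢ Fintype.piFinset fun _ : Direction => Finset.range (W.card + 1) := by
    intro z hz
    rw [Finset.mem_product, Fintype.mem_piFinset]
    refine ⟨hz.1, fun d => Finset.mem_range.2 (Nat.lt_succ_of_le ?_)⟩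
    exact Finset.card_le_card ((Finset.filter_subset _ _).trans hz.2.1)
  have h' : ∀ y, Relation.ReflTransGen (TokenStep W) x y → ValidTokens W y ∧
      Relation.ReflTransGen (fun a b => TokenStep W a b ∧ tokenKey W a ∈
        ((W ×ˢ Fintype.piFinset fun _ : Direction => Finset.range (W.card + 1) : Finset _) :
          Set (Pos × (Direction → ℕ)))) x y := by
    intro y h
    induction h with
    | refl => exact ⟨hx, .refl⟩
    | tail _ h ih => exact ⟨ih.1.step h, ih.2.tail ⟨h, key_mem _ ih.1⟩⟩
  refine (within_of_key (I := fun z => ValidTokens W z ∧ ∀ p,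
      tokenCount W (fun _ => False) (insert z.1 z.2) p =
        tokenCount W (fun _ => False) (insert x.1 x.2) p)
    (fun a b ha hab => ⟨ha.1.step hab, fun p => (hab.tokenCount_eq ha.1 p).trans (ha.2 p)⟩)
    (fun a b ha hb hab => within_of_tokenKey_eq ha.1 hb.1 hab
      fun p => (ha.2 p).trans (hb.2 p).symm)
    _ ⟨hx, fun _ => rfl⟩ (h' y h).2 (key_mem y (h' y h).1)).mono (le_of_eq ?_)
  rw [Finset.card_product, Fintype.card_piFinset]
  simp only [Finset.card_range, Finset.prod_const, tokenBound]
  rfl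

end Tokens

end PushFight

namespace PushFight

/-! ### A polynomial bound on the number of moves -/

/-- The placement after a piece `a` has gone from `p` to `q`. -/
abbrev Placement.relocate (P : Placement) (p q : Pos) (a : Piece) : Placement :=
  Function.update (Function.update P p none) q (some a)

theorem Placement.relocate_apply (P : Placement) (p q : Pos) (a : Piece) (r : Pos) :
    P.relocate p q a r = if r = q then some a else if r = p then none else P r := by
  simp [Placement.relocate, Function.update_apply]

/-- What the moves of the player `c` preserve: pieces are on squares of the board, the pieces of
the other player are those of `O`, and no king of `c` carries the anchor. -/
structure MovePreserved (B : Board) (c : Color) (O P : Placement) : Prop where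
  mem_squares : ∀ p, P p ≠ none → p ∈ B.squares
  other : ∀ p b, b.color ≠ c → (P p = some b ↔ O p = some b)
  not_anchored : ∀ p b, P p = some b → b.color = c → b.kind ≠ Kind.anchoredKing

/-- The configuration of tokens that belongs to a placement and a king of the player `c`. -/
structure Matches (c : Color) (P : Placement) (x : Pos × Finset Pos) : Prop where
  king : ∃ a, P x.1 = some a ∧ a.color = c ∧ a.kind ≠ Kind.pawn
  own : ∀ p, (∃ a, P p = some a ∧ a.color = c) ↔ p = x.1 ∨ p ∈ x.2
  notMem : x.1 ∉ x.2

open scoped Classical in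
/-- The squares that are not occupied by the other player. -/
noncomputable def freeSquares (B : Board) (c : Color) (O : Placement) : Finset Pos :=
  B.squares.filter fun p => ∀ b, O p = some b → b.color = c

variable {B : Board} {c : Color} {O P P' : Placement}

theorem Move.exists_relocate (h : Move B c P P') : ∃ p q a, ∃ path : List Pos,
    P p = some a ∧ a.color = c ∧ (p :: path).IsChain Adjacent ∧ (p :: path).Nodup ∧
    (∀ r ∈ path, r ∈ B.squares ∧ P r = none) ∧ (p :: path).getLast (by simp) = q ∧
    q ∈ path ∧ P' = P.relocate p q a := by
  obtain ⟨p, q, a, path, hp, ha, hc, hn, hpath, hq, rfl⟩ := h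
  refine ⟨p, q, a, path, hp, ha, hc, hn, hpath, ?_, ?_, rfl⟩
  · rcases path with _ | ⟨r, path⟩
    · simp at hq
    · rw [List.getLast_cons (by simp)]
      rw [List.getLast?_eq_some_getLast (by simp)] at hq
      exact Option.some.inj hq
  · exact List.mem_of_getLast? hq

theorem MovePreserved.move (hP : MovePreserved B c O P) (h : Move B c P P') :
    MovePreserved B c O P' := by
  obtain ⟨p, q, a, path, hp, ha, -, -, hpath, -, hq, rfl⟩ := h.exists_relocate
  have hq' := hpath q hq
  refine ⟨fun r => ?_, fun r b hb => ?_, fun r b => ?_⟩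
  · rw [Placement.relocate_apply]
    split_ifs with h₁ h₂
    · exact fun _ => h₁ ▸ hq'.1
    · exact fun h => absurd rfl h
    · exact hP.mem_squares r
  · rw [← hP.other r b hb, Placement.relocate_apply]
    split_ifs with h₁ h₂
    · subst h₁
      rw [hq'.2]
      simp only [Option.some.injEq, reduceCtorEq, iff_false]
      rintro rfl
      exact hb ha
    · subst h₂
      rw [hp]
      simp only [Option.some.injEq, false_iff]
      rintro rfl
      exact hb ha
    · exact Iff.rfl
  · rw [Placement.relocate_apply]
    split_ifs with h₁ h₂
    · intro h
      cases h
      exact hP.not_anchored p a hp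
    · simp
    · exact hP.not_anchored r b

theorem MovePreserved.mem_freeSquares (hP : MovePreserved B c O P) {r : Pos}
    (hr : r ∈ B.squares) (h : ∀ b, P r = some b → b.color = c) : r ∈ freeSquares B c O := by
  refine Finset.mem_filter.2 ⟨hr, fun b hb => ?_⟩
  by_contra hbc
  exact hbc (h b ((hP.other r b hbc).2 hb))

theorem Matches.valid (hP : MovePreserved B c O P) {x : Pos × Finset Pos} (hx : Matches c P x) :
    ValidTokens (freeSquares B c O) x := by
  have h : ∀ r, (r = x.1 ∨ r ∈ x.2) → r ∈ freeSquares B c O := by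
    intro r hr
    obtain ⟨a, ha, hac⟩ := (hx.own r).2 hr
    refine hP.mem_freeSquares (hP.mem_squares r (by simp [ha])) fun b hb => ?_
    rw [ha] at hb
    cases hb
    exact hac
  exact ⟨h _ (Or.inl rfl), fun r hr => h r (Or.inr hr), hx.notMem⟩

theorem reaches_main {W S : Finset Pos} {v : Pos} (path : List Pos)
    (hc : (v :: path).IsChain Adjacent) (hpath : ∀ r ∈ path, r ∈ W ∧ r ∉ S) :
    Relation.ReflTransGen (TokenStep W) (v, S) ((v :: path).getLast (by simp), S) := by
  induction path generalizing v with
  | nil => exact .refl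
  | cons r path ih =>
    rw [List.isChain_cons_cons] at hc
    rw [List.getLast_cons (by simp)]
    have hr := hpath r (by simp)
    exact .head (.main hc.1 hr.1 hr.2) (ih hc.2 fun t ht => hpath t (by simp [ht]))

theorem reaches_other {W S : Finset Pos} {v p : Pos} (path : List Pos) (hp : p ∉ S)
    (hc : (p :: path).IsChain Adjacent) (hpath : ∀ r ∈ path, r ∈ W ∧ r ∉ S ∧ r ≠ v) :
    Relation.ReflTransGen (TokenStep W) (v, insert p S)
      (v, insert ((p :: path).getLast (by simp)) S) := by
  induction path generalizing p with
  | nil => exact .refl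
  | cons r path ih =>
    rw [List.isChain_cons_cons] at hc
    rw [List.getLast_cons (by simp)]
    have hr := hpath r (by simp)
    exact .head (.other hc.1 hr.1 hp hr.2.1 hr.2.2)
      (ih hr.2.1 hc.2 fun t ht => hpath t (by simp [ht]))

/-- Which king will push is known only at the end, so it is followed backwards: the configuration
before a move is reconstructed from the one after it. The path of the moved piece becomes a sequence
of steps of one token. -/
theorem Matches.of_move (hP : MovePreserved B c O P) (h : Move B c P P') {y : Pos × Finset Pos}
    (hy : Matches c P' y) : ∃ x, Matches c P x ∧
      Relation.ReflTransGen (TokenStep (freeSquares B c O)) x y := by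
  obtain ⟨p, q, a, path, hp, ha, hc, hn, hpath, hl, hq, rfl⟩ := h.exists_relocate
  have hpq : p ≠ q := fun h => (List.nodup_cons.1 hn).1 (h ▸ hq)
  have hW : ∀ r ∈ path, r ∈ freeSquares B c O := fun r hr =>
    hP.mem_freeSquares (hpath r hr).1 fun b hb => by simp [(hpath r hr).2] at hb
  have own_iff : ∀ r, (∃ b, P r = some b ∧ b.color = c) ↔
      r = p ∨ ((r = y.1 ∨ r ∈ y.2) ∧ r ≠ q) := by
    intro r
    rw [← hy.own r, Placement.relocate_apply]
    by_cases hrp : r = p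
    · subst hrp
      simpa [hp] using ha
    · by_cases hrq : r = q
      · subst hrq
        simp [(hpath r hq).2, hrp]
      · simp [hrp, hrq]
  have notMem_iff : ∀ r ∈ path, r ≠ q → r ≠ y.1 ∧ r ∉ y.2 := by
    intro r hr hrq
    have h := mt (own_iff r).2 (by simp [(hpath r hr).2])
    push Not at h
    exact ⟨fun h' => hrq (h.2 (Or.inl h')), fun h' => hrq (h.2 (Or.inr h'))⟩
  have hpy : p ≠ y.1 ∧ p ∉ y.2 := by
    have h := mt (hy.own p).2 (by simp [hpq])
    push Not at h
    exact h
  have hqy : q = y.1 ∨ q ∈ y.2 :=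
    (hy.own q).1 ⟨a, by simp, ha⟩
  obtain ⟨v, S⟩ := y
  -- The moved piece is the pushing king in the first case and an indistinguishable piece in the
  -- second.
  by_cases hqv : q = v
  · subst hqv
    refine ⟨(p, S), ⟨?_, fun r => ?_, hpy.2⟩, ?_⟩
    · obtain ⟨b, hb, hbc, hbk⟩ := hy.king
      simp only [Placement.relocate_apply, if_true, Option.some.injEq] at hb
      subst hb
      exact ⟨a, hp, hbc, hbk⟩
    · rw [own_iff r]
      constructor
      · rintro (rfl | ⟨rfl | h, h'⟩)
        · exact Or.inl rfl
        · exact absurd rfl h'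
        · exact Or.inr h
      · rintro (rfl | h)
        · exact Or.inl rfl
        · exact Or.inr ⟨Or.inr h, fun h' => hy.notMem (h' ▸ h)⟩
    · have h := reaches_main (W := freeSquares B c O) (S := S) path hc fun r hr => ⟨hW r hr, ?_⟩
      · rwa [hl] at h
      · by_cases hrq : r = q
        · rw [hrq]
          exact hy.notMem
        · exact (notMem_iff r hr hrq).2
  · have hqS : q ∈ S := hqy.resolve_left hqv
    have hvS : v ∉ S := hy.notMem
    refine ⟨(v, insert p (S.erase q)), ⟨?_, fun r => ?_, ?_⟩, ?_⟩
    · obtain ⟨b, hb, hbc, hbk⟩ := hy.king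
      rw [Placement.relocate_apply, if_neg (Ne.symm hqv), if_neg (Ne.symm hpy.1)] at hb
      exact ⟨b, hb, hbc, hbk⟩
    · rw [own_iff r]
      simp only [Finset.mem_insert, Finset.mem_erase]
      constructor
      · rintro (rfl | ⟨rfl | h, h'⟩)
        · exact Or.inr (Or.inl rfl)
        · exact Or.inl rfl
        · exact Or.inr (Or.inr ⟨h', h⟩)
      · rintro (rfl | rfl | ⟨h', h⟩)
        · exact Or.inr ⟨Or.inl rfl, Ne.symm hqv⟩
        · exact Or.inl rfl
        · exact Or.inr ⟨Or.inr h, h'⟩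
    · simp only [Finset.mem_insert, Finset.mem_erase, not_or, not_and]
      exact ⟨Ne.symm hpy.1, fun _ => hvS⟩
    · have h := reaches_other (W := freeSquares B c O) (S := S.erase q) (v := v) (p := p) path
        (by simp [hpy.2]) hc fun r hr => ⟨hW r hr, ?_⟩
      · rwa [hl, Finset.insert_erase hqS] at h
      · by_cases hrq : r = q
        · rw [hrq]
          exact ⟨by simp, hqv⟩
        · exact ⟨by simp [(notMem_iff r hr hrq).2], (notMem_iff r hr hrq).1⟩

theorem Matches.eq_none_of_free (hP : MovePreserved B c O P) {x : Pos × Finset Pos}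
    (hx : Matches c P x) {r : Pos} (hr : r ∈ freeSquares B c O) (hr₁ : r ≠ x.1) (hr₂ : r ∉ x.2) :
    P r = none := by
  rcases h : P r with _ | b
  · rfl
  · exfalso
    by_cases hb : b.color = c
    · rcases (hx.own r).1 ⟨b, h, hb⟩ with h' | h'
      · exact hr₁ h'
      · exact hr₂ h'
    · exact hb ((Finset.mem_filter.1 hr).2 b ((hP.other r b hb).1 h))

theorem move_of_adjacent {p q : Pos} {a : Piece} (hp : P p = some a) (ha : a.color = c)
    (hpq : Adjacent p q) (hq : q ∈ B.squares) (hq' : P q = none) :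
    Move B c P (P.relocate p q a) :=
  ⟨p, q, a, [q], hp, ha, by simpa using hpq, by simpa using hpq.ne, by simpa using ⟨hq, hq'⟩,
    rfl, rfl⟩

/-- A token step is itself a move, along a path with one edge. Which piece takes part is read off
from the placement. -/
theorem Matches.exists_move (hP : MovePreserved B c O P) {x y : Pos × Finset Pos}
    (hx : Matches c P x) (h : TokenStep (freeSquares B c O) x y) :
    ∃ P', Move B c P P' ∧ Matches c P' y := by
  have hy := (hx.valid hP).step h
  cases h with
  | @main v u S hvu hu hS =>
    obtain ⟨a, ha, hac, hak⟩ := hx.king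
    refine ⟨P.relocate v u a, move_of_adjacent ha hac hvu (Finset.mem_filter.1 hu).1
      (hx.eq_none_of_free hP hu hvu.ne.symm hS), ⟨a, ?_, hac, hak⟩, fun r => ?_, hS⟩
    · simp
    · have h := hx.own r
      simp only at h ⊢
      rw [Placement.relocate_apply]
      by_cases hru : r = u
      · simpa [hru] using hac
      · by_cases hrv : r = v
        · simp only [hrv, if_true, if_neg hvu.ne, reduceCtorEq, false_and, exists_false, false_iff,
            not_or]
          exact ⟨hvu.ne, hx.notMem⟩
        · simpa [hru, hrv] using h
  | @other v p q S hpq hq hp hqS hqv =>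
    obtain ⟨a, ha, hac⟩ := (hx.own p).2 (Or.inr (Finset.mem_insert_self p S))
    have hpv : v ≠ p := fun h => hx.notMem (by simp [h])
    refine ⟨P.relocate p q a, move_of_adjacent ha hac hpq (Finset.mem_filter.1 hq).1
      (hx.eq_none_of_free hP hq hqv (by simp [hqS, hpq.ne.symm])), ?_, fun r => ?_, hy.2.2⟩
    · obtain ⟨b, hb, hbc, hbk⟩ := hx.king
      exact ⟨b, by simpa [Placement.relocate_apply, hqv.symm, hpv] using hb, hbc, hbk⟩
    · have h := hx.own r
      simp only [Finset.mem_insert] at h ⊢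
      rw [Placement.relocate_apply]
      by_cases hrq : r = q
      · simpa [hrq] using hac
      · by_cases hrp : r = p
        · subst hrp
          simp [hpq.ne, hp, Ne.symm hpv]
        · simpa [hrq, hrp] using h

/-- The player's pieces may be permuted between `P` and `P'`, but none of them is anchored, so each
of them can be pushed. The piece that falls is the opponent's, whose pieces stand on the same
squares in both placements. -/
theorem WinningPush.of_matches {d : Direction} {m : ℕ} {x : Pos × Finset Pos}
    (hP : MovePreserved B c O P) (hP' : MovePreserved B c O P') (hx : Matches c P x)
    (hx' : Matches c P' x) (h : WinningPush B c P x.1 d m) : WinningPush B c P' x.1 d m := by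
  obtain ⟨⟨-, hm, hb, hn, hr⟩, hs, b, hb', hbc⟩ := h
  refine ⟨⟨hx'.king, hm, fun i hi₁ hi₂ => ?_, ?_, hr⟩, hs, b, ?_, hbc⟩
  · obtain ⟨b, hb, hbk⟩ := hb i hi₁ hi₂
    by_cases hbc : b.color = c
    · obtain ⟨b', hb', hbc'⟩ := (hx'.own _).2 ((hx.own _).1 ⟨b, hb, hbc⟩)
      exact ⟨b', hb', hP'.not_anchored _ _ hb' hbc'⟩
    · exact ⟨b, (hP'.other _ _ hbc).2 ((hP.other _ _ hbc).1 hb), hbk⟩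
  · by_contra hne
    exact hs (hP'.mem_squares _ hne)
  · exact (hP'.other _ _ hbc).2 ((hP.other _ _ hbc).1 hb')

/-- The point is `not_anchored`: an anchored white king makes it Black's turn, and then uniqueness
of the anchor excludes an anchored black king. -/
theorem GameState.movePreserved (s : GameState) :
    MovePreserved s.board s.turn s.piece s.piece := by
  refine ⟨s.piece_mem, fun _ _ _ => Iff.rfl, fun p b hb hbc hbk => ?_⟩
  have hp := s.piece_mem p (by simp [hb])
  obtain ⟨col, kind⟩ := b
  simp only at hbc hbk
  subst hbk
  unfold GameState.turn at hbc
  split_ifs at hbc with h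
  · obtain ⟨q, hq, hq'⟩ := h
    have := s.anchor_unique p q _ _ hb hq' rfl rfl
    subst this
    rw [hb] at hq'
    cases hq'
    cases hbc
  · exact h ⟨p, hp, hbc ▸ hb⟩

theorem exists_moves_of_within {n : ℕ} {x y : Pos × Finset Pos}
    (h : Within (TokenStep (freeSquares B c O)) n x y) (hP : MovePreserved B c O P)
    (hx : Matches c P x) : ∃ P', Within (Move B c) n P P' ∧ MovePreserved B c O P' ∧
      Matches c P' y := by
  induction h generalizing P with
  | refl n a => exact ⟨P, .refl _ _, hP, hx⟩
  | head h _ ih =>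
    obtain ⟨Q, hQ, hQ'⟩ := hx.exists_move hP h
    obtain ⟨P', h₁, h₂, h₃⟩ := ih (hP.move hQ) hQ'
    exact ⟨P', .head hQ h₁, h₂, h₃⟩

theorem MovePreserved.reflTransGen (hP : MovePreserved B c O P)
    (h : Relation.ReflTransGen (Move B c) P P') : MovePreserved B c O P' := by
  induction h with
  | refl => exact hP
  | tail _ h ih => exact ih.move h

theorem exists_matches_of_moves (hP : MovePreserved B c O P)
    (h : Relation.ReflTransGen (Move B c) P P') {y : Pos × Finset Pos} (hy : Matches c P' y) :
    ∃ x, Matches c P x ∧ Relation.ReflTransGen (TokenStep (freeSquares B c O)) x y := by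
  induction h generalizing y with
  | refl => exact ⟨y, hy, .refl⟩
  | tail h₁ h₂ ih =>
    obtain ⟨x, hx, hxy⟩ := hy.of_move (hP.reflTransGen h₁) h₂
    obtain ⟨w, hw, hwx⟩ := ih hx
    exact ⟨w, hw, hwx.trans hxy⟩

theorem within_iff_exists_seq {α : Type*} {r : α → α → Prop} {n : ℕ} {a b : α} :
    Within r n a b ↔ ∃ (l : ℕ) (C : ℕ → α), l ≤ n ∧ C 0 = a ∧ (∀ i < l, r (C i) (C (i + 1))) ∧
      C l = b := by
  constructor
  · intro h
    induction h with
    | refl n a => exact ⟨0, fun _ => a, Nat.zero_le _, rfl, by simp, rfl⟩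
    | @head n a b c h _ ih =>
      obtain ⟨l, C, hl, h0, hC, hb⟩ := ih
      refine ⟨l + 1, fun i => Nat.casesOn i a C, by omega, rfl, fun i hi => ?_, hb⟩
      cases i with
      | zero => simpa [h0] using h
      | succ i => exact hC i (by omega)
  · rintro ⟨l, C, hl, rfl, hC, rfl⟩
    refine Within.mono ?_ hl
    clear hl
    induction l generalizing C with
    | zero => exact .refl _ _
    | succ l ih =>
      exact .head (hC 0 (by omega)) (ih (fun i => C (i + 1)) fun i hi => hC (i + 1) (by omega))

/-- The player can win this turn if and only if they can do so by few moves and one push. -/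
theorem GameState.mateInOne_iff (s : GameState) (k : ℕ) :
    s.MateInOne k ↔ ∃ P, Within (Move s.board s.turn) (min k (tokenBound s.board.squares.card))
      s.piece P ∧ ∃ p d m, WinningPush s.board s.turn P p d m := by
  classical
  constructor
  · rintro ⟨l, C, hl, h0, hC, p, d, m, hw⟩
    rcases le_or_gt l (tokenBound s.board.squares.card) with hle | hlt
    · exact ⟨C l, within_iff_exists_seq.2 ⟨l, C, le_min hl hle, h0, hC, rfl⟩, p, d, m, hw⟩
    -- In this case `tokenBound` is less than `l` and hence less than `k`, so the rearranged
    -- sequence respects both bounds.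
    · have h₁ : Relation.ReflTransGen (Move s.board s.turn) s.piece (C l) :=
        (within_iff_exists_seq.2 ⟨l, C, le_rfl, h0, hC, rfl⟩).reflTransGen
      have hP := s.movePreserved
      have hP' := hP.reflTransGen h₁
      have hy : Matches s.turn (C l) (p, s.board.squares.filter fun r =>
          r ≠ p ∧ ∃ a, C l r = some a ∧ a.color = s.turn) := by
        refine ⟨hw.1.1, fun r => ?_, by simp⟩
        simp only [Finset.mem_filter]
        constructor
        · rintro ⟨a, ha, hac⟩
          by_cases hr : r = p
          · exact Or.inl hr
          · exact Or.inr ⟨hP'.mem_squares r (by simp [ha]), hr, a, ha, hac⟩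
        · rintro (rfl | ⟨-, -, h⟩)
          · obtain ⟨a, ha, hac, -⟩ := hw.1.1
            exact ⟨a, ha, hac⟩
          · exact h
      obtain ⟨x, hx, hxy⟩ := exists_matches_of_moves hP h₁ hy
      obtain ⟨P, hP₁, hP₂, hP₃⟩ :=
        exists_moves_of_within (within_tokenBound (hx.valid hP) hxy) hP hx
      have hcard : (freeSquares s.board s.turn s.piece).card ≤ s.board.squares.card :=
        Finset.card_le_card (Finset.filter_subset _ _)
      have hbound : tokenBound (freeSquares s.board s.turn s.piece).card ≤
          tokenBound s.board.squares.card := by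
        unfold tokenBound
        gcongr
      exact ⟨P, hP₁.mono (le_min (by omega) hbound), p, d, m,
        WinningPush.of_matches hP' hP₂ hy hP₃ hw⟩
  · rintro ⟨P, h, p, d, m, hw⟩
    obtain ⟨l, C, hl, h0, hC, rfl⟩ := within_iff_exists_seq.1 h
    exact ⟨l, C, hl.trans (min_le_left _ _), h0, hC, p, d, m, hw⟩

end PushFight

namespace PushFight

/-! ### A nondeterministic verifier that works on single cells -/

/-- What the verifier writes on a cell: the piece that stands there at present, and marks that say
that this piece is being moved, that the cell is known to be connected to the first marked one, that
a win has been found, that a push in a direction reaches the cell, and that the neighbour in a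
direction is not a square of the board. -/
structure CellState where
  occupant : Option Piece
  active : Bool
  visited : Bool
  won : Bool
  pushed : Direction → Bool
  void : Direction → Bool

instance : Finite CellState :=
  Finite.of_injective (fun x : CellState =>
    (x.occupant, x.active, x.visited, x.won, x.pushed, x.void)) fun x y h => by
      cases x
      cases y
      simpa using h

/-- The cell state that shows an occupant only. -/
def CellState.initial (o : Option Piece) : CellState :=
  ⟨o, false, false, false, fun _ => false, fun _ => false⟩

/-- `seed` starts the exploration of the board at one square, `grab` and `release` begin and end a
move, `startPush` marks the pushing king, and `win` records that a push drives an opposing piece off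
the board. -/
inductive SoloAction
  | seed
  | startPush (d : Direction)
  | win (d : Direction)
  | release
  | grab
  deriving DecidableEq, Fintype

/-- `visit` extends the explored part of the board to a neighbour, `walk` carries the grabbed piece
to the next square, and `extendPush` adds the next piece to the row that is pushed. -/
inductive PairAction
  | visit
  | walk
  | extendPush
  deriving DecidableEq

/-- The condition that a solo action puts on all squares. -/
def SoloAction.Guard : SoloAction → CellState → Prop
  | seed, x => x.visited = false
  | startPush _, x => x.active = false
  | grab, x => x.active = false ∧ ∀ d, x.pushed d = false
  | _, _ => True

/-- The condition that a solo action puts on its square. -/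
def SoloAction.Pre (c : Color) (rail : Direction → Bool) : SoloAction → CellState → Prop
  | startPush _, x => ∃ a, x.occupant = some a ∧ a.color = c ∧ a.kind ≠ Kind.pawn
  | win d, x => x.pushed d = true ∧ x.void d = true ∧ rail d = false ∧
      ∃ b, x.occupant = some b ∧ b.color ≠ c
  | grab, x => ∃ a, x.occupant = some a ∧ a.color = c
  | _, _ => True

def SoloAction.effect : SoloAction → CellState → CellState
  | seed, x => { x with visited := true }
  | startPush d, x => { x with pushed := Function.update x.pushed d true }
  | win _, x => { x with won := true }
  | release, x => { x with active := false }
  | grab, x => { x with active := true }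

/-- The condition that an action in direction `d` puts on a square and its neighbour. -/
def PairAction.Pre (d : Direction) : PairAction → CellState → CellState → Prop
  | visit, x, _ => x.visited = true
  | walk, x, y => x.active = true ∧ y.occupant = none
  | extendPush, x, y => x.pushed d = true ∧
      ∃ b, y.occupant = some b ∧ b.kind ≠ Kind.anchoredKing

def PairAction.source : PairAction → CellState → CellState
  | walk, x => { x with occupant := none, active := false }
  | _, x => x

def PairAction.target (d : Direction) : PairAction → CellState → CellState → CellState
  | visit, _, y => { y with visited := true }
  | walk, x, y => { y with occupant := x.occupant, active := true }
  | extendPush, _, y => { y with pushed := Function.update y.pushed d true }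

def CellState.markVoid (d : Direction) (x : CellState) : CellState :=
  { x with void := Function.update x.void d true }

/-- The number with the given binary digits, least significant digit first. -/
def bitsValue : List Bool → ℕ
  | [] => 0
  | b :: l => b.toNat + 2 * bitsValue l

/-- The second list of binary digits is obtained from the first one by subtracting one. -/
inductive Decrement : List Bool → List Bool → Prop
  | here (l : List Bool) : Decrement (true :: l) (false :: l)
  | borrow {l l' : List Bool} : Decrement l l' → Decrement (false :: l) (true :: l')

theorem Decrement.value {l l' : List Bool} (h : Decrement l l') :
    bitsValue l = bitsValue l' + 1 := by
  induction h with
  | here l => simp [bitsValue]; omega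
  | borrow _ ih => simp [bitsValue, ih]; omega

theorem Decrement.length {l l' : List Bool} (h : Decrement l l') : l.length = l'.length := by
  induction h with
  | here l => rfl
  | borrow _ ih => simp [ih]

theorem exists_decrement {l : List Bool} (h : 0 < bitsValue l) : ∃ l', Decrement l l' := by
  induction l with
  | nil => simp [bitsValue] at h
  | cons b l ih =>
    cases b
    · obtain ⟨l', hl'⟩ := ih (by simpa [bitsValue] using h)
      exact ⟨_, .borrow hl'⟩
    · exact ⟨_, .here l⟩

/-- The steps of the verifier for a set of squares with side rails and a player. Its state consists
of a number in binary and a state of every cell. -/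
inductive VerifierStep (sq : Set Pos) (rail : Pos → Direction → Bool) (c : Color) :
    List Bool × (Pos → CellState) → List Bool × (Pos → CellState) → Prop
  | solo {l : List Bool} {D : Pos → CellState} (a : SoloAction) (p : Pos) : a ≠ .grab → p ∈ sq →
      (∀ q ∈ sq, a.Guard (D q)) → a.Pre c (rail p) (D p) →
      VerifierStep sq rail c (l, D) (l, Function.update D p (a.effect (D p)))
  | grab {l l' : List Bool} {D : Pos → CellState} (p : Pos) : Decrement l l' → p ∈ sq →
      (∀ q ∈ sq, SoloAction.grab.Guard (D q)) → SoloAction.grab.Pre c (rail p) (D p) →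
      VerifierStep sq rail c (l, D) (l', Function.update D p (SoloAction.grab.effect (D p)))
  | pair {l : List Bool} {D : Pos → CellState} (a : PairAction) (d : Direction) (p : Pos) :
      p ∈ sq → p + d.vec ∈ sq → a.Pre d (D p) (D (p + d.vec)) →
      VerifierStep sq rail c (l, D) (l, Function.update (Function.update D p (a.source (D p)))
        (p + d.vec) (a.target d (D p) (D (p + d.vec))))
  | void {l : List Bool} {D : Pos → CellState} (d : Direction) (p : Pos) :
      p ∈ sq → p + d.vec ∉ sq →
      VerifierStep sq rail c (l, D) (l, Function.update D p ((D p).markVoid d))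

/-- The verifier accepts: all squares are connected, there are rails on boundary edges only, and a
win has been found. -/
structure Verified (sq : Set Pos) (rail : Pos → Direction → Bool) (D : Pos → CellState) : Prop where
  visited : ∀ p ∈ sq, (D p).visited = true
  void : ∀ p ∈ sq, ∀ d, rail p d = true → (D p).void d = true
  won : ∃ p ∈ sq, (D p).won = true

theorem add_vec_ne (p : Pos) (d : Direction) : p + d.vec ≠ p := by
  simpa using d.vec_ne_zero

/-! ### Soundness of the verifier: invariants of its marks -/

section Soundness

variable {sq : Set Pos} {rail : Pos → Direction → Bool} {c : Color}

/-- What the marks on the board have verified about it. -/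
structure BoardMarks (sq : Set Pos) (D : Pos → CellState) : Prop where
  mem : ∀ p, (D p).visited = true → p ∈ sq
  connected : ∀ p q, (D p).visited = true → (D q).visited = true →
    Relation.ReflTransGen (fun a b => Adjacent a b ∧ b ∈ sq) p q
  void : ∀ p d, (D p).void d = true → p + d.vec ∉ sq

theorem BoardMarks.of_eq {D D' : Pos → CellState} (h : BoardMarks sq D)
    (hv : ∀ p, (D' p).visited = (D p).visited) (hd : ∀ p, (D' p).void = (D p).void) :
    BoardMarks sq D' := by
  refine ⟨fun p hp => h.mem p (by rwa [← hv]), fun p q hp hq => h.connected p q ?_ ?_,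
    fun p d hp => h.void p d (by rwa [← hd])⟩
  · rwa [← hv]
  · rwa [← hv]

/-- Only `seed`, `visit` and `void` make these marks. The guard of `seed` requires that no square
has been visited, so all visited squares stem from a single seed and are connected to each other. -/
theorem BoardMarks.step {x y : List Bool × (Pos → CellState)} (h : BoardMarks sq x.2)
    (hxy : VerifierStep sq rail c x y) : BoardMarks sq y.2 := by
  cases hxy with
  | @solo l D a p ha hp hg hpre =>
    by_cases hs : a = .seed
    · subst hs
      have hD : ∀ q, (Function.update D p (SoloAction.seed.effect (D p)) q).visited = true →
          q = p := by
        intro q hq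
        by_contra hqp
        rw [Function.update_of_ne hqp] at hq
        have := hg q (h.mem q hq)
        simp only [SoloAction.Guard] at this
        simp [this] at hq
      refine ⟨fun q hq => hD q hq ▸ hp, fun q r hq hr => ?_, fun q d hq => h.void q d ?_⟩
      · rw [hD q hq, hD r hr]
      · by_cases hqp : q = p
        · subst hqp
          simpa [SoloAction.effect] using hq
        · simpa [Function.update_of_ne hqp] using hq
    · refine h.of_eq (fun q => ?_) (fun q => ?_) <;>
      · simp only [Function.update_apply]
        split_ifs with hq
        · subst hq
          cases a <;> first | rfl | exact absurd rfl hs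
        · rfl
  | @grab l l' D p _ hp hg hpre =>
    refine h.of_eq (fun q => ?_) (fun q => ?_) <;>
    · simp only [Function.update_apply]
      split_ifs with hq
      · subst hq
        rfl
      · rfl
  | @pair l D a d p hp hpd hpre =>
    by_cases hs : a = .visit
    · subst hs
      have hpre : (D p).visited = true := hpre
      simp only [PairAction.source, Function.update_eq_self] at h ⊢
      have hD : ∀ q, (Function.update D (p + d.vec)
          (PairAction.visit.target d (D p) (D (p + d.vec))) q).visited = true →
          q = p + d.vec ∨ (D q).visited = true := by
        intro q hq
        by_cases hqp : q = p + d.vec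
        · exact Or.inl hqp
        · exact Or.inr (by simpa [Function.update_of_ne hqp] using hq)
      have h₁ : ∀ q, (D q).visited = true →
          Relation.ReflTransGen (fun a b => Adjacent a b ∧ b ∈ sq) q (p + d.vec) :=
        fun q hq => (h.connected q p hq hpre).tail ⟨⟨d, rfl⟩, hpd⟩
      have h₂ : ∀ q, (D q).visited = true →
          Relation.ReflTransGen (fun a b => Adjacent a b ∧ b ∈ sq) (p + d.vec) q :=
        fun q hq => .head ⟨Adjacent.symm ⟨d, rfl⟩, hp⟩ (h.connected p q hpre hq)
      refine ⟨fun q hq => ?_, fun q r hq hr => ?_, fun q e hq => h.void q e ?_⟩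
      · rcases hD q hq with rfl | hq
        · exact hpd
        · exact h.mem q hq
      · rcases hD q hq with rfl | hq <;> rcases hD r hr with rfl | hr
        · exact .refl
        · exact h₂ r hr
        · exact h₁ q hq
        · exact h.connected q r hq hr
      · by_cases hqp : q = p + d.vec
        · subst hqp
          simpa [PairAction.target] using hq
        · simpa [Function.update_of_ne hqp] using hq
    · refine h.of_eq (fun q => ?_) (fun q => ?_) <;>
      · simp only [Function.update_apply]
        split_ifs with hq hq'
        · subst hq
          cases a <;> first | rfl | exact absurd rfl hs
        · subst hq'
          cases a <;> rfl
        · rfl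
  | @void l D d p hp hpd =>
    have hv : ∀ q, (Function.update D p ((D p).markVoid d) q).visited = (D q).visited := by
      intro q
      rw [Function.update_apply]
      split_ifs with hq
      · subst hq
        rfl
      · rfl
    refine ⟨fun q hq => h.mem q (by rwa [← hv]), fun q r hq hr => h.connected q r ?_ ?_,
      fun q e hq => ?_⟩
    · rwa [← hv]
    · rwa [← hv]
    · by_cases hqp : q = p
      · subst hqp
        simp only [Function.update_self, CellState.markVoid, Function.update_apply] at hq
        split_ifs at hq with he
        · subst he
          exact hpd
        · exact h.void q e hq
      · exact h.void q e (by simpa [Function.update_of_ne hqp] using hq)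

/-- The placement that the verifier has reached: it is obtained from the initial placement by some
moves, possibly followed by a part of a move. -/
def MoveMarks (s : GameState) (k : ℕ) (l : List Bool) (D : Pos → CellState) : Prop :=
  ∃ n P, Within (Move s.board s.turn) n s.piece P ∧
    (((∀ p, (D p).active = false) ∧ (∀ p, (D p).occupant = P p) ∧ n + bitsValue l ≤ k) ∨
      ∃ p q a, (∀ r, (D r).active = true ↔ r = q) ∧ (∀ r d, (D r).pushed d = false) ∧
        P p = some a ∧ a.color = s.turn ∧
        Relation.ReflTransGen (fun x y => Adjacent x y ∧ y ∈ s.board.squares ∧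
          (P y = none ∨ y = p)) p q ∧
        (∀ r, (D r).occupant = P.relocate p q a r) ∧ n + 1 + bitsValue l ≤ k)

/-- What the marks on the board have verified about the game. -/
structure GameMarks (s : GameState) (k : ℕ) (l : List Bool) (D : Pos → CellState) : Prop where
  moves : MoveMarks s k l D
  pushed_mem : ∀ p d, (D p).pushed d = true → p ∈ s.board.squares
  active_mem : ∀ p, (D p).active = true → p ∈ s.board.squares
  pushed : ∀ p d, (D p).pushed d = true → ∃ (p₀ : Pos) (m : ℕ), p = p₀ + m • d.vec ∧
    (∃ a, (D p₀).occupant = some a ∧ a.color = s.turn ∧ a.kind ≠ Kind.pawn) ∧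
    ∀ i : ℕ, 1 ≤ i → i ≤ m →
      ∃ b, (D (p₀ + i • d.vec)).occupant = some b ∧ b.kind ≠ Kind.anchoredKing
  won : (∃ p, (D p).won = true) → s.MateInOne k

/-- Push marks are mentioned only in the case that a move is in progress, so otherwise they may
change. -/
theorem MoveMarks.of_eq {s : GameState} {k : ℕ} {l : List Bool} {D D' : Pos → CellState}
    (h : MoveMarks s k l D) (ho : ∀ p, (D' p).occupant = (D p).occupant)
    (ha : ∀ p, (D' p).active = (D p).active)
    (hd : (∃ p, (D p).active = true) → ∀ p, (D' p).pushed = (D p).pushed) :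
    MoveMarks s k l D' := by
  obtain ⟨n, P, hP, h | ⟨p, q, a, h₁, h₂, h₃, h₄, h₅, h₆, h₇⟩⟩ := h
  · exact ⟨n, P, hP, Or.inl (by simpa [ho, ha] using h)⟩
  · exact ⟨n, P, hP, Or.inr ⟨p, q, a, by simpa [ha] using h₁,
      by simpa [hd ⟨q, (h₁ q).2 rfl⟩] using h₂, h₃, h₄, h₅, by simpa [ho] using h₆, h₇⟩⟩

theorem GameMarks.of_eq {s : GameState} {k : ℕ} {l : List Bool} {D D' : Pos → CellState}
    (h : GameMarks s k l D) (ho : ∀ p, (D' p).occupant = (D p).occupant)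
    (ha : ∀ p, (D' p).active = (D p).active) (hd : ∀ p, (D' p).pushed = (D p).pushed)
    (hw : ∀ p, (D' p).won = (D p).won) : GameMarks s k l D' := by
  refine ⟨h.moves.of_eq ho ha fun _ => hd, ?_, ?_, ?_, ?_⟩
  · simpa only [hd] using h.pushed_mem
  · simpa only [ha] using h.active_mem
  · simpa only [hd, ho] using h.pushed
  · simpa only [hw] using h.won

theorem Placement.relocate_self {P : Placement} {p : Pos} {a : Piece} (h : P p = some a) :
    P.relocate p p a = P := by
  funext r
  rw [Placement.relocate_apply]
  split_ifs with hr
  · rw [hr, h]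
  · rfl

/-- Ending a move. -/
theorem MoveMarks.release {s : GameState} {k : ℕ} {l : List Bool} {D D' : Pos → CellState}
    (h : MoveMarks s k l D) (p : Pos) (ho : ∀ r, (D' r).occupant = (D r).occupant)
    (ha : ∀ r, r ≠ p → (D' r).active = (D r).active) (hp : (D' p).active = false)
    (hd : ∀ p, (D' p).pushed = (D p).pushed) : MoveMarks s k l D' := by
  by_cases hDp : (D p).active = true
  · obtain ⟨n, P, hP, h | ⟨p', q, a, h₁, h₂, h₃, h₄, h₅, h₆, h₇⟩⟩ := h
    · simp [h.1] at hDp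
    obtain rfl := (h₁ p).1 hDp
    have hact : ∀ r, (D' r).active = false := by
      intro r
      by_cases hr : r = p
      · rw [hr, hp]
      · rw [ha r hr]
        simpa using mt (h₁ r).1 hr
    have hocc : ∀ r, (D' r).occupant = P.relocate p' p a r := fun r => (ho r).trans (h₆ r)
    -- A piece that is back on its own square has made no move, since a simple path cannot return to
    -- its start. The unit taken from the counter is lost, which does no harm to the bound.
    by_cases hpp : p = p'
    · subst hpp
      rw [Placement.relocate_self h₃] at hocc
      exact ⟨n, P, hP, Or.inl ⟨hact, hocc, by omega⟩⟩
    -- The walk may have visited squares repeatedly, including its starting square `p'`. A simple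
    -- path does not come back to `p'`, so all of its further squares are empty in `P`.
    · obtain ⟨path, hc, hn, hl⟩ := exists_simple_path h₅
      have hmem : ∀ r ∈ path, r ∈ s.board.squares ∧ P r = none := by
        intro r hr
        obtain ⟨t, u, htu⟩ := List.append_of_mem hr
        have hne : r ≠ p' := fun h => (List.nodup_cons.1 hn).1 (h ▸ hr)
        have hc' : (p' :: path).IsChain fun _ y => y ∈ s.board.squares ∧ (P y = none ∨ y = p') :=
          hc.imp fun _ _ h => h.2
        have hr' : r ∈ s.board.squares ∧ (P r = none ∨ r = p') := by
          rw [htu] at hc'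
          rcases List.eq_nil_or_concat t with rfl | ⟨t, y, rfl⟩
          · exact (List.isChain_cons_cons.1 hc').1
          · have := List.isChain_split.1 (show ((p' :: t) ++ y :: (r :: u)).IsChain _ by
              simpa using hc')
            exact (List.isChain_cons_cons.1 this.2).1
        exact ⟨hr'.1, hr'.2.resolve_right hne⟩
      have hpath : path ≠ [] := by
        rintro rfl
        exact hpp (by simpa using hl.symm)
      rw [List.getLast_cons hpath] at hl
      have hmove : Move s.board s.turn P (P.relocate p' p a) :=
        ⟨p', p, a, path, h₃, h₄, hc.imp fun _ _ h => h.1, hn, hmem,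
          by rw [List.getLast?_eq_some_getLast hpath, hl], rfl⟩
      exact ⟨n + 1, _, hP.trans (.single hmove), Or.inl ⟨hact, hocc, h₇⟩⟩
  · refine h.of_eq ho (fun r => ?_) fun _ => hd
    by_cases hr : r = p
    · rw [hr, hp]
      simpa using Eq.symm (by simpa using hDp)
    · exact ha r hr

/-- Push marks are never removed, `grab` requires that there are none, and `startPush` requires that
no piece is grabbed. So a move and a push never overlap: from the first push mark on the placement
is frozen, and every push mark continues to certify a row of pushable pieces that starts next to a
king. -/
theorem GameMarks.step {s : GameState} {k : ℕ} {x y : List Bool × (Pos → CellState)}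
    (h : GameMarks s k x.1 x.2)
    (hvoid : ∀ p d, (x.2 p).void d = true → p + d.vec ∉ s.board.squares)
    (hxy : VerifierStep (s.board.squares : Set Pos)
      (fun p d => decide ((p, d) ∈ s.board.rails)) s.turn x y) :
    GameMarks s k y.1 y.2 := by
  cases hxy with
  | @solo l D a p ha hp hg hpre =>
    simp only at h hvoid ⊢
    cases a with
    | seed =>
      refine h.of_eq (fun q => ?_) (fun q => ?_) (fun q => ?_) (fun q => ?_) <;>
      · simp only [Function.update_apply]
        split_ifs with hq
        · subst hq
          rfl
        · rfl
    | grab => exact absurd rfl ha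
    | release =>
      have hD : ∀ q, (Function.update D p (SoloAction.release.effect (D p)) q).occupant =
          (D q).occupant ∧ (Function.update D p (SoloAction.release.effect (D p)) q).pushed =
          (D q).pushed ∧ (Function.update D p (SoloAction.release.effect (D p)) q).won =
          (D q).won := by
        intro q
        simp only [Function.update_apply]
        split_ifs with hq
        · subst hq
          exact ⟨rfl, rfl, rfl⟩
        · exact ⟨rfl, rfl, rfl⟩
      have hact : ∀ q, q ≠ p → (Function.update D p (SoloAction.release.effect (D p)) q).active =
          (D q).active := fun q hq => by rw [Function.update_of_ne hq]
      have hact' : (Function.update D p (SoloAction.release.effect (D p)) p).active = false := by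
        simp [SoloAction.effect]
      refine ⟨h.moves.release p (fun q => (hD q).1) hact hact' fun q => (hD q).2.1, ?_, ?_, ?_, ?_⟩
      · simpa only [(hD _).2.1] using h.pushed_mem
      · intro q hq
        by_cases hqp : q = p
        · exact hqp ▸ hp
        · exact h.active_mem q (by rwa [← hact q hqp])
      · simpa only [(hD _).2.1, (hD _).1] using h.pushed
      · simpa only [(hD _).2.2] using h.won
    | startPush d =>
      have hD : ∀ q, (Function.update D p ((SoloAction.startPush d).effect (D p)) q).occupant =
          (D q).occupant ∧ (Function.update D p ((SoloAction.startPush d).effect (D p)) q).active =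
          (D q).active ∧ (Function.update D p ((SoloAction.startPush d).effect (D p)) q).won =
          (D q).won := by
        intro q
        simp only [Function.update_apply]
        split_ifs with hq
        · subst hq
          exact ⟨rfl, rfl, rfl⟩
        · exact ⟨rfl, rfl, rfl⟩
      have hpush : ∀ q e, (Function.update D p ((SoloAction.startPush d).effect (D p)) q).pushed e =
          true → (q = p ∧ e = d) ∨ (D q).pushed e = true := by
        intro q e hq
        by_cases hqp : q = p
        · subst hqp
          simp only [Function.update_self, SoloAction.effect, Function.update_apply] at hq
          split_ifs at hq with he
          · exact Or.inl ⟨rfl, he⟩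
          · exact Or.inr hq
        · exact Or.inr (by simpa [Function.update_of_ne hqp] using hq)
      refine ⟨h.moves.of_eq (fun q => (hD q).1) (fun q => (hD q).2.1) ?_, ?_, ?_, ?_, ?_⟩
      · rintro ⟨r, hr⟩
        have := hg r (h.active_mem r hr)
        simp only [SoloAction.Guard] at this
        simp [this] at hr
      · intro q e hq
        rcases hpush q e hq with ⟨rfl, -⟩ | hq
        · exact hp
        · exact h.pushed_mem q e hq
      · simpa only [(hD _).2.1] using h.active_mem
      · intro q e hq
        simp only [(hD _).1]
        rcases hpush q e hq with ⟨rfl, rfl⟩ | hq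
        · exact ⟨q, 0, by simp, hpre, fun i hi hi' => by omega⟩
        · exact h.pushed q e hq
      · simpa only [(hD _).2.2] using h.won
    | win d =>
      have hD : ∀ q, (Function.update D p ((SoloAction.win d).effect (D p)) q).occupant =
          (D q).occupant ∧ (Function.update D p ((SoloAction.win d).effect (D p)) q).active =
          (D q).active ∧ (Function.update D p ((SoloAction.win d).effect (D p)) q).pushed =
          (D q).pushed := by
        intro q
        simp only [Function.update_apply]
        split_ifs with hq
        · subst hq
          exact ⟨rfl, rfl, rfl⟩
        · exact ⟨rfl, rfl, rfl⟩
      refine ⟨h.moves.of_eq (fun q => (hD q).1) (fun q => (hD q).2.1) fun _ q => (hD q).2.2,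
        by simpa only [(hD _).2.2] using h.pushed_mem,
        by simpa only [(hD _).2.1] using h.active_mem,
        by simpa only [(hD _).2.2, (hD _).1] using h.pushed, fun _ => ?_⟩
      obtain ⟨hpush, hv, hrail, b, hb, hbc⟩ := hpre
      obtain ⟨n, P, hP, h' | ⟨-, -, -, -, h', -⟩⟩ := h.moves
      · obtain ⟨p₀, m, rfl, ⟨a, ha, hac, hak⟩, hm⟩ := h.pushed p d hpush
        obtain ⟨-, hocc, hn⟩ := h'
        simp only [hocc] at ha hm hb
        have hoff := hvoid _ _ hv
        rw [add_assoc, ← succ_nsmul] at hoff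
        have hpres := s.movePreserved.reflTransGen hP.reflTransGen
        obtain ⟨l', C, hl', h0, hC, rfl⟩ := within_iff_exists_seq.1 hP
        refine ⟨l', C, by omega, h0, hC, p₀, d, m, ⟨⟨a, ha, hac, hak⟩, ?_, hm, ?_, ?_⟩, hoff,
          b, hb, hbc⟩
        -- For `m = 0` the falling piece would be the pushing king itself, which has the wrong
        -- color.
        · rcases Nat.eq_zero_or_pos m with rfl | hm
          · rw [zero_nsmul, add_zero, ha] at hb
            cases hb
            exact absurd hac hbc
          · exact hm
        · by_contra hne
          exact hoff (hpres.mem_squares _ hne)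
        · exact fun _ => by simpa using hrail
      · rw [h'] at hpush
        cases hpush
  | @grab l l' D p hdec hp hg hpre =>
    simp only at h hvoid ⊢
    have hD : ∀ q, (Function.update D p (SoloAction.grab.effect (D p)) q).occupant =
        (D q).occupant ∧ (Function.update D p (SoloAction.grab.effect (D p)) q).pushed =
        (D q).pushed ∧ (Function.update D p (SoloAction.grab.effect (D p)) q).won =
        (D q).won := by
      intro q
      simp only [Function.update_apply]
      split_ifs with hq
      · subst hq
        exact ⟨rfl, rfl, rfl⟩
      · exact ⟨rfl, rfl, rfl⟩
    have hact : ∀ q, (D q).active = false := by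
      intro q
      by_contra hq
      have hq' := h.active_mem q (by simpa using hq)
      exact hq (hg q hq').1
    have hpush : ∀ q d, (D q).pushed d = false := by
      intro q d
      by_contra hq
      have hq' := h.pushed_mem q d (by simpa using hq)
      exact hq ((hg q hq').2 d)
    obtain ⟨a, ha, hac⟩ := hpre
    refine ⟨?_, by simpa only [(hD _).2.1] using h.pushed_mem, fun q hq => ?_,
      by simpa only [(hD _).2.1, (hD _).1] using h.pushed, by simpa only [(hD _).2.2] using h.won⟩
    · obtain ⟨n, P, hP, ⟨-, hocc, hn⟩ | ⟨-, q, -, h', -⟩⟩ := h.moves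
      · refine ⟨n, P, hP, Or.inr ⟨p, p, a, fun r => ?_, by simpa only [(hD _).2.1] using hpush,
          (hocc p).symm.trans ha, hac, .refl, fun r => ?_, ?_⟩⟩
        · by_cases hr : r = p
          · simp [hr, SoloAction.effect]
          · simp [hr, hact]
        · rw [(hD r).1, hocc, Placement.relocate_self ((hocc p).symm.trans ha)]
        · have := hdec.value
          omega
      · have := (h' q).2 rfl
        rw [hact] at this
        cases this
    · by_cases hqp : q = p
      · exact hqp ▸ hp
      · rw [Function.update_of_ne hqp, hact] at hq
        cases hq
  | @pair l D a d p hp hpd hpre =>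
    simp only at h hvoid ⊢
    have hpq := add_vec_ne p d
    cases a with
    | visit =>
      refine h.of_eq (fun q => ?_) (fun q => ?_) (fun q => ?_) (fun q => ?_) <;>
      · simp only [Function.update_apply]
        split_ifs with hq hq'
        · subst hq
          rfl
        · subst hq'
          rfl
        · rfl
    | extendPush =>
      simp only [PairAction.source, Function.update_eq_self]
      obtain ⟨hpre, b, hb, hbk⟩ := hpre
      have hD : ∀ q, (Function.update D (p + d.vec)
          (PairAction.extendPush.target d (D p) (D (p + d.vec))) q).occupant = (D q).occupant ∧
          (Function.update D (p + d.vec)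
          (PairAction.extendPush.target d (D p) (D (p + d.vec))) q).active = (D q).active ∧
          (Function.update D (p + d.vec)
          (PairAction.extendPush.target d (D p) (D (p + d.vec))) q).won = (D q).won := by
        intro q
        simp only [Function.update_apply]
        split_ifs with hq
        · subst hq
          exact ⟨rfl, rfl, rfl⟩
        · exact ⟨rfl, rfl, rfl⟩
      have hpush : ∀ q e, (Function.update D (p + d.vec)
          (PairAction.extendPush.target d (D p) (D (p + d.vec))) q).pushed e =
          true → (q = p + d.vec ∧ e = d) ∨ (D q).pushed e = true := by
        intro q e hq
        by_cases hqp : q = p + d.vec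
        · subst hqp
          simp only [Function.update_self, PairAction.target, Function.update_apply] at hq
          split_ifs at hq with he
          · exact Or.inl ⟨rfl, he⟩
          · exact Or.inr hq
        · exact Or.inr (by simpa [Function.update_of_ne hqp] using hq)
      refine ⟨h.moves.of_eq (fun q => (hD q).1) (fun q => (hD q).2.1) ?_, ?_, ?_, ?_, ?_⟩
      · rintro ⟨r, hr⟩
        obtain ⟨n, P, hP, h' | ⟨-, -, -, -, h', -⟩⟩ := h.moves
        · simp [h'.1] at hr
        · rw [h'] at hpre
          cases hpre
      · intro q e hq
        rcases hpush q e hq with ⟨rfl, -⟩ | hq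
        · exact hpd
        · exact h.pushed_mem q e hq
      · simpa only [(hD _).2.1] using h.active_mem
      · intro q e hq
        simp only [(hD _).1]
        rcases hpush q e hq with ⟨rfl, rfl⟩ | hq
        · obtain ⟨p₀, m, rfl, hk, hm⟩ := h.pushed p e hpre
          rw [add_assoc, ← succ_nsmul] at hb ⊢
          refine ⟨p₀, m + 1, rfl, hk, fun i hi₁ hi₂ => ?_⟩
          rcases Nat.lt_or_ge m i with hi | hi
          · obtain rfl : i = m + 1 := by omega
            exact ⟨b, hb, hbk⟩
          · exact hm i hi₁ hi
        · exact h.pushed q e hq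
      · simpa only [(hD _).2.2] using h.won
    | walk =>
      obtain ⟨hact, hocc⟩ := hpre
      obtain ⟨n, P, hP, h' | ⟨p', q, a, h₁, h₂, h₃, h₄, h₅, h₆, h₇⟩⟩ := h.moves
      · simp [h'.1] at hact
      obtain rfl := (h₁ p).1 hact
      set D' := Function.update (Function.update D p (PairAction.walk.source (D p))) (p + d.vec)
        (PairAction.walk.target d (D p) (D (p + d.vec))) with hD'
      have hpush : ∀ r, (D' r).pushed = (D r).pushed ∧ (D' r).won = (D r).won := by
        intro r
        simp only [hD', Function.update_apply]
        split_ifs with hr hr'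
        · subst hr
          exact ⟨rfl, rfl⟩
        · subst hr'
          exact ⟨rfl, rfl⟩
        · exact ⟨rfl, rfl⟩
      have hact' : ∀ r, (D' r).active = true ↔ r = p + d.vec := by
        intro r
        simp only [hD', Function.update_apply]
        split_ifs with hr hr'
        · subst hr
          simp [PairAction.target]
        · subst hr'
          simp [PairAction.source, hr]
        · rw [h₁ r]
          simp [hr, hr']
      -- A cell without occupant is empty in `P` too, unless it is the square where the current move
      -- started.
      have hfree : P (p + d.vec) = none ∨ p + d.vec = p' := by
        rw [h₆, Placement.relocate_apply, if_neg hpq] at hocc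
        split_ifs at hocc with h
        · exact Or.inr h
        · exact Or.inl hocc
      refine ⟨⟨n, P, hP, Or.inr ⟨p', p + d.vec, a, hact', ?_, h₃, h₄,
        h₅.tail ⟨⟨d, rfl⟩, hpd, hfree⟩, fun r => ?_, h₇⟩⟩, ?_, ?_, ?_, ?_⟩
      · simpa only [(hpush _).1] using h₂
      · have hr := h₆ r
        have hp' : (D p).occupant = some a := by rw [h₆, Placement.relocate_apply, if_pos rfl]
        rw [Placement.relocate_apply] at hr ⊢
        simp only [hD', Function.update_apply]
        split_ifs with hr₁ hr₂ hr₃ hr₄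
        · exact hp'
        · rfl
        · subst hr₂
          simp only [PairAction.source]
          rcases h₅.cases_tail with h | ⟨_, -, h⟩
          · exact absurd h hr₃
          · exact (h.2.2.resolve_right hr₃).symm
        · rw [hr, if_neg hr₂, if_pos hr₄]
        · rw [hr, if_neg hr₂, if_neg hr₄]
      · simpa only [(hpush _).1] using h.pushed_mem
      · intro r hr
        rw [(hact' r).1 hr]
        exact hpd
      · intro r e hr
        rw [(hpush r).1, h₂] at hr
        cases hr
      · simpa only [(hpush _).2] using h.won
  | @void l D d p hp hpd =>
    refine h.of_eq (fun q => ?_) (fun q => ?_) (fun q => ?_) (fun q => ?_) <;>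
    · simp only [Function.update_apply]
      split_ifs with hq
      · subst hq
        rfl
      · rfl

end Soundness

end PushFight

namespace PushFight

/-! ### Completeness of the verifier: a winning turn can be verified in few steps -/

section Completeness

/-- The cells show the placement `P`, and neither a move nor a push is in progress. -/
def Idle (P : Placement) (D : Pos → CellState) : Prop :=
  ∀ p, (D p).occupant = P p ∧ (D p).active = false ∧ ∀ d, (D p).pushed d = false

/-- The piece `a` has been taken from `p` and is now on `x`. -/
def Walking (P : Placement) (p : Pos) (a : Piece) (x : Pos) (D : Pos → CellState) : Prop :=
  ∀ r, (D r).occupant = P.relocate p x a r ∧ ((D r).active = true ↔ r = x) ∧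
    ∀ d, (D r).pushed d = false

/-- The marks about the board have not been removed. -/
def KeepsMarks (D D' : Pos → CellState) : Prop :=
  ∀ r, ((D r).visited = true → (D' r).visited = true) ∧
    ∀ d, (D r).void d = true → (D' r).void d = true

theorem KeepsMarks.trans {D D' D'' : Pos → CellState} (h : KeepsMarks D D')
    (h' : KeepsMarks D' D'') : KeepsMarks D D'' :=
  fun r => ⟨fun hr => (h' r).1 ((h r).1 hr), fun d hd => (h' r).2 d ((h r).2 d hd)⟩

theorem KeepsMarks.refl (D : Pos → CellState) : KeepsMarks D D :=
  fun _ => ⟨id, fun _ => id⟩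

/-- All marks about the board have been made. -/
def Surveyed (sq : Set Pos) (D : Pos → CellState) : Prop :=
  (∀ p ∈ sq, (D p).visited = true) ∧ ∀ p ∈ sq, ∀ d : Direction, p + d.vec ∉ sq →
    (D p).void d = true

theorem Surveyed.keeps {sq : Set Pos} {D D' : Pos → CellState} (h : Surveyed sq D)
    (hD : KeepsMarks D D') : Surveyed sq D' :=
  ⟨fun p hp => (hD p).1 (h.1 p hp), fun p hp d hd => (hD p).2 d (h.2 p hp d hd)⟩

variable {sq : Set Pos} {rail : Pos → Direction → Bool} {c : Color} {P : Placement}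
  {l : List Bool} {D : Pos → CellState}

local notation "VStep" => VerifierStep sq rail c

theorem exists_seed (hD : Idle P D) (hv : ∀ r, (D r).visited = false) {p : Pos} (hp : p ∈ sq) :
    ∃ D', Within VStep 1 (l, D) (l, D') ∧ Idle P D' ∧ (D' p).visited = true := by
  refine ⟨_, .single (.solo .seed p (by simp) hp (fun q _ => hv q) trivial), fun r => ?_, ?_⟩
  · rw [Function.update_apply]
    split_ifs with hr
    · subst hr
      exact hD r
    · exact hD r
  · simp [SoloAction.effect]

theorem exists_visit (path : List Pos) {p : Pos} (hD : Idle P D) (hp : p ∈ sq)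
    (hv : (D p).visited = true) (hc : (p :: path).IsChain Adjacent) (hpath : ∀ r ∈ path, r ∈ sq) :
    ∃ D', Within VStep path.length (l, D) (l, D') ∧ Idle P D' ∧ KeepsMarks D D' ∧
      (D' ((p :: path).getLast (by simp))).visited = true := by
  induction path generalizing p D with
  | nil => exact ⟨D, .refl _ _, hD, .refl D, hv⟩
  | cons r path ih =>
    rw [List.isChain_cons_cons] at hc
    obtain ⟨⟨d, rfl⟩, hc⟩ := hc
    have hr := hpath _ (List.mem_cons_self ..)
    have hstep : VStep (l, D) (l, _) := .pair (rail := rail) .visit d p hp hr hv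
    simp only [PairAction.source, Function.update_eq_self] at hstep
    set D₁ := Function.update D (p + d.vec) (PairAction.visit.target d (D p) (D (p + d.vec)))
      with hD₁
    have h₁ : Idle P D₁ := by
      intro r
      simp only [hD₁, Function.update_apply]
      split_ifs with hr
      · subst hr
        exact hD _
      · exact hD r
    have h₂ : KeepsMarks D D₁ := by
      intro r
      simp only [hD₁, Function.update_apply]
      split_ifs with hr
      · subst hr
        exact ⟨fun _ => rfl, fun _ => id⟩
      · exact ⟨id, fun _ => id⟩
    obtain ⟨D', h, hD', hk, hl⟩ := ih (p := p + d.vec) h₁ hr (by simp [hD₁, PairAction.target]) hc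
      fun r hr => hpath r (by simp [hr])
    refine ⟨D', .head hstep h, hD', h₂.trans hk, ?_⟩
    rw [List.getLast_cons (by simp)]
    exact hl

theorem exists_void (hD : Idle P D) {p : Pos} {d : Direction} (hp : p ∈ sq)
    (hpd : p + d.vec ∉ sq) :
    ∃ D', Within VStep 1 (l, D) (l, D') ∧ Idle P D' ∧ KeepsMarks D D' ∧
      (D' p).void d = true := by
  refine ⟨_, .single (.void d p hp hpd), fun r => ?_, fun r => ?_, ?_⟩
  · rw [Function.update_apply]
    split_ifs with hr
    · subst hr
      exact hD r
    · exact hD r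
  · rw [Function.update_apply]
    split_ifs with hr
    · subst hr
      refine ⟨id, fun e he => ?_⟩
      simp only [CellState.markVoid, Function.update_apply]
      split_ifs
      · rfl
      · exact he
    · exact ⟨id, fun _ => id⟩
  · simp [CellState.markVoid]

theorem exists_grab (hD : Idle P D) {p : Pos} {a : Piece} (hp : p ∈ sq) (ha : P p = some a)
    (hac : a.color = c) {l' : List Bool} (hl : Decrement l l') :
    ∃ D', Within VStep 1 (l, D) (l', D') ∧ Walking P p a p D' ∧ KeepsMarks D D' := by
  refine ⟨_, .single (.grab p hl hp (fun q _ => (hD q).2) ⟨a, (hD p).1.trans ha, hac⟩),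
    fun r => ?_, fun r => ?_⟩
  · rw [Function.update_apply, Placement.relocate_self ha]
    split_ifs with hr
    · subst hr
      exact ⟨(hD r).1, by simp [SoloAction.effect], (hD r).2.2⟩
    · exact ⟨(hD r).1, by simp [(hD r).2.1, hr], (hD r).2.2⟩
  · rw [Function.update_apply]
    split_ifs with hr
    · subst hr
      exact ⟨id, fun _ => id⟩
    · exact ⟨id, fun _ => id⟩

/-- The square that the piece leaves has to show its state in `P` again, which is `none` by `hx'`
unless it is the starting square `p`, and that one is emptied by `Placement.relocate`. -/
theorem exists_walk (path : List Pos) {p x : Pos} {a : Piece} (hD : Walking P p a x D)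
    (hx : x ∈ sq) (hx' : x = p ∨ P x = none) (hc : (x :: path).IsChain Adjacent)
    (hpath : ∀ r ∈ path, r ∈ sq ∧ P r = none) :
    ∃ D', Within VStep path.length (l, D) (l, D') ∧
      Walking P p a ((x :: path).getLast (by simp)) D' ∧ KeepsMarks D D' := by
  induction path generalizing x D with
  | nil => exact ⟨D, .refl _ _, hD, .refl D⟩
  | cons r path ih =>
    rw [List.isChain_cons_cons] at hc
    obtain ⟨⟨d, rfl⟩, hc⟩ := hc
    have hr := hpath _ (List.mem_cons_self ..)
    have hne := add_vec_ne x d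
    have hstep : VStep (l, D) (l, _) := .pair (rail := rail) .walk d x hx hr.1
      ⟨(hD x).2.1.2 rfl, by
        rw [(hD _).1, Placement.relocate_apply, if_neg hne]
        split_ifs
        · rfl
        · exact hr.2⟩
    set D₁ := Function.update (Function.update D x (PairAction.walk.source (D x))) (x + d.vec)
      (PairAction.walk.target d (D x) (D (x + d.vec))) with hD₁
    have h₁ : Walking P p a (x + d.vec) D₁ := by
      intro r
      have hDr := hD r
      rw [Placement.relocate_apply] at hDr ⊢
      simp only [hD₁, Function.update_apply]
      split_ifs with hr₁ hr₂ hr₃ hr₄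
      · subst hr₁
        refine ⟨?_, by simp [PairAction.target], hDr.2.2⟩
        have := (hD x).1
        rwa [Placement.relocate_apply, if_pos rfl] at this
      · subst hr₂
        exact ⟨rfl, by simp [PairAction.source, hr₁], hDr.2.2⟩
      · subst hr₂
        exact ⟨(hx'.resolve_left hr₃).symm, by simp [PairAction.source, hr₁], hDr.2.2⟩
      · rw [if_neg hr₂, if_pos hr₄] at hDr
        exact ⟨hDr.1, by simp [hDr.2.1, hr₁, hr₂], hDr.2.2⟩
      · rw [if_neg hr₂, if_neg hr₄] at hDr
        exact ⟨hDr.1, by simp [hDr.2.1, hr₁, hr₂], hDr.2.2⟩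
    have h₂ : KeepsMarks D D₁ := by
      intro r
      simp only [hD₁, Function.update_apply]
      split_ifs with hr₁ hr₂
      · subst hr₁
        exact ⟨id, fun _ => id⟩
      · subst hr₂
        exact ⟨id, fun _ => id⟩
      · exact ⟨id, fun _ => id⟩
    obtain ⟨D', h, hD', hk⟩ := ih (x := x + d.vec) h₁ hr.1 (Or.inr hr.2) hc
      fun r hr => hpath r (by simp [hr])
    refine ⟨D', .head hstep h, ?_, h₂.trans hk⟩
    rw [List.getLast_cons (by simp)]
    exact hD'

theorem exists_release {p x : Pos} {a : Piece} (hD : Walking P p a x D) (hx : x ∈ sq) :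
    ∃ D', Within VStep 1 (l, D) (l, D') ∧ Idle (P.relocate p x a) D' ∧ KeepsMarks D D' := by
  refine ⟨_, .single (.solo .release x (by simp) hx (fun _ _ => trivial) trivial),
    fun r => ?_, fun r => ?_⟩
  · rw [Function.update_apply]
    split_ifs with hr
    · subst hr
      exact ⟨(hD r).1, rfl, (hD r).2.2⟩
    · exact ⟨(hD r).1, by simpa using mt (hD r).2.1.1 hr, (hD r).2.2⟩
  · rw [Function.update_apply]
    split_ifs with hr
    · subst hr
      exact ⟨id, fun _ => id⟩
    · exact ⟨id, fun _ => id⟩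

/-- A move costs one `grab`, at most one `walk` for each square of the board, because its path is
simple, and one `release`. The `grab` takes one unit from the counter. -/
theorem exists_verifier_move {B : Board} {P' : Placement} (h : Move B c P P')
    (hP : ∀ p, P p ≠ none → p ∈ B.squares) (hD : Idle P D) (hl : 0 < bitsValue l) :
    ∃ l' D', Within (VerifierStep (B.squares : Set Pos) rail c) (B.squares.card + 2)
      (l, D) (l', D') ∧ Idle P' D' ∧ KeepsMarks D D' ∧ bitsValue l = bitsValue l' + 1 := by
  obtain ⟨p, q, a, path, hp, ha, hc, hn, hpath, hq, hqm, rfl⟩ := h.exists_relocate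
  obtain ⟨l', hl'⟩ := exists_decrement hl
  have hpB := hP p (by simp [hp])
  obtain ⟨D₁, h₁, hD₁, hk₁⟩ := exists_grab (rail := rail) (sq := (B.squares : Set Pos)) hD hpB hp
    ha hl'
  obtain ⟨D₂, h₂, hD₂, hk₂⟩ := exists_walk (rail := rail) (c := c) (l := l')
    (sq := (B.squares : Set Pos)) path hD₁ hpB (Or.inl rfl) hc hpath
  rw [hq] at hD₂
  obtain ⟨D₃, h₃, hD₃, hk₃⟩ := exists_release (rail := rail) (c := c) (l := l')
    (sq := (B.squares : Set Pos)) hD₂ (hpath q hqm).1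
  have hlen : path.length ≤ B.squares.card := by
    have hsub : path.toFinset ⊆ B.squares := fun r hr => (hpath r (List.mem_toFinset.1 hr)).1
    have := Finset.card_le_card hsub
    rwa [List.toFinset_card_of_nodup (List.nodup_cons.1 hn).2] at this
  exact ⟨l', D₃, ((h₁.trans h₂).trans h₃).mono (by omega), hD₃, (hk₁.trans hk₂).trans hk₃,
    hl'.value⟩

theorem exists_verifier_moves {B : Board} {P' : Placement} {n : ℕ}
    (h : Within (Move B c) n P P') {O : Placement} (hP : MovePreserved B c O P)
    (hD : Idle P D) (hl : n ≤ bitsValue l) :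
    ∃ l' D', Within (VerifierStep (B.squares : Set Pos) rail c) (n * (B.squares.card + 2))
      (l, D) (l', D') ∧ Idle P' D' ∧ KeepsMarks D D' := by
  induction h generalizing l D with
  | refl n P => exact ⟨l, D, .refl _ _, hD, .refl D⟩
  | head h _ ih =>
    obtain ⟨l₁, D₁, h₁, hD₁, hk₁, hl₁⟩ :=
      exists_verifier_move (rail := rail) (l := l) h hP.mem_squares hD (by omega)
    obtain ⟨l₂, D₂, h₂, hD₂, hk₂⟩ := ih (l := l₁) (hP.move h) hD₁ (by omega)
    exact ⟨l₂, D₂, (h₁.trans h₂).mono (by ring_nf; exact le_rfl), hD₂, hk₁.trans hk₂⟩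

theorem exists_startPush (hD : Idle P D) {p : Pos} {a : Piece} (d : Direction) (hp : p ∈ sq)
    (ha : P p = some a) (hac : a.color = c) (hak : a.kind ≠ Kind.pawn) :
    ∃ D', Within VStep 1 (l, D) (l, D') ∧ (∀ r, (D' r).occupant = P r) ∧ KeepsMarks D D' ∧
      (D' p).pushed d = true := by
  refine ⟨_, .single (.solo (.startPush d) p (by simp) hp (fun q _ => (hD q).2.1)
    ⟨a, (hD p).1.trans ha, hac, hak⟩), fun r => ?_, fun r => ?_, ?_⟩
  · rw [Function.update_apply]
    split_ifs with hr
    · subst hr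
      exact (hD r).1
    · exact (hD r).1
  · rw [Function.update_apply]
    split_ifs with hr
    · subst hr
      exact ⟨id, fun _ => id⟩
    · exact ⟨id, fun _ => id⟩
  · simp [SoloAction.effect]

theorem exists_extendPush (m : ℕ) {p : Pos} {d : Direction} (hD : ∀ r, (D r).occupant = P r)
    (hp : p ∈ sq) (hd : (D p).pushed d = true)
    (hm : ∀ i : ℕ, 1 ≤ i → i ≤ m → p + i • d.vec ∈ sq ∧
      ∃ b, P (p + i • d.vec) = some b ∧ b.kind ≠ Kind.anchoredKing) :
    ∃ D', Within VStep m (l, D) (l, D') ∧ (∀ r, (D' r).occupant = P r) ∧ KeepsMarks D D' ∧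
      (D' (p + m • d.vec)).pushed d = true := by
  induction m with
  | zero => exact ⟨D, .refl _ _, hD, .refl D, by simpa using hd⟩
  | succ m ih =>
    obtain ⟨D₁, h₁, hD₁, hk₁, hd₁⟩ := ih fun i hi hi' => hm i hi (by omega)
    have hmem : p + m • d.vec ∈ sq := by
      rcases Nat.eq_zero_or_pos m with rfl | hpos
      · simpa using hp
      · exact (hm m hpos (by omega)).1
    obtain ⟨hmem', b, hb, hbk⟩ := hm (m + 1) (by omega) le_rfl
    have hadd : p + (m + 1) • d.vec = p + m • d.vec + d.vec := by rw [add_assoc, ← succ_nsmul]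
    rw [hadd] at hmem' hb ⊢
    have hstep : VStep (l, D₁) (l, _) := .pair (rail := rail) .extendPush d (p + m • d.vec) hmem
      hmem' ⟨hd₁, b, (hD₁ _).trans hb, hbk⟩
    simp only [PairAction.source, Function.update_eq_self] at hstep
    refine ⟨_, (h₁.trans (.single hstep)), fun r => ?_, hk₁.trans fun r => ?_, ?_⟩
    · rw [Function.update_apply]
      split_ifs with hr
      · subst hr
        exact hD₁ _
      · exact hD₁ r
    · rw [Function.update_apply]
      split_ifs with hr
      · subst hr
        exact ⟨id, fun _ => id⟩
      · exact ⟨id, fun _ => id⟩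
    · simp [PairAction.target]

theorem exists_win {p : Pos} {d : Direction} {b : Piece} (hp : p ∈ sq)
    (hd : (D p).pushed d = true) (hv : (D p).void d = true) (hr : rail p d = false)
    (hb : (D p).occupant = some b) (hbc : b.color ≠ c) :
    ∃ D', Within VStep 1 (l, D) (l, D') ∧ KeepsMarks D D' ∧ (D' p).won = true := by
  refine ⟨_, .single (.solo (.win d) p (by simp) hp (fun _ _ => trivial)
    ⟨hd, hv, hr, b, hb, hbc⟩), fun r => ?_, ?_⟩
  · rw [Function.update_apply]
    split_ifs with hr
    · subst hr
      exact ⟨id, fun _ => id⟩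
    · exact ⟨id, fun _ => id⟩
  · simp [SoloAction.effect]

/-- The number of steps that the verifier needs on a board with `n` squares. -/
def verifierBound (n : ℕ) : ℕ :=
  1 + n * n + n * 4 * 1 + tokenBound n * (n + 2) + (1 + n + 1)

/-- One `seed`, then for every square a path of at most `B.squares.card` visits from the seed, then
at most four `void` marks for every square. Marks persist, so `Within.exists_forall` fulfils these
tasks one after another. -/
theorem exists_surveyed (B : Board) (hD : Idle P D) (hv : ∀ r, (D r).visited = false) :
    ∃ D', Within (VerifierStep (B.squares : Set Pos) rail c)
      (1 + B.squares.card * B.squares.card + B.squares.card * 4 * 1) (l, D) (l, D') ∧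
      Idle P D' ∧ Surveyed (B.squares : Set Pos) D' := by
  classical
  obtain ⟨o, ho⟩ := B.nonempty
  obtain ⟨D₁, h₁, hD₁, hv₁⟩ := exists_seed (rail := rail) (c := c) (l := l)
    (sq := (B.squares : Set Pos)) hD hv ho
  obtain ⟨⟨l₂, D₂⟩, h₂, ⟨hl₂, hD₂, -⟩, hv₂⟩ := Within.exists_forall
    (r := VerifierStep (B.squares : Set Pos) rail c) (n := B.squares.card) B.squares
    (fun x => x.1 = l ∧ Idle P x.2 ∧ (x.2 o).visited = true)
    (fun q x => (x.2 q).visited = true) (by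
      rintro q hq ⟨l', D'⟩ ⟨rfl, hD', ho'⟩
      have hconn : Relation.ReflTransGen (fun a b => Adjacent a b ∧ b ∈ B.squares) o q :=
        B.connected o ho q hq
      obtain ⟨path, hc, hn, hl⟩ := exists_simple_path hconn
      have hpath : ∀ r ∈ path, r ∈ B.squares := by
        intro r hr
        obtain ⟨t, u, htu⟩ := List.append_of_mem hr
        have hc' : (o :: path).IsChain fun _ y => y ∈ B.squares := hc.imp fun _ _ h => h.2
        rw [htu] at hc'
        rcases List.eq_nil_or_concat t with rfl | ⟨t, y, rfl⟩
        · exact (List.isChain_cons_cons.1 hc').1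
        · have := List.isChain_split.1 (show ((o :: t) ++ y :: (r :: u)).IsChain _ by
            simpa using hc')
          exact (List.isChain_cons_cons.1 this.2).1
      obtain ⟨D'', h'', hI, hk, hvis⟩ := exists_visit (rail := rail) (c := c) (l := l')
        (sq := (B.squares : Set Pos)) path hD' ho ho' (hc.imp fun _ _ h => h.1) hpath
      rw [hl] at hvis
      have hlen : path.length ≤ B.squares.card := by
        have hsub : path.toFinset ⊆ B.squares := fun r hr => hpath r (List.mem_toFinset.1 hr)
        have := Finset.card_le_card hsub
        rwa [List.toFinset_card_of_nodup (List.nodup_cons.1 hn).2] at this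
      exact ⟨(l', D''), h''.mono hlen, ⟨rfl, hI, (hk o).1 ho'⟩, hvis, fun r _ => (hk r).1⟩)
    (l, D₁) ⟨rfl, hD₁, hv₁⟩
  simp only at hl₂ hD₂ hv₂
  subst hl₂
  obtain ⟨⟨l₃, D₃⟩, h₃, ⟨hl₃, hD₃, hv₃⟩, hd₃⟩ := Within.exists_forall
    (r := VerifierStep (B.squares : Set Pos) rail c) (n := 1)
    ((B.squares ×ˢ (Finset.univ : Finset Direction)).filter fun e => e.1 + e.2.vec ∉ B.squares)
    (fun x => x.1 = l₂ ∧ Idle P x.2 ∧ ∀ p ∈ B.squares, (x.2 p).visited = true)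
    (fun e x => (x.2 e.1).void e.2 = true) (by
      rintro ⟨p, d⟩ he ⟨l', D'⟩ ⟨rfl, hD', hv'⟩
      simp only [Finset.mem_filter, Finset.mem_product, Finset.mem_univ, and_true] at he
      obtain ⟨D'', h'', hI, hk, hvoid⟩ := exists_void (rail := rail) (c := c) (l := l')
        (sq := (B.squares : Set Pos)) (d := d) hD' he.1 he.2
      exact ⟨(l', D''), h'', ⟨rfl, hI, fun q hq => (hk q).1 (hv' q hq)⟩, hvoid,
        fun e _ => (hk e.1).2 e.2⟩)
    (l₂, D₂) ⟨rfl, hD₂, hv₂⟩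
  simp only at hl₃ hD₃ hv₃ hd₃
  subst hl₃
  have hcard : ((B.squares ×ˢ (Finset.univ : Finset Direction)).filter
      fun e => e.1 + e.2.vec ∉ B.squares).card ≤ B.squares.card * 4 := by
    refine (Finset.card_filter_le _ _).trans ?_
    rw [Finset.card_product]
    exact le_rfl
  refine ⟨D₃, ((h₁.trans h₂).trans h₃).mono ?_, hD₃, hv₃, fun p hp d hd => ?_⟩
  · have := Nat.mul_le_mul_right 1 hcard
    omega
  · exact hd₃ (p, d) (by simpa using ⟨hp, hd⟩)

/-- The verifier follows the sequence of moves from `GameState.mateInOne_iff`: it is no longer than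
`k`, so that the counter suffices, and no longer than `tokenBound`, so that the time suffices. -/
theorem GameState.exists_verified (s : GameState) {k : ℕ} (h : s.MateInOne k) {l : List Bool}
    (hl : bitsValue l = k) {D : Pos → CellState} (hD : ∀ p, D p = .initial (s.piece p)) :
    ∃ l' D', Within (VerifierStep (s.board.squares : Set Pos)
      (fun p d => decide ((p, d) ∈ s.board.rails)) s.turn) (verifierBound s.board.squares.card)
      (l, D) (l', D') ∧
      Verified (s.board.squares : Set Pos) (fun p d => decide ((p, d) ∈ s.board.rails)) D' := by
  obtain ⟨P, hP, p, d, m, ⟨⟨⟨a, ha, hac, hak⟩, hm₁, hm, hn, hr⟩, hs, b, hb, hbc⟩⟩ :=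
    (s.mateInOne_iff k).1 h
  have hpres := s.movePreserved.reflTransGen hP.reflTransGen
  obtain ⟨D₁, h₁, hD₁, hs₁⟩ := exists_surveyed (P := s.piece) (D := D) (l := l)
    (rail := fun p d => decide ((p, d) ∈ s.board.rails)) (c := s.turn) s.board
    (fun r => by simp [hD, CellState.initial]) (fun r => by simp [hD, CellState.initial])
  obtain ⟨l₂, D₂, h₂, hD₂, hk₂⟩ := exists_verifier_moves (l := l)
    (rail := fun p d => decide ((p, d) ∈ s.board.rails)) hP s.movePreserved hD₁
    ((min_le_left _ _).trans hl.ge)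
  have hp : p ∈ s.board.squares := hpres.mem_squares p (by simp [ha])
  have hmem : ∀ i : ℕ, 1 ≤ i → i ≤ m → p + i • d.vec ∈ s.board.squares := by
    intro i hi hi'
    obtain ⟨b, hb, -⟩ := hm i hi hi'
    exact hpres.mem_squares _ (by rw [hb]; simp)
  obtain ⟨D₃, h₃, hD₃, hk₃, hd₃⟩ := exists_startPush (l := l₂) (c := s.turn)
    (rail := fun p d => decide ((p, d) ∈ s.board.rails)) (sq := (s.board.squares : Set Pos))
    hD₂ d hp ha hac hak
  obtain ⟨D₄, h₄, hD₄, hk₄, hd₄⟩ := exists_extendPush (l := l₂) (c := s.turn)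
    (rail := fun p d => decide ((p, d) ∈ s.board.rails)) (sq := (s.board.squares : Set Pos))
    m hD₃ hp hd₃ fun i hi hi' => ⟨hmem i hi hi', hm i hi hi'⟩
  have hs₄ := ((hs₁.keeps hk₂).keeps hk₃).keeps hk₄
  have hpm := hmem m hm₁ le_rfl
  obtain ⟨D₅, h₅, hk₅, hw⟩ := exists_win (l := l₂) (c := s.turn)
    (rail := fun p d => decide ((p, d) ∈ s.board.rails)) (sq := (s.board.squares : Set Pos))
    (D := D₄) hpm hd₄ (hs₄.2 _ hpm d (by rwa [add_assoc, ← succ_nsmul]))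
    (by simpa using hr hs) ((hD₄ _).trans hb) hbc
  have hs₅ := hs₄.keeps hk₅
  -- The pushed pieces stand on distinct squares, which bounds the number of `extendPush` steps.
  have hm_le : m ≤ s.board.squares.card := by
    have hinj : Set.InjOn (fun i : ℕ => p + (i + 1) • d.vec) (Finset.range m : Set ℕ) := by
      intro i _ j _ hij
      simp only [add_right_inj] at hij
      cases d <;> simpa [Direction.vec] using hij
    have := Finset.card_le_card_of_injOn (s := Finset.range m) (t := s.board.squares) _
      (fun i hi => by
        simp only [Finset.coe_range, Set.mem_Iio] at hi
        exact hmem (i + 1) (by omega) (by omega)) hinj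
    simpa using this
  refine ⟨l₂, D₅, (((h₁.trans h₂).trans ((h₃.trans h₄).trans h₅))).mono ?_, hs₅.1,
    fun q hq e he => hs₅.2 q hq e ?_, _, hpm, hw⟩
  · unfold verifierBound
    have := Nat.mul_le_mul_right (s.board.squares.card + 2)
      (min_le_right k (tokenBound s.board.squares.card))
    omega
  · exact (s.board.rails_boundary (q, e) (by simpa using he)).2

end Completeness

end PushFight

namespace PushFight

open RegularRewriting

/-! ### The verifier as a rewriting system on words -/

def Symbol.IsSquare : Symbol → Prop
  | square _ _ => True
  | _ => False

def Symbol.rail : Symbol → Direction → Bool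
  | square r _ => r
  | _ => fun _ => false

def Symbol.occupant : Symbol → Option Piece
  | square _ a => a
  | _ => none

/-- A cell of the grid with a mark for the column that is inspected at present. -/
structure GridLetter where
  sym : Symbol
  col : Bool
  st : CellState

instance : Finite GridLetter :=
  Finite.of_injective (fun x : GridLetter => (x.sym, x.col, x.st)) fun x y h => by
    cases x
    cases y
    simpa using h

/-- The letters of the rewriting system: a binary digit with the corresponding digit of the counter,
or a cell of the grid. -/
abbrev Letter : Type := (Bool × Bool) ⊕ GridLetter

noncomputable instance : Fintype Letter := Fintype.ofFinite _

instance : Inhabited Letter := ⟨Sum.inl (false, false)⟩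

/-- The letter that represents an input symbol at the beginning. -/
def Symbol.toLetter : Symbol → Letter
  | bit b => Sum.inl (b, b)
  | s => Sum.inr ⟨s, false, .initial s.occupant⟩

/-- The part of a letter that never changes. -/
def Letter.static : Letter → Bool ⊕ Symbol
  | .inl b => .inl b.1
  | .inr x => .inr x.sym

def Letter.col : Letter → Bool
  | .inl _ => false
  | .inr x => x.col

/-- The part of a letter that belongs to the state of the verifier. -/
def Letter.dynamic : Letter → Bool ⊕ CellState
  | .inl b => .inl b.2
  | .inr x => .inr x.st

abbrev LetterPair : Type := Letter × Letter

noncomputable instance : Fintype LetterPair := Fintype.ofFinite _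

/-- The pairs of cells that are related by `Q`. -/
def GridPair (Q : GridLetter → GridLetter → Prop) (z : LetterPair) : Prop :=
  ∃ x y, z = (.inr x, .inr y) ∧ Q x y

/-- The pairs of pairs of digits that are related by `Q`. -/
def BitPair (Q : Bool × Bool → Bool × Bool → Prop) (z : LetterPair) : Prop :=
  ∃ x y, z = (.inl x, .inl y) ∧ Q x y

def keepBits : Language LetterPair := allLetters (BitPair fun x y => y = x)

/-- With the least significant digit first, subtracting one turns the leading zeros into ones and
the first one into zero. The first digit of each pair is that of the input and stays. -/
def decrementBits : Language LetterPair :=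
  allLetters (BitPair fun x y => x.2 = false ∧ y = (x.1, true)) *
    oneLetter (BitPair fun x y => x.2 = true ∧ y = (x.1, false)) * keepBits

def GridLetter.SoloGuard (a : SoloAction) (x y : GridLetter) : Prop :=
  y = x ∧ (x.sym.IsSquare → a.Guard x.st)

def GridLetter.SoloRule (c : Color) (a : SoloAction) (x y : GridLetter) : Prop :=
  x.sym.IsSquare ∧ a.Guard x.st ∧ a.Pre c x.sym.rail x.st ∧ y = { x with st := a.effect x.st }

def soloLang (c : Color) (a : SoloAction) : Language LetterPair :=
  allLetters (GridPair (GridLetter.SoloGuard a)) * oneLetter (GridPair (GridLetter.SoloRule c a)) *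
    allLetters (GridPair (GridLetter.SoloGuard a))

/-- The rules that change a square and its neighbour in direction `d`. -/
inductive GridLetter.PairRule (d : Direction) :
    GridLetter → GridLetter → GridLetter → GridLetter → Prop
  | pair (a : PairAction) {x y : GridLetter} : x.sym.IsSquare → y.sym.IsSquare →
      a.Pre d x.st y.st →
      PairRule d x y { x with st := a.source x.st } { y with st := a.target d x.st y.st }
  | void {x y : GridLetter} : x.sym.IsSquare → ¬ y.sym.IsSquare →
      PairRule d x y { x with st := x.st.markVoid d } y

def Direction.IsVertical : Direction → Prop
  | up | down => True
  | left | right => False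

/-- Whether the neighbour in this direction comes later in the word. -/
def Direction.IsForward : Direction → Prop
  | down | right => True
  | left | up => False

/-- In a word that describes a row-by-row array, the letters `x` and `y` belong to adjacent cells
if they are adjacent, or if they belong to the inspected column and no letter between them does. -/
def gapLang (v : Prop) (x x' y y' : GridLetter) : Language LetterPair :=
  allLetters (GridPair fun a b => b = a) *
    oneLetter (fun z => z = (.inr x, .inr x') ∧ (v → x.col = true)) *
    allLetters (GridPair fun a b => b = a ∧ v ∧ a.col = false) *
    oneLetter (fun z => z = (.inr y, .inr y') ∧ (v → y.col = true)) *
    allLetters (GridPair fun a b => b = a)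

-- The letters before and after the change range over a finite type, so this is a finite union.
-- Which of the two cells comes first in the word depends on the direction.
open scoped Classical in
def pairLang (d : Direction) : Language LetterPair :=
  unionLang fun x : GridLetter × GridLetter × GridLetter × GridLetter =>
    {z | GridLetter.PairRule d x.1 x.2.1 x.2.2.1 x.2.2.2 ∧
      (d.IsForward → z ∈ gapLang d.IsVertical x.1 x.2.2.1 x.2.1 x.2.2.2) ∧
      (¬ d.IsForward → z ∈ gapLang d.IsVertical x.2.1 x.2.2.2 x.1 x.2.2.1)}

/-- The marking of a square that has no neighbour in direction `d` in the array. -/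
def edgeLang (d : Direction) : Language LetterPair :=
  allLetters (GridPair fun a b => b = a ∧ (¬ d.IsForward → d.IsVertical ∧ a.col = false)) *
    oneLetter (GridPair fun a b => a.sym.IsSquare ∧ (d.IsVertical → a.col = true) ∧
      b = { a with st := a.st.markVoid d }) *
    allLetters (GridPair fun a b => b = a ∧ (d.IsForward → d.IsVertical ∧ a.col = false))

def SamePlace (z : LetterPair) : Prop :=
  Letter.static z.2 = Letter.static z.1 ∧ Letter.col z.2 = Letter.col z.1

def SameState (z : LetterPair) : Prop :=
  Letter.static z.2 = Letter.static z.1 ∧ Letter.dynamic z.2 = Letter.dynamic z.1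

/-- Whether the next letter is the first one of a row. -/
def IsRowBreak : Bool ⊕ Symbol → Prop
  | .inl _ => True
  | .inr s => s = .endRow

/-- The first cells of all rows are marked. -/
def resetLang : Language LetterPair :=
  allLetters SameState ⊓ chainLetters fun a b =>
    (Letter.static b.1).isRight → (Letter.col b.2 = true ↔ IsRowBreak (Letter.static a.1))

/-- The marks are shifted by one cell. -/
def shiftLang : Language LetterPair :=
  allLetters (fun z => SameState z ∧ (Letter.col z.1 = true → Letter.static z.1 ≠ .inr .endRow)) ⊓
    chainLetters fun a b => (Letter.static b.1).isRight → Letter.col b.2 = Letter.col a.1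

/-- Whether a symbol shows an anchored king of some color. -/
def HasAnchor (P : Color → Prop) : Bool ⊕ Symbol → Prop
  | .inl _ => False
  | .inr s => ∃ a, s.occupant = some a ∧ a.kind = Kind.anchoredKing ∧ P a.color

def whiteAnchorLang : Language LetterPair :=
  allLetters (fun _ => True) * oneLetter (fun z => HasAnchor (· = .white) (Letter.static z.1)) *
    allLetters (fun _ => True)

/-- It is the turn of the player `c`. -/
def turnLang : Color → Language LetterPair
  | .black => whiteAnchorLang
  | .white => whiteAnchorLangᶜ

/-- The actions of the verifier except for the beginning of a move. -/
def actionLang (c : Color) : Language LetterPair :=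
  unionLang (fun a : {a : SoloAction // a ≠ .grab} => soloLang c a) ⊔
    (unionLang pairLang ⊔ unionLang edgeLang)

/-- A move is paid for when it begins: only `grab` is combined with a decrement. `SamePlace` is
stated explicitly because the preservation of symbols and column marks is needed before a word is
known to describe an array. -/
def stepLang : Language LetterPair :=
  unionLang (fun c => (keepBits * actionLang c ⊔ decrementBits * soloLang c .grab) ⊓
    (turnLang c ⊓ allLetters SamePlace)) ⊔ (resetLang ⊔ shiftLang)

/-- What is required of all cells in the end. -/
def GridLetter.Checked (x : GridLetter) : Prop :=
  (x.col = true ↔ x.sym = .endRow) ∧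
    (x.sym.IsSquare → x.st.visited = true ∧ ∀ d, x.sym.rail d = true → x.st.void d = true)

/-- The last digit must be one, as in the binary form of a positive number. The marks always form a
column, so marks exactly on the row ends show that all rows have the same length. -/
def shapeLang : Language LetterPair :=
  allLetters (fun z => (Letter.static z.1).isLeft) *
    oneLetter (fun z => Letter.static z.1 = .inl true) *
    allLetters (fun z => ∃ x, z.1 = .inr x ∧ x.Checked) *
    oneLetter (fun z => ∃ x, z.1 = .inr x ∧ x.Checked ∧ x.sym = .endRow)

def wonLang : Language LetterPair :=
  allLetters (fun _ => True) *
    oneLetter (fun z => ∃ x, z.1 = .inr x ∧ x.sym.IsSquare ∧ x.st.won = true) *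
    allLetters (fun _ => True)

def twoAnchorsLang : Language LetterPair :=
  allLetters (fun _ => True) * oneLetter (fun z => HasAnchor (fun _ => True) (Letter.static z.1)) *
    allLetters (fun _ => True) *
    oneLetter (fun z => HasAnchor (fun _ => True) (Letter.static z.1)) *
    allLetters (fun _ => True)

def finalLang : Language LetterPair := shapeLang ⊓ (wonLang ⊓ twoAnchorsLangᶜ)

theorem isRegular_gapLang (v : Prop) (x x' y y' : GridLetter) :
    (gapLang v x x' y y').IsRegular :=
  isRegular_mul (isRegular_mul (isRegular_mul (isRegular_mul (isRegular_allLetters _)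
    (isRegular_oneLetter _)) (isRegular_allLetters _)) (isRegular_oneLetter _))
    (isRegular_allLetters _)

theorem isRegular_soloLang (c : Color) (a : SoloAction) : (soloLang c a).IsRegular :=
  isRegular_mul (isRegular_mul (isRegular_allLetters _) (isRegular_oneLetter _))
    (isRegular_allLetters _)

theorem isRegular_keepBits : keepBits.IsRegular := isRegular_allLetters _

theorem isRegular_edgeLang (d : Direction) : (edgeLang d).IsRegular :=
  isRegular_mul (isRegular_mul (isRegular_allLetters _) (isRegular_oneLetter _))
    (isRegular_allLetters _)

theorem isRegular_pairLang (d : Direction) : (pairLang d).IsRegular := by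
  refine isRegular_unionLang fun x => ?_
  by_cases hx : GridLetter.PairRule d x.1 x.2.1 x.2.2.1 x.2.2.2
  · by_cases hd : d.IsForward
    · convert isRegular_gapLang d.IsVertical x.1 x.2.2.1 x.2.1 x.2.2.2 using 1
      simp [hx, hd]
      rfl
    · convert isRegular_gapLang d.IsVertical x.2.1 x.2.2.2 x.1 x.2.2.1 using 1
      simp [hx, hd]
      rfl
  -- Where no rule applies, the language is empty, that is, the complement of the language of all
  -- words.
  · have h_empty : ∀ L K : Language LetterPair, ({z | GridLetter.PairRule d x.1 x.2.1 x.2.2.1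
        x.2.2.2 ∧ (d.IsForward → z ∈ L) ∧ (¬ d.IsForward → z ∈ K)} : Language LetterPair) =
        (allLetters fun _ => True)ᶜ := by
      intro L K
      ext z
      exact ⟨fun h => absurd h.1 hx, fun h => absurd (fun _ _ => trivial) h⟩
    rw [h_empty]
    exact (isRegular_allLetters _).compl

theorem isRegular_whiteAnchorLang : whiteAnchorLang.IsRegular :=
  isRegular_mul (isRegular_mul (isRegular_allLetters _) (isRegular_oneLetter _))
    (isRegular_allLetters _)

theorem isRegular_stepLang : stepLang.IsRegular := by
  refine isRegular_sup (isRegular_unionLang fun c => ?_) (isRegular_sup ?_ ?_)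
  · refine (isRegular_sup (isRegular_mul isRegular_keepBits ?_) (isRegular_mul ?_
      (isRegular_soloLang _ _))).inf (Language.IsRegular.inf ?_ (isRegular_allLetters _))
    · exact isRegular_sup (isRegular_unionLang fun a => isRegular_soloLang _ _)
        (isRegular_sup (isRegular_unionLang isRegular_pairLang)
          (isRegular_unionLang isRegular_edgeLang))
    · exact isRegular_mul (isRegular_mul (isRegular_allLetters _) (isRegular_oneLetter _))
        isRegular_keepBits
    · cases c
      · exact isRegular_whiteAnchorLang.compl
      · exact isRegular_whiteAnchorLang
  · exact (isRegular_allLetters _).inf (isRegular_chainLetters _)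
  · exact (isRegular_allLetters _).inf (isRegular_chainLetters _)

theorem isRegular_finalLang : finalLang.IsRegular := by
  refine Language.IsRegular.inf ?_ (Language.IsRegular.inf ?_ (Language.IsRegular.compl ?_))
  · exact isRegular_mul (isRegular_mul (isRegular_mul (isRegular_allLetters _)
      (isRegular_oneLetter _)) (isRegular_allLetters _)) (isRegular_oneLetter _)
  · exact isRegular_mul (isRegular_mul (isRegular_allLetters _) (isRegular_oneLetter _))
      (isRegular_allLetters _)
  · exact isRegular_mul (isRegular_mul (isRegular_mul (isRegular_mul (isRegular_allLetters _)
      (isRegular_oneLetter _)) (isRegular_allLetters _)) (isRegular_oneLetter _))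
      (isRegular_allLetters _)

end PushFight

namespace PushFight

open RegularRewriting

/-! ### Arrays of cells -/

/-- An array of cells, with a mark at the end of each row. -/
structure Layout where
  o : Pos
  h : ℕ
  w : ℕ
  sym : Pos → Symbol
  square_mem : ∀ p, (sym p).IsSquare →
    o.1 ≤ p.1 ∧ p.1 < o.1 + h ∧ o.2 ≤ p.2 ∧ p.2 < o.2 + w
  endRow_iff : ∀ p, o.1 ≤ p.1 → p.1 < o.1 + h → o.2 ≤ p.2 → p.2 ≤ o.2 + w →
    (sym p = .endRow ↔ p.2 = o.2 + w)
  ne_bit : ∀ p b, sym p ≠ .bit b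

namespace Layout

variable (L : Layout)

/-- The positions in the array in reading order, including those of the marks at the end of the
rows. -/
def cells : List Pos :=
  (List.range L.h).flatMap fun i : ℕ =>
    (List.range (L.w + 1)).map fun j : ℕ => (L.o.1 + (i : ℤ), L.o.2 + (j : ℤ))

def squares : Set Pos := {p | (L.sym p).IsSquare}

def rail (p : Pos) (d : Direction) : Bool := (L.sym p).rail d

/-- Reading order. -/
def Before (p q : Pos) : Prop := p.1 < q.1 ∨ p.1 = q.1 ∧ p.2 < q.2

def letter (t : ℕ) (D : Pos → CellState) (p : Pos) : GridLetter :=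
  ⟨L.sym p, decide (p.2 = L.o.2 + t), D p⟩

/-- The word for a state of the verifier, with marks in column `t`. -/
def block (bits cs : List Bool) (t : ℕ) (D : Pos → CellState) : List Letter :=
  (bits.zip cs).map Sum.inl ++ L.cells.map fun p => Sum.inr (L.letter t D p)

theorem mem_cells {p : Pos} : p ∈ L.cells ↔
    (L.o.1 ≤ p.1 ∧ p.1 < L.o.1 + L.h) ∧ L.o.2 ≤ p.2 ∧ p.2 ≤ L.o.2 + L.w := by
  simp only [cells, List.mem_flatMap, List.mem_map, List.mem_range]
  constructor
  · rintro ⟨i, hi, j, hj, rfl⟩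
    simp only
    omega
  · rintro ⟨⟨h₁, h₂⟩, h₃, h₄⟩
    refine ⟨(p.1 - L.o.1).toNat, by omega, (p.2 - L.o.2).toNat, by omega, ?_⟩
    ext <;> simp only <;> omega

theorem square_mem_cells {p : Pos} (h : p ∈ L.squares) : p ∈ L.cells := by
  have := L.square_mem p h
  rw [mem_cells]
  omega

/-- Since the list is strictly increasing in reading order, no cell of the array lies between two
consecutive entries. All the facts below on the position of a cell in the word come from this order.
-/
theorem pairwise_cells : L.cells.Pairwise Before := by
  unfold cells
  rw [List.pairwise_flatMap]
  constructor
  · intro i _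
    rw [List.pairwise_map]
    refine List.pairwise_lt_range.imp fun {j j'} hj => Or.inr ⟨rfl, ?_⟩
    simp only
    omega
  · refine List.pairwise_lt_range.imp fun {i i'} hi p hp q hq => ?_
    simp only [List.mem_map] at hp hq
    obtain ⟨j, -, rfl⟩ := hp
    obtain ⟨j', -, rfl⟩ := hq
    refine Or.inl ?_
    simp only
    omega

theorem Before.irrefl {p : Pos} : ¬ Before p p := by
  unfold Before
  omega

theorem Before.asymm {p q : Pos} (h : Before p q) : ¬ Before q p := by
  unfold Before at h ⊢
  omega

section Order

variable {L} {A₁ A₂ A₃ : List Pos} {p q r : Pos}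

theorem mem_left (h : L.cells = A₁ ++ p :: A₂) (hr : r ∈ L.cells) (hrp : Before r p) : r ∈ A₁ := by
  have hs := L.pairwise_cells
  rw [h] at hr hs
  rw [List.pairwise_append, List.pairwise_cons] at hs
  rcases List.mem_append.1 hr with hr | hr
  · exact hr
  · rcases List.mem_cons.1 hr with rfl | hr
    · exact absurd hrp Before.irrefl
    · exact absurd hrp (hs.2.1.1 r hr).asymm

theorem mem_right (h : L.cells = A₁ ++ p :: A₂) (hr : r ∈ L.cells) (hpr : Before p r) :
    r ∈ A₂ := by
  have hs := L.pairwise_cells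
  rw [h] at hr hs
  rw [List.pairwise_append] at hs
  rcases List.mem_append.1 hr with hr | hr
  · exact absurd hpr (hs.2.2 r hr p (by simp)).asymm
  · rcases List.mem_cons.1 hr with rfl | hr
    · exact absurd hpr Before.irrefl
    · exact hr

theorem before_left (h : L.cells = A₁ ++ p :: A₂) (hr : r ∈ A₁) : Before r p := by
  have hs := L.pairwise_cells
  rw [h, List.pairwise_append] at hs
  exact hs.2.2 r hr p (by simp)

theorem before_right (h : L.cells = A₁ ++ p :: A₂) (hr : r ∈ A₂) : Before p r := by
  have hs := L.pairwise_cells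
  rw [h, List.pairwise_append, List.pairwise_cons] at hs
  exact hs.2.1.1 r hr

theorem mem_between (h : L.cells = A₁ ++ p :: (A₂ ++ q :: A₃)) (hr : r ∈ L.cells)
    (hpr : Before p r) (hrq : Before r q) : r ∈ A₂ := by
  have h₁ := mem_right h hr hpr
  have h₂ := mem_left (A₁ := A₁ ++ p :: A₂) (p := q) (by simpa using h) hr hrq
  rcases List.mem_append.1 h₁ with h₁ | h₁
  · exact h₁
  · have h' : L.cells = (A₁ ++ p :: A₂) ++ q :: A₃ := by simpa using h
    rcases List.mem_cons.1 h₁ with rfl | h₁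
    · exact absurd hrq Before.irrefl
    · exact absurd hrq (before_right h' h₁).asymm

theorem notMem_of_cells (h : L.cells = A₁ ++ p :: A₂) : p ∉ A₁ ∧ p ∉ A₂ :=
  ⟨fun hp => Before.irrefl (before_left h hp), fun hp => Before.irrefl (before_right h hp)⟩

theorem next_right (h : L.cells = A₁ ++ p :: q :: A₃) (hp : p.2 < L.o.2 + L.w) :
    q = p + Direction.right.vec := by
  have hp' := L.mem_cells.1 (show p ∈ L.cells by simp [h])
  have hpq : Before p q := before_right h (by simp)
  have hr : p + Direction.right.vec ∈ L.cells := by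
    rw [mem_cells]
    simp only [Direction.vec, Prod.fst_add, Prod.snd_add]
    omega
  by_contra hne
  have hlt : Before (p + Direction.right.vec) q := by
    by_contra hnlt
    apply hne
    unfold Before at hpq hnlt
    simp only [Direction.vec, Prod.fst_add, Prod.snd_add] at hnlt ⊢
    ext
    · simp only [Prod.fst_add]
      have := L.mem_cells.1 (show q ∈ L.cells by simp [h])
      by_contra hne'
      have h' : p.1 < q.1 := by omega
      omega
    · simp only [Prod.snd_add]
      have := L.mem_cells.1 (show q ∈ L.cells by simp [h])
      omega
  have := mem_between (A₂ := []) h hr (by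
    unfold Before
    simp only [Direction.vec, Prod.fst_add, Prod.snd_add]
    omega) hlt
  simp at this

theorem next_endRow (h : L.cells = A₁ ++ p :: q :: A₃) (hp : p.2 = L.o.2 + L.w) :
    q.2 = L.o.2 := by
  have hq := L.mem_cells.1 (show q ∈ L.cells by simp [h])
  have hpq : Before p q := before_right h (by simp)
  have hr : ((q.1, L.o.2) : Pos) ∈ L.cells := by
    rw [mem_cells]
    simp only
    omega
  by_contra hne
  have := mem_between (A₂ := []) h hr (by unfold Before at hpq ⊢; simp only; omega)
    (Or.inr ⟨rfl, by simp only; omega⟩)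
  simp at this

/-- The cell below `p` belongs to the array, because `q` is in a later row. If it were not `q`, it
would come between `p` and `q`, where `hA` excludes its column. -/
theorem next_down (h : L.cells = A₁ ++ p :: (A₂ ++ q :: A₃)) (hpq : p.2 = q.2)
    (hA : ∀ r ∈ A₂, r.2 ≠ p.2) : q = p + Direction.down.vec := by
  have hp := L.mem_cells.1 (show p ∈ L.cells by simp [h])
  have hq := L.mem_cells.1 (show q ∈ L.cells by simp [h])
  have hlt : Before p q := before_right h (by simp)
  unfold Before at hlt
  have hr : p + Direction.down.vec ∈ L.cells := by
    rw [mem_cells]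
    simp only [Direction.vec, Prod.fst_add, Prod.snd_add]
    omega
  by_contra hne
  have hlt' : Before (p + Direction.down.vec) q := by
    unfold Before
    simp only [Direction.vec, Prod.fst_add, Prod.snd_add]
    by_contra hcon
    apply hne
    ext
    · simp only [Direction.vec, Prod.fst_add]
      omega
    · simp only [Direction.vec, Prod.snd_add]
      omega
  refine hA _ (mem_between h hr ?_ hlt') ?_
  · unfold Before
    simp only [Direction.vec, Prod.fst_add, Prod.snd_add]
    omega
  · simp [Direction.vec]

end Order

section Update

variable {L}

theorem map_letter_update {t : ℕ} {D : Pos → CellState} {A : List Pos} {p : Pos} (hp : p ∉ A)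
    (x : CellState) :
    A.map (fun q => (Sum.inr (L.letter t (Function.update D p x) q) : Letter)) =
      A.map fun q => Sum.inr (L.letter t D q) := by
  refine List.map_congr_left fun q hq => ?_
  have : q ≠ p := fun h => hp (h ▸ hq)
  simp [letter, Function.update_of_ne this]

theorem map_cells_update {t : ℕ} {D : Pos → CellState} {A₁ A₂ : List Pos} {p : Pos}
    (h : L.cells = A₁ ++ p :: A₂) (x : CellState) :
    L.cells.map (fun q => (Sum.inr (L.letter t (Function.update D p x) q) : Letter)) =
      A₁.map (fun q => Sum.inr (L.letter t D q)) ++ Sum.inr { L.letter t D p with st := x } ::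
        A₂.map fun q => Sum.inr (L.letter t D q) := by
  obtain ⟨h₁, h₂⟩ := notMem_of_cells h
  rw [h, List.map_append, List.map_cons, map_letter_update h₁, map_letter_update h₂]
  simp [letter]

theorem map_cells_update₂ {t : ℕ} {D : Pos → CellState} {A₁ A₂ A₃ : List Pos} {p q : Pos}
    (h : L.cells = A₁ ++ p :: (A₂ ++ q :: A₃)) (x y : CellState) :
    L.cells.map (fun r => (Sum.inr (L.letter t
      (Function.update (Function.update D p x) q y) r) : Letter)) =
      A₁.map (fun r => Sum.inr (L.letter t D r)) ++ Sum.inr { L.letter t D p with st := x } ::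
        (A₂.map (fun r => Sum.inr (L.letter t D r)) ++ Sum.inr { L.letter t D q with st := y } ::
        A₃.map fun r => Sum.inr (L.letter t D r)) := by
  obtain ⟨h₁, h₂⟩ := notMem_of_cells h
  simp only [List.mem_append, List.mem_cons, not_or] at h₂
  rw [map_cells_update (A₁ := A₁ ++ p :: A₂) (A₂ := A₃) (by simpa using h), List.map_append,
    List.map_cons, map_letter_update h₁, map_letter_update h₂.1, map_letter_update h₂.2.2]
  simp [letter, Function.update_of_ne (Ne.symm h₂.2.1)]

end Update

end Layout

/-! ### Words in products of languages -/

theorem mem_all_one_all {α : Type} {P Q R : α → Prop} {z : List α} :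
    z ∈ allLetters P * oneLetter Q * allLetters R ↔
      ∃ a x b, z = a ++ x :: b ∧ (∀ y ∈ a, P y) ∧ Q x ∧ ∀ y ∈ b, R y := by
  constructor
  · rintro ⟨_, ⟨a, ha, _, ⟨x, rfl, hx⟩, rfl⟩, b, hb, rfl⟩
    exact ⟨a, x, b, by simp, ha, hx, hb⟩
  · rintro ⟨a, x, b, rfl, ha, hx, hb⟩
    exact ⟨a ++ [x], ⟨a, ha, [x], ⟨x, rfl, hx⟩, rfl⟩, b, hb, by simp⟩

theorem mem_all_one_all_one_all {α : Type} {P Q R S T : α → Prop} {z : List α} :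
    z ∈ allLetters P * oneLetter Q * allLetters R * oneLetter S * allLetters T ↔
      ∃ a x b y c, z = a ++ x :: (b ++ y :: c) ∧ (∀ y ∈ a, P y) ∧ Q x ∧ (∀ y ∈ b, R y) ∧ S y ∧
        ∀ y ∈ c, T y := by
  constructor
  · rintro ⟨_, ⟨w, hw, _, ⟨y, rfl, hy⟩, rfl⟩, c, hc, rfl⟩
    obtain ⟨a, x, b, rfl, ha, hx, hb⟩ := mem_all_one_all.1 hw
    exact ⟨a, x, b, y, c, by simp, ha, hx, hb, hy, hc⟩
  · rintro ⟨a, x, b, y, c, rfl, ha, hx, hb, hy, hc⟩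
    exact ⟨a ++ x :: b ++ [y], ⟨_, mem_all_one_all.2 ⟨a, x, b, rfl, ha, hx, hb⟩, [y],
      ⟨y, rfl, hy⟩, rfl⟩, c, hc, by simp⟩

theorem map_snd_eq_of_keep {a : List LetterPair} {Q : GridLetter → GridLetter → Prop}
    (hQ : ∀ x y, Q x y → y = x) (h : ∀ z ∈ a, GridPair Q z) : a.map Prod.snd = a.map Prod.fst := by
  refine List.map_congr_left fun z hz => ?_
  obtain ⟨x, y, rfl, hxy⟩ := h z hz
  rw [hQ x y hxy]

theorem append_map_inl_inj {α β : Type} {a b : List (α ⊕ β)} {u : List α} {v : List β}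
    (h : a ++ b = u.map Sum.inl ++ v.map Sum.inr) (ha : ∀ x ∈ a, x.isLeft) (hb : ∀ x ∈ b, x.isRight) :
    a = u.map Sum.inl ∧ b = v.map Sum.inr := by
  induction a generalizing u with
  | nil =>
    cases u with
    | nil => exact ⟨rfl, by simpa using h⟩
    | cons x u =>
      simp only [List.nil_append, List.map_cons, List.cons_append] at h
      have := hb (.inl x) (by simp [h])
      simp at this
  | cons x a ih =>
    cases u with
    | nil =>
      cases v with
      | nil => simp at h
      | cons y v =>
        simp only [List.cons_append, List.map_nil, List.nil_append, List.map_cons,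
          List.cons.injEq] at h
        have := ha x (by simp)
        rw [h.1] at this
        simp at this
    | cons y u =>
      simp only [List.cons_append, List.map_cons, List.cons.injEq] at h
      obtain ⟨h₁, h₂⟩ := ih h.2 fun x hx => ha x (by simp [hx])
      exact ⟨by rw [h.1, h₁]; rfl, h₂⟩

/-! ### Words of the step languages describe steps of the verifier -/

namespace Layout

variable {L : Layout} {t : ℕ} {D : Pos → CellState} {c : Color}

local notation "word" D => L.cells.map fun p => (Sum.inr (L.letter t D p) : Letter)

theorem solo_sound {a : SoloAction} {z : List LetterPair} (hz : z ∈ soloLang c a)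
    (hu : z.map Prod.fst = word D) :
    ∃ p ∈ L.squares, (∀ q ∈ L.squares, a.Guard (D q)) ∧ a.Pre c (L.rail p) (D p) ∧
      z.map Prod.snd = word (Function.update D p (a.effect (D p))) := by
  obtain ⟨α, _, β, rfl, hα, ⟨x, y, rfl, hx₁, hx₂, hx₃, rfl⟩, hβ⟩ := mem_all_one_all.1 hz
  rw [List.map_append, List.map_cons] at hu
  obtain ⟨A₁, A, hA, hA₁, hA'⟩ := List.map_eq_append_iff.1 hu.symm
  obtain ⟨p, A₂, rfl, hp, hA₂⟩ := List.map_eq_cons_iff.1 hA'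
  simp only [Sum.inr.injEq] at hp
  subst hp
  refine ⟨p, hx₁, fun q hq => ?_, hx₃, ?_⟩
  · have hq' := L.square_mem_cells hq
    rw [hA] at hq'
    have aux : ∀ B : List Pos, ∀ γ : List LetterPair, (∀ z ∈ γ, GridPair (GridLetter.SoloGuard a) z) →
        B.map (fun p => (Sum.inr (L.letter t D p) : Letter)) = γ.map Prod.fst → q ∈ B →
        a.Guard (D q) := by
      intro B γ hγ hB hqB
      have : (Sum.inr (L.letter t D q) : Letter) ∈ γ.map Prod.fst := by
        rw [← hB]
        exact List.mem_map_of_mem hqB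
      obtain ⟨z, hz, hz'⟩ := List.mem_map.1 this
      obtain ⟨x, y, rfl, -, h⟩ := hγ z hz
      simp only [Sum.inr.injEq] at hz'
      subst hz'
      exact h hq
    rcases List.mem_append.1 hq' with hq' | hq'
    · exact aux A₁ α hα hA₁ hq'
    · rcases List.mem_cons.1 hq' with rfl | hq'
      · exact hx₂
      · exact aux A₂ β hβ hA₂ hq'
  · rw [map_cells_update hA, List.map_append, List.map_cons,
      map_snd_eq_of_keep (fun _ _ h => h.1) hα, map_snd_eq_of_keep (fun _ _ h => h.1) hβ, hA₁, hA₂]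
    rfl

/-- The marks are translated back into positions: a letter is marked exactly if its cell is in
column `t`. -/
theorem gap_sound {v : Prop} {x x' y y' : GridLetter} {z : List LetterPair}
    (hz : z ∈ gapLang v x x' y y') (hu : z.map Prod.fst = word D) :
    ∃ A₁ p A₂ q A₃, L.cells = A₁ ++ p :: (A₂ ++ q :: A₃) ∧ x = L.letter t D p ∧
      y = L.letter t D q ∧ (v → p.2 = q.2 ∧ ∀ r ∈ A₂, r.2 ≠ p.2) ∧ (¬ v → A₂ = []) ∧
      z.map Prod.snd = A₁.map (fun r => Sum.inr (L.letter t D r)) ++ Sum.inr x' ::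
        (A₂.map (fun r => Sum.inr (L.letter t D r)) ++ Sum.inr y' ::
        A₃.map fun r => Sum.inr (L.letter t D r)) := by
  obtain ⟨α, _, β, _, γ, rfl, hα, ⟨rfl, hx⟩, hβ, ⟨rfl, hy⟩, hγ⟩ := mem_all_one_all_one_all.1 hz
  simp only [List.map_append, List.map_cons] at hu ⊢
  obtain ⟨A₁, A, hA, hA₁, hA'⟩ := List.map_eq_append_iff.1 hu.symm
  obtain ⟨p, A', rfl, hp, hA''⟩ := List.map_eq_cons_iff.1 hA'
  obtain ⟨A₂, A'', rfl, hA₂, hA'''⟩ := List.map_eq_append_iff.1 hA''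
  obtain ⟨q, A₃, rfl, hq, hA₃⟩ := List.map_eq_cons_iff.1 hA'''
  simp only [Sum.inr.injEq] at hp hq
  have hcol : ∀ r, (L.letter t D r).col = true ↔ r.2 = L.o.2 + t := by simp [letter]
  refine ⟨A₁, p, A₂, q, A₃, hA, hp.symm, hq.symm, fun hv => ⟨?_, fun r hr => ?_⟩, fun hv => ?_, ?_⟩
  · have h₁ := hx hv
    have h₂ := hy hv
    rw [← hp, hcol] at h₁
    rw [← hq, hcol] at h₂
    rw [h₁, h₂]
  · have h₁ := hx hv
    rw [← hp, hcol] at h₁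
    have : (Sum.inr (L.letter t D r) : Letter) ∈ β.map Prod.fst := by
      rw [← hA₂]
      exact List.mem_map_of_mem hr
    obtain ⟨z, hz, hz'⟩ := List.mem_map.1 this
    obtain ⟨a, b, rfl, -, -, h⟩ := hβ z hz
    simp only [Sum.inr.injEq] at hz'
    subst hz'
    rw [h₁, ne_eq, ← hcol r, h]
    simp
  · rcases β with _ | ⟨z, β⟩
    · simpa using hA₂
    · obtain ⟨_, _, -, -, h, -⟩ := hβ z (by simp)
      exact absurd h hv
  · rw [map_snd_eq_of_keep (fun _ _ h => h) hα, map_snd_eq_of_keep (fun _ _ h => h.1) hβ,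
      map_snd_eq_of_keep (fun _ _ h => h) hγ, hA₁, hA₂, hA₃]

theorem square_lt {p : Pos} (hp : p ∈ L.squares) : p.2 < L.o.2 + L.w := (L.square_mem p hp).2.2.2

/-- The letters that a pair rule may change belong to adjacent cells. -/
theorem forward_adjacent {d : Direction} (hd : d.IsForward) {A₁ A₂ A₃ : List Pos} {p q : Pos}
    (h : L.cells = A₁ ++ p :: (A₂ ++ q :: A₃))
    (hv : d.IsVertical → p.2 = q.2 ∧ ∀ r ∈ A₂, r.2 ≠ p.2) (hn : ¬ d.IsVertical → A₂ = [])
    (hp : p ∈ L.squares) : q = p + d.vec := by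
  cases d with
  | up => exact hd.elim
  | left => exact hd.elim
  | down => exact next_down h (hv trivial).1 (hv trivial).2
  | right =>
    obtain rfl := hn id
    exact next_right h (square_lt hp)

/-- The second alternative occurs in direction `left`: the letter before a cell of the first column
is the end mark of the previous row. Neither this mark nor the position to the left of the array is
a square, so the `void` rule is still correct. -/
theorem backward_adjacent {d : Direction} (hd : ¬ d.IsForward) {A₁ A₂ A₃ : List Pos} {p q : Pos}
    (h : L.cells = A₁ ++ p :: (A₂ ++ q :: A₃))
    (hv : d.IsVertical → p.2 = q.2 ∧ ∀ r ∈ A₂, r.2 ≠ p.2) (hn : ¬ d.IsVertical → A₂ = []) :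
    p = q + d.vec ∨ (p ∉ L.squares ∧ q + d.vec ∉ L.squares) := by
  cases d with
  | right => exact absurd trivial hd
  | down => exact absurd trivial hd
  | up =>
    refine Or.inl ?_
    rw [next_down h (hv trivial).1 (hv trivial).2]
    ext <;> simp [Direction.vec]
  | left =>
    obtain rfl := hn id
    have hp := L.mem_cells.1 (show p ∈ L.cells by simp [h])
    rcases lt_or_eq_of_le hp.2.2 with hlt | heq
    · refine Or.inl ?_
      rw [next_right h hlt]
      ext <;> simp [Direction.vec]
    · refine Or.inr ⟨fun hp' => ?_, fun hq => ?_⟩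
      · have := square_lt hp'
        omega
      · have h₁ := next_endRow h heq
        have h₂ := (L.square_mem _ hq).2.2.1
        simp only [Direction.vec, Prod.snd_add] at h₂
        omega

/-- The `void` rule in `pairLang` is a change of two cells of which one stays the same, whereas
`VerifierStep.void` updates a single cell. -/
theorem update_update_self {p q : Pos} (x : CellState) (hpq : q ≠ p) :
    Function.update (Function.update D p x) q (D q) = Function.update D p x := by
  have : D q = Function.update D p x q := by rw [Function.update_of_ne hpq]
  rw [this, Function.update_eq_self]

theorem pair_sound {d : Direction} {z : List LetterPair} (hz : z ∈ pairLang d)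
    (hu : z.map Prod.fst = word D) {l : List Bool} :
    ∃ D', z.map Prod.snd = (word D') ∧
      VerifierStep L.squares L.rail c (l, D) (l, D') := by
  obtain ⟨⟨x, y, x', y'⟩, hrule, hf, hb⟩ := hz
  simp only at hrule hf hb
  by_cases hd : d.IsForward
  · obtain ⟨A₁, p, A₂, q, A₃, hA, rfl, rfl, hv, hn, hsnd⟩ := gap_sound (hf hd) hu
    have hne : q ≠ p := by
      rintro rfl
      exact (notMem_of_cells hA).2 (by simp)
    cases hrule with
    | pair a hp hq hpre =>
      have hadj := forward_adjacent hd hA hv hn hp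
      rw [hadj] at hA hq hsnd
      refine ⟨_, ?_, .pair a d p hp hq (by rw [hadj] at hpre; exact hpre)⟩
      rw [map_cells_update₂ hA, hsnd]
      rfl
    | void hp hq =>
      have hadj := forward_adjacent hd hA hv hn hp
      refine ⟨_, ?_, .void d p hp (by rw [← hadj]; exact hq)⟩
      rw [← update_update_self _ hne, map_cells_update₂ hA, hsnd]
      rfl
  · obtain ⟨A₁, q, A₂, p, A₃, hA, rfl, rfl, hv, hn, hsnd⟩ := gap_sound (hb hd) hu
    have hne : q ≠ p := by
      rintro rfl
      exact (notMem_of_cells hA).2 (by simp)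
    have hadj := backward_adjacent hd hA hv hn
    cases hrule with
    | pair a hp hq hpre =>
      have hadj := hadj.resolve_right fun h => h.1 hq
      rw [hadj] at hA hq hsnd
      refine ⟨_, ?_, .pair a d p hp hq (by rw [hadj] at hpre; exact hpre)⟩
      rw [Function.update_comm (by rw [← hadj]; exact hne.symm), map_cells_update₂ hA, hsnd]
      rfl
    | void hp hq =>
      refine ⟨_, ?_, .void d p hp (hadj.elim (fun h => by rw [← h]; exact hq) fun h => h.2)⟩
      rw [← update_update_self _ hne, Function.update_comm hne.symm, map_cells_update₂ hA, hsnd]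
      rfl

/-- A neighbour in the array would lie on that side of `p` on which the word contains no letter of
the inspected column if `d` is vertical, and no letter at all if `d` is horizontal. -/
theorem edge_sound {d : Direction} {z : List LetterPair} (hz : z ∈ edgeLang d)
    (hu : z.map Prod.fst = word D) {l : List Bool} :
    ∃ D', z.map Prod.snd = (word D') ∧
      VerifierStep L.squares L.rail c (l, D) (l, D') := by
  obtain ⟨α, _, β, rfl, hα, ⟨x, y, rfl, hx, hxc, rfl⟩, hβ⟩ := mem_all_one_all.1 hz
  rw [List.map_append, List.map_cons] at hu
  obtain ⟨A₁, A, hA, hA₁, hA'⟩ := List.map_eq_append_iff.1 hu.symm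
  obtain ⟨p, A₂, rfl, hp, hA₂⟩ := List.map_eq_cons_iff.1 hA'
  simp only [Sum.inr.injEq] at hp
  subst hp
  have hcol : ∀ r, (L.letter t D r).col = true ↔ r.2 = L.o.2 + t := by simp [letter]
  refine ⟨_, ?_, .void d p hx fun hpd => ?_⟩
  · rw [map_cells_update hA, List.map_append, List.map_cons,
      map_snd_eq_of_keep (fun _ _ h => h.1) hα, map_snd_eq_of_keep (fun _ _ h => h.1) hβ, hA₁, hA₂]
    rfl
  · have hmem := L.square_mem_cells hpd
    have aux : ∀ (B : List Pos) (γ : List LetterPair) (v : Prop),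
        (∀ z ∈ γ, GridPair (fun a b => b = a ∧ (v → d.IsVertical ∧ a.col = false)) z) →
        B.map (fun p => (Sum.inr (L.letter t D p) : Letter)) = γ.map Prod.fst → v →
        p + d.vec ∉ B := by
      intro B γ v hγ hB hv hpB
      have : (Sum.inr (L.letter t D (p + d.vec)) : Letter) ∈ γ.map Prod.fst := by
        rw [← hB]
        exact List.mem_map_of_mem (f := fun p => (Sum.inr (L.letter t D p) : Letter)) hpB
      obtain ⟨z, hz, hz'⟩ := List.mem_map.1 this
      obtain ⟨x, y, rfl, -, h⟩ := hγ z hz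
      simp only [Sum.inr.injEq] at hz'
      subst hz'
      obtain ⟨hvert, hcol'⟩ := h hv
      have h₁ := (hcol p).1 (hxc hvert)
      have h₂ : ¬ (p + d.vec).2 = L.o.2 + t := by rw [← hcol, hcol']; simp
      cases d <;> first | exact hvert.elim | (simp [Direction.vec] at h₂; exact h₂ h₁)
    by_cases hd : d.IsForward
    · refine aux A₂ β _ hβ hA₂ hd (mem_right hA hmem ?_)
      cases d <;> first | exact hd.elim | (simp [Before, Direction.vec])
    · refine aux A₁ α _ hα hA₁ hd (mem_left hA hmem ?_)
      cases d <;> first | exact absurd trivial hd | (simp [Before, Direction.vec])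

/-- All letters of such a word are cells; this locates the boundary between digits and cells in
`split_block`. -/
theorem gridPair_of_action {z : List LetterPair} (hz : z ∈ actionLang c ∨ z ∈ soloLang c .grab) :
    ∀ y ∈ z, ∃ Q, GridPair Q y := by
  have solo : ∀ a, z ∈ soloLang c a → ∀ y ∈ z, ∃ Q, GridPair Q y := by
    intro a hz y hy
    obtain ⟨α, x, β, rfl, hα, hx, hβ⟩ := mem_all_one_all.1 hz
    rcases List.mem_append.1 hy with hy | hy
    · exact ⟨_, hα y hy⟩
    · rcases List.mem_cons.1 hy with rfl | hy
      · exact ⟨_, hx⟩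
      · exact ⟨_, hβ y hy⟩
  have gap : ∀ v x x' y y', z ∈ gapLang v x x' y y' → ∀ y ∈ z, ∃ Q, GridPair Q y := by
    intro v f f' g g' hz y hy
    obtain ⟨α, _, β, _, γ, rfl, hα, ⟨rfl, -⟩, hβ, ⟨rfl, -⟩, hγ⟩ := mem_all_one_all_one_all.1 hz
    simp only [List.mem_append, List.mem_cons] at hy
    rcases hy with hy | rfl | hy | rfl | hy
    · exact ⟨_, hα y hy⟩
    · exact ⟨fun _ _ => True, f, f', rfl, trivial⟩
    · exact ⟨_, hβ y hy⟩
    · exact ⟨fun _ _ => True, g, g', rfl, trivial⟩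
    · exact ⟨_, hγ y hy⟩
  rcases hz with (⟨a, hz⟩ | ⟨d, x, -, hf, hb⟩ | ⟨d, hz⟩) | hz
  · exact solo _ hz
  · by_cases hd : d.IsForward
    · exact gap _ _ _ _ _ (hf hd)
    · exact gap _ _ _ _ _ (hb hd)
  · intro y hy
    obtain ⟨α, x, β, rfl, hα, hx, hβ⟩ := mem_all_one_all.1 hz
    rcases List.mem_append.1 hy with hy | hy
    · exact ⟨_, hα y hy⟩
    · rcases List.mem_cons.1 hy with rfl | hy
      · exact ⟨_, hx⟩
      · exact ⟨_, hβ y hy⟩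
  · exact solo _ hz

theorem action_sound {z : List LetterPair} (hz : z ∈ actionLang c)
    (hu : z.map Prod.fst = word D) {l : List Bool} :
    ∃ D', z.map Prod.snd = (word D') ∧
      VerifierStep L.squares L.rail c (l, D) (l, D') := by
  rcases hz with ⟨⟨a, ha⟩, hz⟩ | ⟨d, hz⟩ | ⟨d, hz⟩
  · obtain ⟨p, hp, hg, hpre, hsnd⟩ := solo_sound hz hu
    exact ⟨_, hsnd, .solo a p ha hp hg hpre⟩
  · exact pair_sound hz hu
  · exact edge_sound hz hu

end Layout

theorem keepBits_sound {z : List LetterPair} (hz : z ∈ keepBits) :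
    z.map Prod.snd = z.map Prod.fst := by
  refine List.map_congr_left fun y hy => ?_
  obtain ⟨a, b, rfl, rfl⟩ := hz y hy
  rfl

theorem decrementBits_sound {z : List LetterPair} (hz : z ∈ decrementBits) {bits cs : List Bool}
    (hlen : cs.length = bits.length) (hu : z.map Prod.fst = (bits.zip cs).map Sum.inl) :
    ∃ cs', Decrement cs cs' ∧ z.map Prod.snd = (bits.zip cs').map Sum.inl := by
  obtain ⟨α, _, β, rfl, hα, ⟨x, y, rfl, hx, rfl⟩, hβ⟩ := mem_all_one_all.1 hz
  clear hz
  induction α generalizing bits cs with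
  | nil =>
    rcases bits with _ | ⟨b, bits⟩
    · simp at hu
    rcases cs with _ | ⟨e, cs⟩
    · simp at hu
    simp only [List.nil_append, List.map_cons, List.zip_cons_cons, List.cons.injEq,
      Sum.inl.injEq] at hu
    obtain ⟨rfl, hu⟩ := hu
    obtain rfl : e = true := by simpa using hx
    exact ⟨false :: cs, .here cs, by simp [keepBits_sound hβ, hu]⟩
  | cons a α ih =>
    rcases bits with _ | ⟨b, bits⟩
    · simp at hu
    rcases cs with _ | ⟨e, cs⟩
    · simp at hu
    obtain ⟨x', y', rfl, hx', rfl⟩ := hα a (by simp)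
    simp only [List.cons_append, List.map_cons, List.zip_cons_cons, List.cons.injEq,
      Sum.inl.injEq] at hu
    obtain ⟨rfl, hu⟩ := hu
    obtain rfl : e = false := by simpa using hx'
    obtain ⟨cs', h, h'⟩ := ih (by simpa using hlen) (fun y hy => hα y (by simp [hy])) hu
    exact ⟨true :: cs', .borrow h, by simp [h']⟩

theorem isLeft_of_decrementBits {z : List LetterPair} (hz : z ∈ decrementBits) :
    ∀ y ∈ z, ∃ Q, BitPair Q y := by
  intro y hy
  obtain ⟨α, x, β, rfl, hα, hx, hβ⟩ := mem_all_one_all.1 hz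
  rcases List.mem_append.1 hy with hy | hy
  · exact ⟨_, hα y hy⟩
  · rcases List.mem_cons.1 hy with rfl | hy
    · exact ⟨_, hx⟩
    · exact ⟨_, hβ y hy⟩

namespace Layout

variable {L : Layout} {t : ℕ} {D : Pos → CellState} {c : Color}

theorem split_block {z₁ z₂ : List LetterPair} {bits cs : List Bool}
    (h₁ : ∀ y ∈ z₁, ∃ Q, BitPair Q y) (h₂ : ∀ y ∈ z₂, ∃ Q, GridPair Q y)
    (hu : (z₁ ++ z₂).map Prod.fst = L.block bits cs t D) :
    z₁.map Prod.fst = (bits.zip cs).map Sum.inl ∧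
      z₂.map Prod.fst = L.cells.map fun p => Sum.inr (L.letter t D p) := by
  have hfun : (fun p => (Sum.inr (L.letter t D p) : Letter)) = Sum.inr ∘ L.letter t D := rfl
  rw [block, List.map_append, hfun, ← List.map_map] at hu
  rw [hfun, ← List.map_map]
  refine append_map_inl_inj hu ?_ ?_
  · intro x hx
    obtain ⟨y, hy, rfl⟩ := List.mem_map.1 hx
    obtain ⟨Q, a, b, rfl, -⟩ := h₁ y hy
    rfl
  · intro x hx
    obtain ⟨y, hy, rfl⟩ := List.mem_map.1 hx
    obtain ⟨Q, a, b, rfl, -⟩ := h₂ y hy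
    rfl

theorem step_sound {z : List LetterPair} {bits cs : List Bool}
    (hz : z ∈ keepBits * actionLang c ⊔ decrementBits * soloLang c .grab)
    (hlen : cs.length = bits.length) (hu : z.map Prod.fst = L.block bits cs t D) :
    ∃ cs' D', z.map Prod.snd = L.block bits cs' t D' ∧ cs'.length = bits.length ∧
      VerifierStep L.squares L.rail c (cs, D) (cs', D') := by
  rcases hz with ⟨z₁, hz₁, z₂, hz₂, rfl⟩ | ⟨z₁, hz₁, z₂, hz₂, rfl⟩
  · obtain ⟨h₁, h₂⟩ := split_block (fun y hy => ⟨_, hz₁ y hy⟩) (gridPair_of_action (.inl hz₂)) hu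
    obtain ⟨D', h, hstep⟩ := action_sound hz₂ h₂ (l := cs)
    exact ⟨cs, D', by simp [block, keepBits_sound hz₁, h₁, h], hlen, hstep⟩
  · obtain ⟨h₁, h₂⟩ := split_block (isLeft_of_decrementBits hz₁)
      (gridPair_of_action (c := c) (.inr hz₂)) hu
    obtain ⟨cs', hdec, h⟩ := decrementBits_sound hz₁ hlen h₁
    obtain ⟨p, hp, hg, hpre, hsnd⟩ := solo_sound hz₂ h₂
    exact ⟨cs', _, by simp [block, h, hsnd], hdec.length.symm.trans hlen,
      .grab p hdec hp hg hpre⟩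

end Layout

end PushFight

namespace PushFight

open RegularRewriting

/-! ### Steps of the verifier are described by words of the step languages -/

namespace Layout

variable {L : Layout} {t : ℕ} {D : Pos → CellState} {c : Color} {p q : Pos}

local notation "word" D => L.cells.map fun p => (Sum.inr (L.letter t D p) : Letter)

/-- The cells in `A` remain unchanged. -/
def keepWord (L : Layout) (t : ℕ) (D : Pos → CellState) (A : List Pos) : List LetterPair :=
  A.map fun p => (Sum.inr (L.letter t D p), Sum.inr (L.letter t D p))

theorem keepWord_fst (A : List Pos) : (L.keepWord t D A).map Prod.fst =
    A.map fun p => Sum.inr (L.letter t D p) := by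
  rw [keepWord, List.map_map]
  rfl

theorem keepWord_snd (A : List Pos) : (L.keepWord t D A).map Prod.snd =
    A.map fun p => Sum.inr (L.letter t D p) := by
  rw [keepWord, List.map_map]
  rfl

theorem forall_keepWord {Q : GridLetter → GridLetter → Prop} {A : List Pos}
    (h : ∀ r ∈ A, Q (L.letter t D r) (L.letter t D r)) : ∀ z ∈ L.keepWord t D A, GridPair Q z := by
  intro z hz
  obtain ⟨r, hr, rfl⟩ := List.mem_map.1 hz
  exact ⟨_, _, rfl, h r hr⟩

theorem exists_soloWord {a : SoloAction} (hp : p ∈ L.squares)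
    (hg : ∀ q ∈ L.squares, a.Guard (D q)) (hpre : a.Pre c (L.rail p) (D p)) :
    ∃ z ∈ soloLang c a, z.map Prod.fst = (word D) ∧
      z.map Prod.snd = word (Function.update D p (a.effect (D p))) := by
  obtain ⟨A₁, A₂, hA⟩ := List.append_of_mem (L.square_mem_cells hp)
  refine ⟨L.keepWord t D A₁ ++ (Sum.inr (L.letter t D p),
    Sum.inr { L.letter t D p with st := a.effect (D p) }) :: L.keepWord t D A₂,
    mem_all_one_all.2 ⟨_, _, _, rfl, forall_keepWord fun r _ => ⟨rfl, hg r⟩,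
      ⟨_, _, rfl, hp, hg p hp, hpre, rfl⟩, forall_keepWord fun r _ => ⟨rfl, hg r⟩⟩, ?_, ?_⟩
  · rw [hA]
    simp [keepWord_fst]
  · rw [map_cells_update hA]
    simp [keepWord_snd]

theorem exists_gapWord {v : Prop} {A₁ A₂ A₃ : List Pos} (hA : L.cells = A₁ ++ p :: (A₂ ++ q :: A₃))
    (hv : v → p.2 = L.o.2 + t ∧ q.2 = L.o.2 + t ∧ ∀ r ∈ A₂, r.2 ≠ p.2) (hn : ¬ v → A₂ = [])
    (x y : CellState) :
    ∃ z ∈ gapLang v (L.letter t D p) { L.letter t D p with st := x } (L.letter t D q)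
        { L.letter t D q with st := y },
      z.map Prod.fst = (word D) ∧
      z.map Prod.snd = word (Function.update (Function.update D p x) q y) := by
  refine ⟨L.keepWord t D A₁ ++ (Sum.inr (L.letter t D p),
    Sum.inr { L.letter t D p with st := x }) :: (L.keepWord t D A₂ ++ (Sum.inr (L.letter t D q),
    Sum.inr { L.letter t D q with st := y }) :: L.keepWord t D A₃),
    mem_all_one_all_one_all.2 ⟨_, _, _, _, _, rfl, forall_keepWord fun r _ => rfl,
      ⟨rfl, fun h => ?_⟩, forall_keepWord fun r hr => ⟨rfl, ?_⟩, ⟨rfl, fun h => ?_⟩,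
      forall_keepWord fun r _ => rfl⟩, ?_, ?_⟩
  · simp [letter, (hv h).1]
  · by_cases h : v
    · refine ⟨h, ?_⟩
      have := (hv h).2.2 r hr
      rw [(hv h).1] at this
      simp [letter, this]
    · simp [hn h] at hr
  · simp [letter, (hv h).2.1]
  · rw [hA]
    simp [keepWord_fst]
  · rw [map_cells_update₂ hA]
    simp [keepWord_snd]

theorem exists_gap {d : Direction} (hd : d.IsForward) (hp : p ∈ L.cells)
    (hq : p + d.vec ∈ L.cells) :
    ∃ A₁ A₂ A₃, L.cells = A₁ ++ p :: (A₂ ++ (p + d.vec) :: A₃) ∧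
      (d.IsVertical → ∀ r ∈ A₂, r.2 ≠ p.2) ∧ (¬ d.IsVertical → A₂ = []) := by
  obtain ⟨A₁, A, hA⟩ := List.append_of_mem hp
  have hpq : Before p (p + d.vec) := by
    cases d <;> first | exact hd.elim | simp [Before, Direction.vec]
  obtain ⟨A₂, A₃, rfl⟩ := List.append_of_mem (mem_right hA hq hpq)
  have hbetween : ∀ r ∈ A₂, Before p r ∧ Before r (p + d.vec) := fun r hr =>
    ⟨before_right hA (by simp [hr]), before_left (A₁ := A₁ ++ p :: A₂) (A₂ := A₃)
      (by simpa using hA) (by simp [hr])⟩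
  refine ⟨A₁, A₂, A₃, hA, fun hv r hr => ?_, fun hv => List.eq_nil_iff_forall_not_mem.2
    fun r hr => ?_⟩
  · obtain ⟨h₁, h₂⟩ := hbetween r hr
    cases d <;> first | exact hd.elim | exact hv.elim |
      (simp only [Before, Direction.vec, Prod.fst_add, Prod.snd_add] at h₁ h₂; omega)
  · obtain ⟨h₁, h₂⟩ := hbetween r hr
    cases d <;> first | exact hd.elim | exact (hv trivial).elim |
      (simp only [Before, Direction.vec, Prod.fst_add, Prod.snd_add] at h₁ h₂; omega)

theorem vertical_snd {d : Direction} (hd : d.IsVertical) : (p + d.vec).2 = p.2 := by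
  cases d <;> first | exact hd.elim | simp [Direction.vec]

theorem exists_adjacentWord {d : Direction} (hp : p ∈ L.cells) (hq : p + d.vec ∈ L.cells)
    (ht : p.2 = L.o.2 + t) {x y : CellState}
    (hrule : GridLetter.PairRule d (L.letter t D p) (L.letter t D (p + d.vec))
      { L.letter t D p with st := x } { L.letter t D (p + d.vec) with st := y }) :
    ∃ z ∈ pairLang d, z.map Prod.fst = (word D) ∧
      z.map Prod.snd = word (Function.update (Function.update D p x) (p + d.vec) y) := by
  by_cases hd : d.IsForward
  · obtain ⟨A₁, A₂, A₃, hA, hv, hn⟩ := exists_gap hd hp hq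
    obtain ⟨z, hz, h₁, h₂⟩ := exists_gapWord (t := t) (D := D) (v := d.IsVertical) hA
      (fun h => ⟨ht, (vertical_snd h).trans ht, hv h⟩) hn x y
    exact ⟨z, ⟨(_, _, _, _), hrule, fun _ => hz, fun h => absurd hd h⟩, h₁, h₂⟩
  -- For a backward direction the neighbour comes first in the word, so the gap is described from
  -- there in the opposite direction `e`.
  · obtain ⟨e, he, hep, hev⟩ : ∃ e : Direction, e.IsForward ∧ p + d.vec + e.vec = p ∧
        (e.IsVertical ↔ d.IsVertical) := by
      cases d with
      | right => exact absurd trivial hd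
      | down => exact absurd trivial hd
      | up => exact ⟨.down, trivial, by simp [add_assoc, Direction.vec], Iff.rfl⟩
      | left => exact ⟨.right, trivial, by simp [add_assoc, Direction.vec], Iff.rfl⟩
    obtain ⟨A₁, A₂, A₃, hA, hv, hn⟩ := exists_gap he hq (by rwa [hep])
    rw [hep] at hA
    obtain ⟨z, hz, h₁, h₂⟩ := exists_gapWord (t := t) (D := D) (v := d.IsVertical) hA
      (fun h => ⟨(vertical_snd h).trans ht, ht, hv (hev.2 h)⟩) (fun h => hn (by rwa [hev])) y x
    refine ⟨z, ⟨(_, _, _, _), hrule, fun h => absurd h hd, fun _ => hz⟩, h₁, ?_⟩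
    rw [h₂, Function.update_comm (add_vec_ne p d)]

/-- A neighbour in the array is handled by a pair rule, and a missing one by `edgeLang`. To the
right a neighbour is never missing, because every row has an end mark. To the left, the end mark of
the previous row plays the part of the neighbour, unless the square is the first letter of the
array. -/
theorem exists_voidWord {d : Direction} (hp : p ∈ L.squares) (hq : p + d.vec ∉ L.squares)
    (ht : p.2 = L.o.2 + t) :
    ∃ z, (z ∈ pairLang d ∨ z ∈ edgeLang d) ∧ z.map Prod.fst = (word D) ∧
      z.map Prod.snd = word (Function.update D p ((D p).markVoid d)) := by
  have hpc := L.square_mem_cells hp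
  have hp' := L.square_mem p hp
  by_cases hqc : p + d.vec ∈ L.cells
  · obtain ⟨z, hz, h₁, h₂⟩ := exists_adjacentWord (D := D) (y := D (p + d.vec)) hpc hqc ht
      (.void hp hq)
    refine ⟨z, .inl hz, h₁, ?_⟩
    rw [h₂]
    simp only [letter]
    rw [update_update_self _ (add_vec_ne p d)]
  · obtain ⟨A₁, A₂, hA⟩ := List.append_of_mem hpc
    have edge : (¬ d.IsForward → ∀ r ∈ A₁, d.IsVertical ∧ r.2 ≠ p.2) →
        (d.IsForward → ∀ r ∈ A₂, d.IsVertical ∧ r.2 ≠ p.2) →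
        ∃ z, (z ∈ pairLang d ∨ z ∈ edgeLang d) ∧ z.map Prod.fst = (word D) ∧
          z.map Prod.snd = word (Function.update D p ((D p).markVoid d)) := by
      intro hb hf
      have hcol : ∀ r, r.2 ≠ p.2 → (L.letter t D r).col = false := by
        intro r hr
        rw [ht] at hr
        simp [letter, hr]
      refine ⟨L.keepWord t D A₁ ++ (Sum.inr (L.letter t D p),
        Sum.inr { L.letter t D p with st := (D p).markVoid d }) :: L.keepWord t D A₂,
        .inr (mem_all_one_all.2 ⟨_, _, _, rfl,
          forall_keepWord fun r hr => ⟨rfl, fun h => ⟨(hb h r hr).1, hcol r (hb h r hr).2⟩⟩,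
          ⟨_, _, rfl, hp, fun _ => by simp [letter, ht], rfl⟩,
          forall_keepWord fun r hr => ⟨rfl, fun h => ⟨(hf h r hr).1, hcol r (hf h r hr).2⟩⟩⟩),
        ?_, ?_⟩
      · rw [hA]
        simp [keepWord_fst]
      · rw [map_cells_update hA]
        simp [keepWord_snd]
    rw [mem_cells] at hqc
    cases d with
    | right =>
      simp only [Direction.vec, Prod.fst_add, Prod.snd_add] at hqc
      omega
    | down =>
      refine edge (fun h => absurd trivial h) fun _ r hr => ⟨trivial, fun hrp => hqc ?_⟩
      have h₁ := before_right hA hr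
      have h₂ := L.mem_cells.1 (show r ∈ L.cells by simp [hA, hr])
      simp only [Before, Direction.vec, Prod.fst_add, Prod.snd_add] at h₁ ⊢
      omega
    | up =>
      refine edge (fun _ r hr => ⟨trivial, fun hrp => hqc ?_⟩) fun h => h.elim
      have h₁ := before_left hA hr
      have h₂ := L.mem_cells.1 (show r ∈ L.cells by simp [hA, hr])
      simp only [Before, Direction.vec, Prod.fst_add, Prod.snd_add] at h₁ ⊢
      omega
    | left =>
      rcases List.eq_nil_or_concat A₁ with rfl | ⟨A₁, r, rfl⟩
      · exact edge (by simp) fun h => h.elim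
      · have hA' : L.cells = A₁ ++ r :: ([] ++ p :: A₂) := by simpa using hA
        have hr : r ∉ L.squares := by
          intro hr
          have h := next_right hA' (square_lt hr)
          have h' := L.square_mem r hr
          rw [h] at hqc hp'
          simp only [Direction.vec, Prod.fst_add, Prod.snd_add] at hqc hp'
          omega
        obtain ⟨z, hz, h₁, h₂⟩ := exists_gapWord (t := t) (D := D) (v := False) hA'
          (fun h => h.elim) (fun _ => rfl) (D r) ((D p).markVoid .left)
        refine ⟨z, .inl ⟨(L.letter t D p, L.letter t D r,
          { L.letter t D p with st := (D p).markVoid .left }, L.letter t D r),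
          .void hp hr, fun h => h.elim, fun _ => hz⟩, h₁, ?_⟩
        rw [h₂, Function.update_eq_self]

end Layout

theorem exists_keepBitsWord (l : List (Bool × Bool)) : ∃ z ∈ keepBits,
    z.map Prod.fst = l.map Sum.inl ∧ z.map Prod.snd = l.map Sum.inl := by
  refine ⟨l.map fun b => (.inl b, .inl b), fun y hy => ?_, ?_, ?_⟩
  · obtain ⟨b, -, rfl⟩ := List.mem_map.1 hy
    exact ⟨b, b, rfl, rfl⟩
  · rw [List.map_map]
    rfl
  · rw [List.map_map]
    rfl

theorem exists_decrementWord {cs cs' : List Bool} (h : Decrement cs cs') {bits : List Bool}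
    (hlen : cs.length = bits.length) : ∃ z ∈ decrementBits,
    z.map Prod.fst = (bits.zip cs).map Sum.inl ∧
      z.map Prod.snd = (bits.zip cs').map Sum.inl := by
  induction h generalizing bits with
  | here l =>
    obtain _ | ⟨b, bits⟩ := bits
    · simp at hlen
    obtain ⟨z, hz, h₁, h₂⟩ := exists_keepBitsWord (bits.zip l)
    refine ⟨(.inl (b, true), .inl (b, false)) :: z, mem_all_one_all.2 ⟨[], _, z, rfl, by simp,
      ⟨_, _, rfl, rfl, rfl⟩, hz⟩, ?_, ?_⟩
    · simp [h₁]
    · simp [h₂]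
  | borrow _ ih =>
    obtain _ | ⟨b, bits⟩ := bits
    · simp at hlen
    obtain ⟨z, hz, h₁, h₂⟩ := ih (bits := bits) (by simpa using hlen)
    obtain ⟨α, x, β, rfl, hα, hx, hβ⟩ := mem_all_one_all.1 hz
    refine ⟨(.inl (b, false), .inl (b, true)) :: (α ++ x :: β), mem_all_one_all.2
      ⟨(.inl (b, false), .inl (b, true)) :: α, x, β, rfl, ?_, hx, hβ⟩, ?_, ?_⟩
    · intro y hy
      rcases List.mem_cons.1 hy with rfl | hy
      · exact ⟨_, _, rfl, rfl, rfl⟩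
      · exact hα y hy
    · simpa using h₁
    · simpa using h₂

/-- One step of the rewriting system. -/
def Rewrites (u v : List Letter) : Prop :=
  ∃ z ∈ stepLang, z.map Prod.fst = u ∧ z.map Prod.snd = v

/-- The symbols of a word. -/
def statics (u : List Letter) : List (Bool ⊕ Symbol) := u.map Letter.static

namespace Layout

variable {L : Layout} {t : ℕ} {D : Pos → CellState} {c : Color} {p q : Pos}

/-- A step of the verifier can be performed when the marks are in a suitable column. -/
theorem exists_stepWord {bits cs cs' : List Bool} {D' : Pos → CellState}
    (h : VerifierStep L.squares L.rail c (cs, D) (cs', D')) (hlen : cs.length = bits.length) :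
    ∃ t ≤ L.w, ∃ z ∈ keepBits * actionLang c ⊔ decrementBits * soloLang c .grab,
      z.map Prod.fst = L.block bits cs t D ∧ z.map Prod.snd = L.block bits cs' t D' := by
  have column : ∀ p ∈ L.squares, ∃ t ≤ L.w, p.2 = L.o.2 + t := by
    intro p hp
    have := L.square_mem p hp
    exact ⟨(p.2 - L.o.2).toNat, by omega, by omega⟩
  have keep : ∀ t D', (∃ z ∈ actionLang c,
      z.map Prod.fst = L.cells.map (fun p => (Sum.inr (L.letter t D p) : Letter)) ∧
      z.map Prod.snd = L.cells.map (fun p => (Sum.inr (L.letter t D' p) : Letter))) →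
      ∃ z ∈ keepBits * actionLang c ⊔ decrementBits * soloLang c .grab,
      z.map Prod.fst = L.block bits cs t D ∧ z.map Prod.snd = L.block bits cs t D' := by
    rintro t D' ⟨z, hz, h₁, h₂⟩
    obtain ⟨z', hz', h₁', h₂'⟩ := exists_keepBitsWord (bits.zip cs)
    exact ⟨z' ++ z, .inl ⟨z', hz', z, hz, rfl⟩, by simp [block, h₁, h₁'],
      by simp [block, h₂, h₂']⟩
  cases h with
  | solo a p ha hp hg hpre =>
    obtain ⟨z, hz, h⟩ := exists_soloWord (t := 0) hp hg hpre
    exact ⟨0, Nat.zero_le _, keep _ _ ⟨z, .inl ⟨⟨a, ha⟩, hz⟩, h⟩⟩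
  | grab p hdec hp hg hpre =>
    obtain ⟨z, hz, h₁, h₂⟩ := exists_soloWord (t := 0) hp hg hpre
    obtain ⟨z', hz', h₁', h₂'⟩ := exists_decrementWord hdec hlen
    exact ⟨0, Nat.zero_le _, z' ++ z, .inr ⟨z', hz', z, hz, rfl⟩, by simp [block, h₁, h₁'],
      by simp [block, h₂, h₂']⟩
  | pair a d p hp hq hpre =>
    obtain ⟨t, ht, hpt⟩ := column p hp
    obtain ⟨z, hz, h⟩ := exists_adjacentWord (t := t) (D := D) (L.square_mem_cells hp)
      (L.square_mem_cells hq) hpt (.pair a hp hq hpre)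
    exact ⟨t, ht, keep _ _ ⟨z, .inr (.inl ⟨d, hz⟩), h⟩⟩
  | void d p hp hq =>
    obtain ⟨t, ht, hpt⟩ := column p hp
    obtain ⟨z, hz, h⟩ := exists_voidWord (t := t) (D := D) hp hq hpt
    exact ⟨t, ht, keep _ _ ⟨z, .inr (hz.imp (fun h => ⟨d, h⟩) fun h => ⟨d, h⟩), h⟩⟩

/-- The pairs of letters when only the marks change their place. -/
def markWord (L : Layout) (bits cs : List Bool) (t t' : ℕ) (D : Pos → CellState) :
    List LetterPair :=
  (bits.zip cs).map (fun b => (.inl b, .inl b)) ++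
    L.cells.map fun p => (.inr (L.letter t D p), .inr (L.letter t' D p))

theorem markWord_fst {bits cs : List Bool} {t t' : ℕ} :
    (L.markWord bits cs t t' D).map Prod.fst = L.block bits cs t D := by
  simp [markWord, block, Function.comp_def]

theorem markWord_snd {bits cs : List Bool} {t t' : ℕ} :
    (L.markWord bits cs t t' D).map Prod.snd = L.block bits cs t' D := by
  simp [markWord, block, Function.comp_def]

theorem forall_markWord {bits cs : List Bool} {t t' : ℕ} {P : LetterPair → Prop}
    (h₁ : ∀ b, P (.inl b, .inl b))
    (h₂ : ∀ p ∈ L.cells, P (.inr (L.letter t D p), .inr (L.letter t' D p))) :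
    ∀ z ∈ L.markWord bits cs t t' D, P z := by
  intro z hz
  rcases List.mem_append.1 hz with hz | hz
  · obtain ⟨b, -, rfl⟩ := List.mem_map.1 hz
    exact h₁ b
  · obtain ⟨p, hp, rfl⟩ := List.mem_map.1 hz
    exact h₂ p hp

theorem first_cell {A : List Pos} (h : L.cells = p :: A) : p.2 = L.o.2 := by
  have hp := L.mem_cells.1 (show p ∈ L.cells by simp [h])
  by_contra hne
  have := mem_left (r := (p.1, L.o.2)) (A₁ := []) h (L.mem_cells.2 (by simp only; omega))
    (Or.inr ⟨rfl, by simp only; omega⟩)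
  simp at this

/-- Two consecutive letters are two digits, the last digit and the first cell, neighbours in a row,
or the end of a row and the beginning of the next one. -/
theorem isChain_markWord {bits cs : List Bool} {t t' : ℕ} {Q : LetterPair → LetterPair → Prop}
    (h₁ : ∀ x b, Q x (.inl b, .inl b))
    (h₂ : ∀ b, ∀ p ∈ L.cells, p.2 = L.o.2 →
      Q (.inl b, .inl b) (.inr (L.letter t D p), .inr (L.letter t' D p)))
    (h₃ : ∀ p ∈ L.cells, ∀ q ∈ L.cells, (p.2 < L.o.2 + L.w ∧ q.2 = p.2 + 1) ∨
      (p.2 = L.o.2 + L.w ∧ q.2 = L.o.2) → Q (.inr (L.letter t D p), .inr (L.letter t' D p))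
        (.inr (L.letter t D q), .inr (L.letter t' D q))) :
    (L.markWord bits cs t t' D).IsChain Q := by
  rw [markWord, List.isChain_append]
  refine ⟨?_, ?_, ?_⟩
  · rw [List.isChain_map]
    refine List.isChain_iff_forall_rel_of_append_cons_cons.2 fun a b l₁ l₂ _ => h₁ _ _
  · rw [List.isChain_map]
    refine List.isChain_iff_forall_rel_of_append_cons_cons.2 fun p q l₁ l₂ h => ?_
    refine h₃ p (by simp [h]) q (by simp [h]) ?_
    have hp := L.mem_cells.1 (show p ∈ L.cells by simp [h])
    rcases lt_or_eq_of_le hp.2.2 with hlt | heq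
    · refine Or.inl ⟨hlt, ?_⟩
      rw [next_right h hlt]
      simp [Direction.vec]
    · exact Or.inr ⟨heq, next_endRow h heq⟩
  · intro x hx y hy
    obtain ⟨b, -, rfl⟩ := List.mem_map.1 (List.mem_of_getLast? hx)
    rcases hA : L.cells with _ | ⟨p, A⟩
    · simp [hA] at hy
    · simp only [hA, List.map_cons, List.head?_cons, Option.mem_def, Option.some.injEq] at hy
      subst hy
      exact h₂ b p (by simp [hA]) (first_cell hA)

theorem rewrites_reset (bits cs : List Bool) (t : ℕ) (D : Pos → CellState) :
    Rewrites (L.block bits cs t D) (L.block bits cs 0 D) := by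
  refine ⟨_, .inr (.inl ⟨?_, ?_⟩), markWord_fst, markWord_snd⟩
  · exact forall_markWord (fun b => ⟨rfl, rfl⟩) fun p hp => ⟨rfl, rfl⟩
  · refine isChain_markWord (fun x b h => by simp [Letter.static] at h) (fun b p hp hpo _ => ?_)
      fun p hp q hq h _ => ?_
    · simp [Letter.static, IsRowBreak, Letter.col, letter, hpo]
    · have hp' := L.mem_cells.1 hp
      have := L.endRow_iff p hp'.1.1 hp'.1.2 hp'.2.1 hp'.2.2
      simp only [Letter.static, IsRowBreak, Letter.col, letter, this, Nat.cast_zero, add_zero,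
        decide_eq_true_eq]
      omega

theorem rewrites_shift (bits cs : List Bool) {t : ℕ} (ht : t < L.w) (D : Pos → CellState) :
    Rewrites (L.block bits cs t D) (L.block bits cs (t + 1) D) := by
  refine ⟨_, .inr (.inr ⟨?_, ?_⟩), markWord_fst, markWord_snd⟩
  · refine forall_markWord (fun b => ⟨⟨rfl, rfl⟩, by simp [Letter.col]⟩) fun p hp =>
      ⟨⟨rfl, rfl⟩, fun h => ?_⟩
    have hp' := L.mem_cells.1 hp
    have := L.endRow_iff p hp'.1.1 hp'.1.2 hp'.2.1 hp'.2.2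
    simp only [Letter.static, Letter.col, letter, ne_eq, Sum.inr.injEq, this,
      decide_eq_true_eq] at h ⊢
    omega
  · refine isChain_markWord (fun x b h => by simp [Letter.static] at h) (fun b p hp hpo _ => ?_)
      fun p hp q hq h _ => ?_
    · simp only [Letter.col, letter, hpo, decide_eq_false_iff_not]
      omega
    · have hp' := L.mem_cells.1 hp
      simp only [Letter.col, letter, decide_eq_decide]
      omega

/-- Marks are shifted in one direction only, so a column is reached by a reset to column `0` and at
most `L.w` shifts. -/
theorem within_column (bits cs : List Bool) (t : ℕ) {t' : ℕ} (ht : t' ≤ L.w) (D : Pos → CellState) :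
    Within Rewrites (1 + L.w) (L.block bits cs t D) (L.block bits cs t' D) := by
  have : ∀ j ≤ L.w, Within Rewrites (1 + j) (L.block bits cs t D) (L.block bits cs j D) := by
    intro j
    induction j with
    | zero => exact fun _ => .single (rewrites_reset bits cs t D)
    | succ j ih =>
      exact fun hj => (ih (by omega)).trans (.single (rewrites_shift bits cs (by omega) D))
  exact (this t' ht).mono (by omega)

theorem statics_block {bits cs : List Bool} (hlen : cs.length = bits.length) :
    statics (L.block bits cs t D) = bits.map Sum.inl ++ L.cells.map fun p => .inr (L.sym p) := by
  have : (bits.zip cs).map Prod.fst = bits := List.map_fst_zip (by omega)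
  rw [statics, block, List.map_append, List.map_map, List.map_map]
  conv_rhs => rw [← this, List.map_map]
  rfl

theorem col_block {bits cs : List Bool} (hlen : cs.length = bits.length) :
    (L.block bits cs t D).map Letter.col =
      bits.map (fun _ => false) ++ L.cells.map fun p => decide (p.2 = L.o.2 + t) := by
  have : (bits.zip cs).map Prod.fst = bits := List.map_fst_zip (by omega)
  rw [block, List.map_append, List.map_map, List.map_map]
  conv_rhs => rw [← this, List.map_map]
  rfl

end Layout

theorem mem_turnLang {c : Color} {z : List LetterPair} : z ∈ turnLang c ↔
    (c = .black ↔ ∃ y ∈ statics (z.map Prod.fst), HasAnchor (· = .white) y) := by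
  have key : z ∈ whiteAnchorLang ↔
      ∃ y ∈ statics (z.map Prod.fst), HasAnchor (· = .white) y := by
    constructor
    · intro hz
      obtain ⟨α, x, β, rfl, -, hx, -⟩ := mem_all_one_all.1 hz
      exact ⟨_, by simp [statics], hx⟩
    · rintro ⟨y, hy, h⟩
      simp only [statics, List.map_map, List.mem_map] at hy
      obtain ⟨x, hx, rfl⟩ := hy
      obtain ⟨α, β, rfl⟩ := List.append_of_mem hx
      exact mem_all_one_all.2 ⟨α, x, β, rfl, by simp, h, by simp⟩
  cases c
  · simp only [turnLang, reduceCtorEq, false_iff, ← key]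
    rfl
  · simp only [turnLang, true_iff, ← key]

namespace Layout

variable {L : Layout} {t : ℕ} {D : Pos → CellState} {c : Color}

theorem within_of_verifierStep {bits cs cs' : List Bool} {D' : Pos → CellState}
    (h : VerifierStep L.squares L.rail c (cs, D) (cs', D')) (hlen : cs.length = bits.length)
    (hlen' : cs'.length = bits.length)
    (hc : c = .black ↔ ∃ y ∈ L.cells, HasAnchor (· = .white) (.inr (L.sym y))) (t : ℕ) :
    ∃ t', Within Rewrites (L.w + 2) (L.block bits cs t D) (L.block bits cs' t' D') := by
  obtain ⟨t', ht', z, hz, h₁, h₂⟩ := exists_stepWord h hlen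
  refine ⟨t', ((within_column bits cs t ht' D).trans
    (.single ⟨z, .inl ⟨c, hz, ?_, ?_⟩, h₁, h₂⟩)).mono (by omega)⟩
  · refine mem_turnLang.2 ?_
    rw [h₁, statics_block hlen, hc]
    simp [HasAnchor]
  -- Both words are blocks of the same array with marks in the same column, so they agree in symbols
  -- and marks letter by letter.
  · have hs : z.map (fun y => Letter.static y.2) = z.map fun y => Letter.static y.1 := by
      have := (statics_block (L := L) (t := t') (D := D') hlen').trans
        (statics_block (L := L) (t := t') (D := D) hlen).symm
      rw [← h₁, ← h₂] at this
      simpa [statics, Function.comp_def] using this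
    have hcol : z.map (fun y => Letter.col y.2) = z.map fun y => Letter.col y.1 := by
      have := (col_block (L := L) (t := t') (D := D') hlen').trans
        (col_block (L := L) (t := t') (D := D) hlen).symm
      rw [← h₁, ← h₂] at this
      simpa [Function.comp_def] using this
    exact fun y hy => ⟨List.map_eq_map_iff.1 hs y hy, List.map_eq_map_iff.1 hcol y hy⟩

end Layout

end PushFight

namespace PushFight

open RegularRewriting

/-! ### Numbers in binary -/

theorem bitsValue_encodePosNum (n : PosNum) :
    bitsValue (Computability.encodePosNum n) = (n : ℕ) := by
  induction n with
  | one => simp [Computability.encodePosNum, bitsValue]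
  | bit1 m ih =>
    simp only [Computability.encodePosNum, bitsValue, ih, PosNum.cast_bit1, Bool.toNat_true]
    omega
  | bit0 m ih =>
    simp only [Computability.encodePosNum, bitsValue, ih, PosNum.cast_bit0, Bool.toNat_false]
    omega

theorem exists_encodePosNum (n : PosNum) :
    ∃ l, Computability.encodePosNum n = l ++ [true] := by
  induction n with
  | one => exact ⟨[], rfl⟩
  | bit1 m ih =>
    obtain ⟨l, hl⟩ := ih
    exact ⟨true :: l, by simp [Computability.encodePosNum, hl]⟩
  | bit0 m ih =>
    obtain ⟨l, hl⟩ := ih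
    exact ⟨false :: l, by simp [Computability.encodePosNum, hl]⟩

/-- Together with `exists_encodePosNum` this characterizes the binary forms of positive numbers as
the strings of digits that end in one, which is what `shapeLang` tests. -/
theorem exists_eq_encodePosNum (l : List Bool) :
    ∃ n, Computability.encodePosNum n = l ++ [true] := by
  induction l with
  | nil => exact ⟨.one, rfl⟩
  | cons b l ih =>
    obtain ⟨n, hn⟩ := ih
    cases b
    · exact ⟨.bit0 n, by simp [Computability.encodePosNum, hn]⟩
    · exact ⟨.bit1 n, by simp [Computability.encodePosNum, hn]⟩

theorem encodeNat_posNum (n : PosNum) :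
    Computability.encodeNat (n : ℕ) = Computability.encodePosNum n := by
  rw [Computability.encodeNat, PosNum.of_to_nat]
  rfl

theorem exists_posNum_eq {k : ℕ} (hk : 0 < k) : ∃ n : PosNum, (n : ℕ) = k := by
  have h := Num.to_of_nat k
  cases hn : (k : Num) with
  | zero =>
    rw [hn] at h
    exact absurd h hk.ne
  | pos n => exact ⟨n, by rwa [hn] at h⟩

/-! ### Game states as arrays -/

namespace Layout

theorem flatMap_range_map_range {α : Type} (h m : ℕ) (f : ℕ → ℕ → α) :
    (List.range h).flatMap (fun i => (List.range m).map fun j => f i j) =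
      (List.range (h * m)).map fun n => f (n / m) (n % m) := by
  induction h with
  | zero => simp
  | succ h ih =>
    rw [List.range_succ, List.flatMap_append, ih, Nat.succ_mul, List.range_add, List.map_append]
    congr 1
    simp only [List.flatMap_cons, List.flatMap_nil, List.append_nil, List.map_map]
    refine List.map_congr_left fun j hj => ?_
    have hj : j < m := List.mem_range.1 hj
    have h₁ : (h * m + j) / m = h := by
      rw [Nat.mul_comm, Nat.mul_add_div (by omega), Nat.div_eq_of_lt hj, add_zero]
    have h₂ : (h * m + j) % m = j := by
      rw [Nat.mul_comm, Nat.mul_add_mod, Nat.mod_eq_of_lt hj]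
    simp [h₁, h₂]

variable (L : Layout)

theorem cells_eq : L.cells = (List.range (L.h * (L.w + 1))).map fun n =>
    (L.o.1 + ((n / (L.w + 1) : ℕ) : ℤ), L.o.2 + ((n % (L.w + 1) : ℕ) : ℤ)) :=
  flatMap_range_map_range L.h (L.w + 1) fun i j => (L.o.1 + (i : ℤ), L.o.2 + (j : ℤ))

/-- The array shows a game state. -/
structure Describes (s : GameState) : Prop where
  squares : L.squares = s.board.squares
  rail : L.rail = fun p d => decide ((p, d) ∈ s.board.rails)
  occupant : ∀ p, (L.sym p).occupant = s.piece p

variable {L}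

theorem Describes.sym_eq {s : GameState} (h : L.Describes s) {p : Pos} (hp : p ∈ L.cells) :
    L.sym p = if p.2 = L.o.2 + L.w then .endRow else s.symbolAt p := by
  have hp' := L.mem_cells.1 hp
  have hend := L.endRow_iff p hp'.1.1 hp'.1.2 hp'.2.1 hp'.2.2
  split_ifs with hpw
  · exact hend.2 hpw
  have hmem : p ∈ s.board.squares ↔ (L.sym p).IsSquare := by
    rw [← Finset.mem_coe, ← h.squares]
    rfl
  have hr := congrFun h.rail p
  have ho := h.occupant p
  unfold Layout.rail at hr
  unfold GameState.symbolAt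
  cases hsym : L.sym p with
  | bit b => exact absurd hsym (L.ne_bit p b)
  | endRow => exact absurd (hend.1 hsym) hpw
  | offBoard => rw [if_neg (by rw [hmem, hsym]; exact id)]
  | square r a =>
    rw [if_pos (by rw [hmem, hsym]; trivial), ← ho, ← hr, hsym]
    rfl

theorem Describes.describe_eq {s : GameState} (h : L.Describes s) (k : ℕ) :
    s.describe k L.o L.h L.w =
      (Computability.encodeNat k).map Symbol.bit ++ L.cells.map L.sym := by
  have hsym : L.cells.map L.sym = L.cells.map fun p =>
      if p.2 = L.o.2 + L.w then .endRow else s.symbolAt p :=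
    List.map_congr_left fun p hp => h.sym_eq hp
  rw [hsym, GameState.describe, cells, List.map_flatMap]
  simp only [List.bind_eq_flatMap, List.flatMap_assoc, List.pure_def, List.flatMap_cons,
    List.flatMap_nil, List.append_nil]
  congr 2
  funext i
  rw [List.range_succ, List.map_append, List.map_append, List.map_map]
  congr 1
  · rw [← List.map_eq_flatMap, List.map_map]
    refine List.map_congr_left fun j hj => ?_
    have := List.mem_range.1 hj
    simp [this.ne]
  · simp

theorem Describes.turn_eq {s : GameState} (h : L.Describes s) :
    s.turn = .black ↔ ∃ y ∈ L.cells, HasAnchor (· = .white) (.inr (L.sym y)) := by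
  have : s.turn = .black ↔
      ∃ p ∈ s.board.squares, s.piece p = some ⟨Color.white, Kind.anchoredKing⟩ := by
    unfold GameState.turn
    split_ifs with h <;> simp [h]
  rw [this]
  simp only [HasAnchor, h.occupant]
  constructor
  · rintro ⟨p, hp, hpa⟩
    rw [← Finset.mem_coe, ← h.squares] at hp
    exact ⟨p, L.square_mem_cells hp, _, hpa, rfl, rfl⟩
  · rintro ⟨p, -, ⟨c, k⟩, hpa, rfl, rfl⟩
    exact ⟨p, s.piece_mem p (by simp [hpa]), hpa⟩

/-- The array shows no marks and the initial placement. -/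
theorem map_toLetter (bits : List Bool) :
    (bits.map Symbol.bit ++ L.cells.map L.sym).map Symbol.toLetter =
      L.block bits bits (L.w + 1) fun p => .initial (L.sym p).occupant := by
  rw [List.map_append, block]
  congr 1
  · induction bits with
    | nil => rfl
    | cons b bits ih => simpa using ⟨rfl, by simpa using ih⟩
  · rw [List.map_map]
    refine List.map_congr_left fun p hp => ?_
    -- Column `L.w + 1` lies beyond the end marks, so no letter is marked.
    have hcol : (decide (p.2 = L.o.2 + (L.w + 1 : ℕ))) = false := by
      have := L.mem_cells.1 hp
      simp only [decide_eq_false_iff_not]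
      omega
    have hbit := L.ne_bit p
    simp only [Function.comp_apply, letter, hcol]
    cases hsym : L.sym p with
    | bit b => exact absurd hsym (hbit b)
    | _ => rfl

end Layout

/-- The array of cells in a rectangle that contains the board. -/
def GameState.layout (s : GameState) (o : Pos) (h w : ℕ) (hfit : s.FitsIn o h w) : Layout where
  o := o
  h := h
  w := w
  sym p := if p.2 = o.2 + w then .endRow else s.symbolAt p
  square_mem p hp := by
    split_ifs at hp with hw
    · exact hp.elim
    · by_cases hps : p ∈ s.board.squares
      · obtain ⟨i, hi, j, hj, rfl⟩ := hfit p hps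
        simp only
        omega
      · rw [symbolAt, if_neg hps] at hp
        exact hp.elim
  endRow_iff p _ _ _ _ := by
    simp only [symbolAt]
    split_ifs <;> simp_all
  ne_bit p b := by
    simp only [symbolAt]
    split_ifs <;> simp

theorem GameState.describes_layout (s : GameState) {o : Pos} {h w : ℕ} (hfit : s.FitsIn o h w) :
    (s.layout o h w hfit).Describes s := by
  have hne : ∀ p ∈ s.board.squares, p.2 ≠ o.2 + w := by
    intro p hp
    obtain ⟨i, hi, j, hj, rfl⟩ := hfit p hp
    simp only
    omega
  refine ⟨Set.ext fun p => ?_, ?_, fun p => ?_⟩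
  · simp only [Layout.squares, layout, Set.mem_ofPred_eq, Finset.mem_coe]
    by_cases hp : p ∈ s.board.squares
    · simp [hp, hne p hp, symbolAt, Symbol.IsSquare]
    · split_ifs <;> simp [hp, symbolAt, Symbol.IsSquare]
  · funext p d
    simp only [Layout.rail, layout]
    by_cases hp : p ∈ s.board.squares
    · simp [hp, hne p hp, symbolAt, Symbol.rail]
    · have hd : (p, d) ∉ s.board.rails := fun hd => hp (s.board.rails_boundary _ hd).1
      split_ifs <;> simp [hp, hd, symbolAt, Symbol.rail]
  · simp only [layout]
    by_cases hp : p ∈ s.board.squares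
    · simp [hp, hne p hp, symbolAt, Symbol.occupant]
    · have : s.piece p = none := by
        by_contra h
        exact hp (s.piece_mem p h)
      split_ifs <;> simp [hp, this, symbolAt, Symbol.occupant]

/-! ### Words in the final language -/

theorem not_pairwise_iff {α : Type} {R : α → α → Prop} {l : List α} :
    ¬ l.Pairwise R ↔ ∃ a x b y c, l = a ++ x :: (b ++ y :: c) ∧ ¬ R x y := by
  constructor
  · intro h
    induction l with
    | nil => simp at h
    | cons x l ih =>
      by_cases hl : l.Pairwise R
      · rw [List.pairwise_cons] at h
        obtain ⟨y, hy, hxy⟩ : ∃ y ∈ l, ¬ R x y := by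
          by_contra! hcon
          exact h ⟨hcon, hl⟩
        obtain ⟨b, c, rfl⟩ := List.append_of_mem hy
        exact ⟨[], x, b, y, c, rfl, hxy⟩
      · obtain ⟨a, y, b, z, c, rfl, hyz⟩ := ih hl
        exact ⟨x :: a, y, b, z, c, rfl, hyz⟩
  · rintro ⟨a, x, b, y, c, rfl, h⟩ hl
    rw [List.pairwise_append, List.pairwise_cons] at hl
    exact h (hl.2.1.1 y (by simp))

theorem mem_twoAnchorsLang {z : List LetterPair} : z ∈ twoAnchorsLang ↔
    ¬ (statics (z.map Prod.fst)).Pairwise fun x y =>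
      ¬ (HasAnchor (fun _ => True) x ∧ HasAnchor (fun _ => True) y) := by
  rw [statics, List.pairwise_map, List.pairwise_map, not_pairwise_iff]
  constructor
  · intro hz
    obtain ⟨a, x, b, y, c, rfl, -, hx, -, hy, -⟩ := mem_all_one_all_one_all.1 hz
    exact ⟨a, x, b, y, c, rfl, not_not.2 ⟨hx, hy⟩⟩
  · rintro ⟨a, x, b, y, c, rfl, h⟩
    obtain ⟨hx, hy⟩ := not_not.1 h
    exact mem_all_one_all_one_all.2 ⟨a, x, b, y, c, rfl, by simp, hx, by simp, hy, by simp⟩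

namespace Layout

variable {L : Layout} {D : Pos → CellState}

theorem pairwise_statics_block_iff {bits cs : List Bool} {t : ℕ} (hlen : cs.length = bits.length) :
    ((statics (L.block bits cs t D)).Pairwise fun x y =>
      ¬ (HasAnchor (fun _ => True) x ∧ HasAnchor (fun _ => True) y)) ↔
    L.cells.Pairwise fun p q => ¬ (HasAnchor (fun _ => True) (.inr (L.sym p)) ∧
      HasAnchor (fun _ => True) (.inr (L.sym q))) := by
  rw [statics_block hlen, List.pairwise_append, List.pairwise_map, List.pairwise_map]
  constructor
  · exact fun h => h.2.1
  · refine fun h => ⟨?_, h, ?_⟩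
    · exact List.pairwise_of_forall fun _ _ h => h.1
    · rintro x hx y hy ⟨h, -⟩
      obtain ⟨b, -, rfl⟩ := List.mem_map.1 hx
      exact h

theorem last_cell {A : List Pos} {p : Pos} (h : L.cells = A ++ [p]) : p.2 = L.o.2 + L.w := by
  have hp := L.mem_cells.1 (show p ∈ L.cells by simp [h])
  by_contra hne
  have := mem_right (r := (p.1, L.o.2 + L.w)) (A₂ := []) h (L.mem_cells.2 (by simp only; omega))
    (Or.inr ⟨rfl, by simp only; omega⟩)
  simp at this

/-- The final language inspects first components only, so a word may be paired with itself. Its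
marks have been brought to column `L.w`, that of the row ends. -/
theorem mem_finalLang {s : GameState} (hL : L.Describes s) {bits cs : List Bool}
    (hlen : cs.length = (bits ++ [true]).length) (h : Verified L.squares L.rail D) :
    (L.block (bits ++ [true]) cs L.w D).map (fun a => (a, a)) ∈ finalLang := by
  obtain ⟨p, hp, hpw⟩ := h.won
  have hpc := L.square_mem_cells hp
  have hfst : ((L.block (bits ++ [true]) cs L.w D).map (fun a => (a, a))).map Prod.fst =
      L.block (bits ++ [true]) cs L.w D := by
    simp [Function.comp_def]
  have hchecked : ∀ q ∈ L.cells, (L.letter L.w D q).Checked := by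
    intro q hq
    have hq' := L.mem_cells.1 hq
    refine ⟨?_, fun hqs => ⟨h.visited q hqs, h.void q hqs⟩⟩
    rw [letter, L.endRow_iff q hq'.1.1 hq'.1.2 hq'.2.1 hq'.2.2, decide_eq_true_eq]
  refine ⟨?_, ?_, ?_⟩
  · rcases List.eq_nil_or_concat L.cells with hA | ⟨A, e, hA⟩
    · simp [hA] at hpc
    have he := L.mem_cells.1 (show e ∈ L.cells by simp [hA])
    rcases List.eq_nil_or_concat cs with rfl | ⟨cs, b, rfl⟩
    · simp at hlen
    have hlen' : bits.length = cs.length := by simpa using hlen.symm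
    refine ⟨_, mem_all_one_all.2 ⟨(bits.zip cs).map fun b => (.inl b, .inl b), (.inl (true, b),
      .inl (true, b)), A.map fun p => (.inr (L.letter L.w D p), .inr (L.letter L.w D p)), rfl,
      ?_, rfl, ?_⟩, [(.inr (L.letter L.w D e), .inr (L.letter L.w D e))], ⟨_, rfl, _, rfl,
      hchecked e (by simp [hA]), (L.endRow_iff e he.1.1 he.1.2 he.2.1 he.2.2).2 (last_cell
        (by simpa using hA))⟩, ?_⟩
    · intro z hz
      obtain ⟨b, -, rfl⟩ := List.mem_map.1 hz
      rfl
    · intro z hz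
      obtain ⟨q, hq, rfl⟩ := List.mem_map.1 hz
      exact ⟨_, rfl, hchecked q (by simp [hA, hq])⟩
    · simp [block, hA, List.zip_append hlen', Function.comp_def]
  · have hmem : (Sum.inr (L.letter L.w D p) : Letter) ∈ L.block (bits ++ [true]) cs L.w D :=
      List.mem_append_right _ (List.mem_map_of_mem (f := fun p => Sum.inr (L.letter L.w D p)) hpc)
    obtain ⟨α, β, hαβ⟩ := List.append_of_mem hmem
    rw [hαβ, List.map_append, List.map_cons]
    exact mem_all_one_all.2 ⟨_, _, _, rfl, by simp, ⟨_, rfl, hp, hpw⟩, by simp⟩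
  · intro hz
    refine mem_twoAnchorsLang.1 hz ?_
    rw [hfst, pairwise_statics_block_iff hlen]
    refine L.pairwise_cells.imp ?_
    rintro p q hpq ⟨⟨a, ha, hak, -⟩, b, hb, hbk, -⟩
    rw [hL.occupant] at ha hb
    obtain rfl := s.anchor_unique p q a b ha hb hak hbk
    exact Before.irrefl hpq

/-- A step of the verifier costs at most `L.w + 1` rewriting steps that bring the marks into a
suitable column, and one that performs it. -/
theorem within_block {s : GameState} (hL : L.Describes s) {n : ℕ} {bits : List Bool}
    {x y : List Bool × (Pos → CellState)}
    (h : Within (VerifierStep L.squares L.rail s.turn) n x y) (hlen : x.1.length = bits.length)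
    (t : ℕ) : ∃ t', y.1.length = bits.length ∧
      Within Rewrites (n * (L.w + 2)) (L.block bits x.1 t x.2) (L.block bits y.1 t' y.2) := by
  induction h generalizing t with
  | refl n x => exact ⟨t, hlen, .refl _ _⟩
  | @head n x y z hxy _ ih =>
    have hlen' : y.1.length = bits.length := by
      rw [← hlen]
      cases hxy with
      | grab p hdec => exact hdec.length.symm
      | _ => rfl
    obtain ⟨t', h'⟩ := within_of_verifierStep hxy hlen hlen' hL.turn_eq t
    obtain ⟨t'', hlen'', h''⟩ := ih hlen' t'
    exact ⟨t'', hlen'', (h'.trans h'').mono (by rw [Nat.succ_mul]; omega)⟩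

end Layout

theorem accepts_of_within {n : ℕ} {u v : List Letter} (h : Within Rewrites n u v)
    (hv : v.map (fun a => (a, a)) ∈ finalLang) :
    ∃ m ≤ n, Accepts stepLang finalLang m u := by
  induction h with
  | refl n u =>
    have := Accepts.final (R := stepLang) _ hv
    rw [List.map_map] at this
    exact ⟨0, Nat.zero_le _, by simpa [Function.comp_def] using this⟩
  | head huv _ ih =>
    obtain ⟨m, hm, h⟩ := ih hv
    obtain ⟨z, hz, rfl, rfl⟩ := huv
    exact ⟨m + 1, by omega, .step z hz h⟩

/-- A bound on the number of rewriting steps for an input of a given length. -/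
noncomputable def stepBound : Polynomial ℕ :=
  let X : Polynomial ℕ := .X
  (1 + X * X + X * 4 * 1 + X * (X + 1) ^ 4 * (X * X + 1) * (X + 2) + (1 + X + 1)) * (X + 1) + X

theorem eval_stepBound (n : ℕ) : stepBound.eval n = verifierBound n * (n + 1) + n := by
  simp [stepBound, verifierBound, tokenBound]

theorem verifierBound_mono : Monotone verifierBound := by
  intro m n h
  unfold verifierBound tokenBound
  gcongr

/-- All parameters are bounded by the length of the input. It contains `h * (w + 1)` cells and end
marks, which bounds the number of squares, and also the width, as `h` is positive. -/
theorem exists_accepts {x : List Symbol} (hx : x ∈ kMoveMateInOne) :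
    ∃ n ≤ stepBound.eval x.length, Accepts stepLang finalLang n (x.map Symbol.toLetter) := by
  obtain ⟨s, k, o, h, w, hk, hfit, rfl, hmate⟩ := hx
  obtain ⟨n, rfl⟩ := exists_posNum_eq hk
  obtain ⟨bits, hbits⟩ := exists_encodePosNum n
  have hL := s.describes_layout hfit
  set L := s.layout o h w hfit with hLdef
  have hx : s.describe n o h w = (bits ++ [true]).map Symbol.bit ++ L.cells.map L.sym := by
    rw [← hbits, ← encodeNat_posNum]
    exact hL.describe_eq n
  have hvalue : bitsValue (bits ++ [true]) = n := by rw [← hbits, bitsValue_encodePosNum]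
  obtain ⟨cs, D, hwithin, hver⟩ := s.exists_verified hmate hvalue
    (D := fun p => .initial (L.sym p).occupant) fun p => by rw [hL.occupant]
  rw [← hL.squares, ← hL.rail] at hwithin hver
  obtain ⟨t, hlen, h₁⟩ := Layout.within_block hL hwithin rfl (L.w + 1)
  obtain ⟨m, hm, hacc⟩ := accepts_of_within
    (h₁.trans (Layout.within_column (bits ++ [true]) cs t le_rfl D))
    (Layout.mem_finalLang hL hlen hver)
  have hcells : L.cells.length = h * (w + 1) := by
    rw [L.cells_eq, List.length_map, List.length_range]
    rfl
  have hlength : (s.describe n o h w).length = bits.length + 1 + h * (w + 1) := by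
    rw [hx, List.length_append, List.length_map, List.length_map, hcells, List.length_append]
    rfl
  have hcard : s.board.squares.card ≤ h * (w + 1) := by
    rw [← hcells]
    refine (Finset.card_le_card fun p hp => ?_).trans L.cells.toFinset_card_le
    rw [← Finset.mem_coe, ← hL.squares] at hp
    exact List.mem_toFinset.2 (L.square_mem_cells hp)
  have hpos : 0 < h := by
    obtain ⟨p, hp⟩ := s.board.nonempty
    obtain ⟨i, hi, -⟩ := hfit p hp
    omega
  have hw : w + 1 ≤ h * (w + 1) := Nat.le_mul_of_pos_left _ hpos
  refine ⟨m, hm.trans ?_, ?_⟩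
  -- The factors account for the steps of the verifier and for the cost of each of them, the summand
  -- for the final motion of the marks to the row ends.
  · rw [eval_stepBound]
    refine Nat.add_le_add (Nat.mul_le_mul (verifierBound_mono (by omega)) ?_) ?_
    · show w + 2 ≤ _
      omega
    · show 1 + w ≤ _
      omega
  · rw [hx, Layout.map_toLetter]
    exact hacc

end PushFight

namespace PushFight

open RegularRewriting

/-! ### From accepted words to game states -/

theorem reflTransGen_of_accepts {n : ℕ} {u : List Letter} (h : Accepts stepLang finalLang n u) :
    ∃ z ∈ finalLang, Relation.ReflTransGen Rewrites u (z.map Prod.fst) := by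
  induction h with
  | final z hz => exact ⟨z, hz, .refl⟩
  | step z hz _ ih =>
    obtain ⟨z', hz', h⟩ := ih
    exact ⟨z', hz', .head ⟨z, hz, rfl, rfl⟩ h⟩

theorem statics_eq_of_forall {z : List LetterPair}
    (h : ∀ y ∈ z, Letter.static y.2 = Letter.static y.1) :
    statics (z.map Prod.snd) = statics (z.map Prod.fst) := by
  rw [statics, statics, List.map_map, List.map_map]
  exact List.map_congr_left h

theorem Rewrites.statics_eq {u v : List Letter} (h : Rewrites u v) : statics v = statics u := by
  obtain ⟨z, ⟨c, -, -, hz⟩ | hz | hz, rfl, rfl⟩ := h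
  · exact statics_eq_of_forall fun y hy => (hz y hy).1
  · exact statics_eq_of_forall fun y hy => (hz.1 y hy).1
  · exact statics_eq_of_forall fun y hy => (hz.1 y hy).1.1

theorem statics_eq_of_reflTransGen {u v : List Letter} (h : Relation.ReflTransGen Rewrites u v) :
    statics v = statics u := by
  induction h with
  | refl => rfl
  | tail _ h ih => exact h.statics_eq.trans ih

/-- The columns of the symbols in a word that describes an array, where the first symbol is in the
column `o`. -/
def columns : ℕ → List Symbol → List ℕ
  | _, [] => []
  | o, s :: l => o :: columns (if s = .endRow then 0 else o + 1) l

theorem length_columns (o : ℕ) (l : List Symbol) : (columns o l).length = l.length := by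
  induction l generalizing o with
  | nil => rfl
  | cons s l ih => simp [columns, ih]

theorem lt_of_mem_columns {o n : ℕ} {l : List Symbol} (h : n ∈ columns o l) :
    n < o + l.length := by
  induction l generalizing o with
  | nil => simp [columns] at h
  | cons s l ih =>
    rcases List.mem_cons.1 h with rfl | h
    · simp
    · have := ih h
      simp only [List.length_cons]
      split_ifs at this <;> omega

/-- Nothing is known yet about the lengths of the rows, so columns are counted from the row ends by
`columns`. The letter `x` precedes the cells `z` and decides whether the first of them is marked. -/
theorem reset_columns {z : List LetterPair} {x : LetterPair} {o : ℕ} {l : List Symbol}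
    (hz : (x :: z).IsChain fun a b =>
      (Letter.static b.1).isRight → (Letter.col b.2 = true ↔ IsRowBreak (Letter.static a.1)))
    (hl : z.map (fun y => Letter.static y.1) = l.map Sum.inr)
    (hx : IsRowBreak (Letter.static x.1) ↔ o = 0) :
    z.map (fun y => Letter.col y.2) = (columns o l).map fun n => decide (n = 0) := by
  induction z generalizing x o l with
  | nil =>
    obtain rfl : l = [] := by simpa using hl.symm
    rfl
  | cons y z ih =>
    obtain _ | ⟨s, l⟩ := l
    · simp at hl
    simp only [List.map_cons, List.cons.injEq] at hl
    rw [List.isChain_cons_cons] at hz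
    simp only [columns, List.map_cons, List.cons.injEq]
    refine ⟨?_, ih hz.2 hl.2 ?_⟩
    · rw [Bool.eq_iff_iff, hz.1 (by simp [hl.1]), hx, decide_eq_true_eq]
    · rw [hl.1]
      by_cases hs : s = .endRow <;> simp [IsRowBreak, hs]

/-- A mark on the end of a row would move on to the next row. This is what `hend` forbids, so the
marks remain in one column, and a marked row end blocks the shift. -/
theorem shift_columns {z : List LetterPair} {x : LetterPair} {o t : ℕ} {l : List Symbol}
    (hz : (x :: z).IsChain fun a b =>
      (Letter.static b.1).isRight → Letter.col b.2 = Letter.col a.1)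
    (hend : ∀ y ∈ z, Letter.col y.1 = true → Letter.static y.1 ≠ .inr .endRow)
    (hl : z.map (fun y => Letter.static y.1) = l.map Sum.inr)
    (hc : z.map (fun y => Letter.col y.1) = (columns o l).map fun n => decide (n = t))
    (hx : Letter.col x.1 = true ↔ o = t + 1) :
    z.map (fun y => Letter.col y.2) = (columns o l).map fun n => decide (n = t + 1) := by
  induction z generalizing x o l with
  | nil =>
    obtain rfl : l = [] := by simpa using hl.symm
    rfl
  | cons y z ih =>
    obtain _ | ⟨s, l⟩ := l
    · simp at hl
    simp only [columns, List.map_cons, List.cons.injEq] at hl hc ⊢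
    rw [List.isChain_cons_cons] at hz
    refine ⟨?_, ih hz.2 (fun y hy => hend y (by simp [hy])) hl.2 hc.2 ?_⟩
    · rw [Bool.eq_iff_iff, hz.1 (by simp [hl.1]), hx, decide_eq_true_eq]
    · have := hend y (by simp)
      rw [hl.1, hc.1, decide_eq_true_eq] at this
      rw [hc.1, decide_eq_true_eq]
      by_cases hs : s = .endRow
      · simpa [hs] using this
      · simp [hs]

/-- The marks in a word are those of a column. -/
def HasColumn (bits : List Bool) (l : List Symbol) (u : List Letter) : Prop :=
  ∃ t : ℕ, u.map Letter.col =
    bits.map (fun _ => false) ++ (columns 0 l).map fun n => decide (n = t)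

theorem eq_inl_of_static {x : Letter} {b : Bool} (h : Letter.static x = .inl b) :
    ∃ b', x = .inl (b, b') := by
  rcases x with ⟨a, b'⟩ | x
  · simp only [Letter.static, Sum.inl.injEq] at h
    exact ⟨b', by rw [h]⟩
  · simp [Letter.static] at h

theorem col_of_static {x : Letter} {b : Bool} (h : Letter.static x = .inl b) :
    Letter.col x = false := by
  obtain ⟨b', rfl⟩ := eq_inl_of_static h
  rfl

/-- A word that describes an array begins with digits. -/
theorem split_statics {bits : List Bool} {l : List Symbol} {z : List LetterPair}
    (h : statics (z.map Prod.fst) = (bits ++ [true]).map Sum.inl ++ l.map Sum.inr) :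
    ∃ α x β, z = α ++ x :: β ∧ α.map (fun y => Letter.static y.1) = bits.map Sum.inl ∧
      Letter.static x.1 = .inl true ∧ β.map (fun y => Letter.static y.1) = l.map Sum.inr := by
  rw [statics, List.map_map, List.map_append, List.append_assoc] at h
  obtain ⟨α, γ, rfl, hα, hγ⟩ := List.map_eq_append_iff.1 h
  obtain ⟨x, β, rfl, hx, hβ⟩ := List.map_eq_cons_iff.1 hγ
  exact ⟨α, x, β, rfl, hα, hx, hβ⟩

theorem map_col_of_statics {α : List LetterPair} {bits : List Bool} (f : LetterPair → Letter)
    (h : ∀ y ∈ α, Letter.static (f y) = Letter.static y.1)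
    (hα : α.map (fun y => Letter.static y.1) = bits.map Sum.inl) :
    α.map (fun y => Letter.col (f y)) = bits.map fun _ => false := by
  induction α generalizing bits with
  | nil =>
    obtain rfl : bits = [] := by simpa using hα.symm
    rfl
  | cons y α ih =>
    obtain _ | ⟨b, bits⟩ := bits
    · simp at hα
    simp only [List.map_cons, List.cons.injEq] at hα ⊢
    exact ⟨col_of_static ((h y (by simp)).trans hα.1), ih (fun y hy => h y (by simp [hy])) hα.2⟩

/-- Whatever the lengths of the rows are, actions keep the marked column, a reset makes it `0`, and
a shift turns `t` into `t + 1`. -/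
theorem Rewrites.hasColumn {bits : List Bool} {l : List Symbol} {u v : List Letter}
    (h : Rewrites u v) (hu : statics u = (bits ++ [true]).map Sum.inl ++ l.map Sum.inr)
    (hc : HasColumn (bits ++ [true]) l u) : HasColumn (bits ++ [true]) l v := by
  obtain ⟨t, ht⟩ := hc
  obtain ⟨z, ⟨c, -, -, hz⟩ | hz | hz, rfl, rfl⟩ := h
  · refine ⟨t, ht ▸ ?_⟩
    rw [List.map_map, List.map_map]
    exact List.map_congr_left fun y hy => (hz y hy).2
  · obtain ⟨hz₁, hz₂⟩ := hz
    obtain ⟨α, x, β, rfl, hα, hx, hβ⟩ := split_statics hu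
    have hx' : Letter.static x.2 = .inl true := ((hz₁ x (by simp)).1).trans hx
    refine ⟨0, ?_⟩
    have h₁ := map_col_of_statics Prod.snd (fun y hy => (hz₁ y (by simp [hy])).1) hα
    have h₂ := reset_columns (o := 0) (hz₂.right_of_append) hβ (by simp [hx, IsRowBreak])
    simp only [List.map_append, List.map_map, List.map_cons, Function.comp_def, h₁, h₂,
      col_of_static hx', List.append_assoc]
    rfl
  · obtain ⟨hz₁, hz₂⟩ := hz
    obtain ⟨α, x, β, rfl, hα, hx, hβ⟩ := split_statics hu
    have hx' : Letter.static x.2 = .inl true := ((hz₁ x (by simp)).1.1).trans hx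
    refine ⟨t + 1, ?_⟩
    have h₁ := map_col_of_statics Prod.snd (fun y hy => (hz₁ y (by simp [hy])).1.1) hα
    have h₁' := map_col_of_statics Prod.fst (fun y hy => rfl) hα
    have hβt : β.map (fun y => Letter.col y.1) =
        (columns 0 l).map fun n => decide (n = t) := by
      simp only [List.map_append, List.map_map, List.map_cons, Function.comp_def, h₁',
        col_of_static hx, List.append_assoc] at ht
      simpa using List.append_cancel_left ht
    have h₂ := shift_columns (o := 0) (hz₂.right_of_append)
      (fun y hy => (hz₁ y (by simp [hy])).2) hβ hβt (by simp [col_of_static hx])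
    simp only [List.map_append, List.map_map, List.map_cons, Function.comp_def, h₁, h₂,
      col_of_static hx', List.append_assoc]
    rfl

/-- When exactly the letters in column `w` end rows, the column starts again from `0` after every `w
+ 1` letters. -/
theorem columns_eq {o w : ℕ} (ho : o ≤ w) {l : List Symbol}
    (h : ∀ y ∈ (columns o l).zip l, (y.1 = w ↔ y.2 = .endRow)) :
    columns o l = (List.range l.length).map fun n => (o + n) % (w + 1) := by
  induction l generalizing o with
  | nil => rfl
  | cons s l ih =>
    have hs : o = w ↔ s = .endRow := h (o, s) (by simp [columns])
    have hw : (if s = .endRow then 0 else o + 1) = (o + 1) % (w + 1) := by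
      by_cases how : o = w
      · rw [if_pos (hs.1 how), how, Nat.mod_self]
      · rw [if_neg (mt hs.2 how), Nat.mod_eq_of_lt (by omega)]
    rw [columns, ih (by rw [hw]; exact Nat.lt_succ_iff.1 (Nat.mod_lt _ (by omega)))
      fun y hy => h y (by simp [columns, hy]), List.length_cons, List.range_succ_eq_map,
      List.map_cons, List.map_map, add_zero, Nat.mod_eq_of_lt (by omega), hw]
    refine congrArg _ (List.map_congr_left fun n _ => ?_)
    simp only [Function.comp_apply, Nat.succ_eq_add_one, Nat.mod_add_mod]
    congr 1
    omega

/-- An array of cells from a list of symbols. -/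
theorem exists_layout {w : ℕ} {l : List Symbol} (hbit : ∀ b, .bit b ∉ l)
    (h : ∀ y ∈ (columns 0 l).zip l, (y.1 = w ↔ y.2 = .endRow)) {l' : List Symbol}
    (hl : l = l' ++ [.endRow]) :
    ∃ L : Layout, L.w = w ∧ L.o = 0 ∧ L.cells.map L.sym = l := by
  have hcol := columns_eq (Nat.zero_le w) h
  simp only [zero_add] at hcol
  have hget : ∀ n (hn : n < l.length), (n % (w + 1) = w ↔ l[n] = .endRow) := by
    intro n hn
    refine h (n % (w + 1), l[n]) ?_
    rw [List.mem_iff_getElem]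
    refine ⟨n, by simpa [length_columns] using hn, ?_⟩
    simp [hcol]
  -- The last symbol is a row end and hence in column `w`, so the list consists of complete rows.
  obtain ⟨m, hm⟩ : ∃ m, l.length = m * (w + 1) := by
    have h₁ := (hget (l.length - 1) (by simp [hl])).2 (by simp [hl])
    have h₂ : 0 < l.length := by simp [hl]
    refine ⟨(l.length - 1) / (w + 1) + 1, ?_⟩
    have := Nat.div_add_mod' (l.length - 1) (w + 1)
    rw [Nat.succ_mul]
    omega
  have hidx : ∀ i j : ℕ, i < m → j ≤ w → i * (w + 1) + j < l.length ∧
      (i * (w + 1) + j) % (w + 1) = j := by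
    intro i j hi hj
    refine ⟨?_, ?_⟩
    · rw [hm]
      calc i * (w + 1) + j < i * (w + 1) + (w + 1) := by omega
        _ = (i + 1) * (w + 1) := (Nat.succ_mul _ _).symm
        _ ≤ m * (w + 1) := Nat.mul_le_mul_right _ hi
    · rw [Nat.mul_comm, Nat.mul_add_mod, Nat.mod_eq_of_lt (by omega)]
  let sym : Pos → Symbol := fun p =>
    if 0 ≤ p.1 ∧ p.1 < m ∧ 0 ≤ p.2 ∧ p.2 ≤ w then
      l.getD (p.1.toNat * (w + 1) + p.2.toNat) .offBoard else .offBoard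
  have hsym : ∀ p : Pos, 0 ≤ p.1 → p.1 < m → 0 ≤ p.2 → p.2 ≤ w →
      (sym p = .endRow ↔ p.2 = w) := by
    intro p h₁ h₂ h₃ h₄
    obtain ⟨hlt, hmod⟩ := hidx p.1.toNat p.2.toNat (by omega) (by omega)
    have := hget _ hlt
    have hin : 0 ≤ p.1 ∧ p.1 < m ∧ 0 ≤ p.2 ∧ p.2 ≤ w := ⟨h₁, h₂, h₃, h₄⟩
    simp only [sym, if_pos hin]
    rw [List.getD_eq_getElem _ _ hlt, ← this, hmod]
    omega
  refine ⟨⟨0, m, w, sym, ?_, ?_, ?_⟩, rfl, rfl, ?_⟩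
  · intro p hp
    by_cases hin : 0 ≤ p.1 ∧ p.1 < m ∧ 0 ≤ p.2 ∧ p.2 ≤ w
    · have := hsym p hin.1 hin.2.1 hin.2.2.1 hin.2.2.2
      have hne : p.2 ≠ w := by
        intro hpw
        rw [this.2 hpw] at hp
        exact hp
      simp only [Prod.fst_zero, Prod.snd_zero]
      omega
    · simp only [sym, if_neg hin] at hp
      exact hp.elim
  · intro p h₁ h₂ h₃ h₄
    simp only [Prod.fst_zero, Prod.snd_zero, zero_add] at h₁ h₂ h₃ h₄ ⊢
    exact hsym p h₁ h₂ h₃ h₄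
  · intro p b
    simp only [sym]
    split_ifs with hin
    · obtain ⟨hlt, -⟩ := hidx p.1.toNat p.2.toNat (by omega) (by omega)
      rw [List.getD_eq_getElem _ _ hlt]
      exact fun h => hbit b (h ▸ List.getElem_mem hlt)
    · simp
  · rw [Layout.cells_eq, List.map_map]
    refine List.ext_getElem (by simp [hm]) fun n h₁ h₂ => ?_
    have hn : n < m * (w + 1) := by rwa [← hm]
    have hdiv : n / (w + 1) < m := Nat.div_lt_of_lt_mul (by rwa [Nat.mul_comm])
    have hmod : n % (w + 1) < w + 1 := Nat.mod_lt _ (by omega)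
    simp only [List.getElem_map, List.getElem_range, Function.comp_apply, Prod.fst_zero,
      Prod.snd_zero, zero_add, sym]
    rw [if_pos ⟨by positivity, by exact_mod_cast hdiv, by positivity,
      by exact_mod_cast Nat.lt_succ_iff.1 hmod⟩]
    simp only [Int.toNat_natCast, Nat.div_add_mod']
    exact List.getD_eq_getElem _ _ h₂

theorem eq_of_maps {u v : List Letter} (h₁ : statics u = statics v)
    (h₂ : u.map Letter.col = v.map Letter.col)
    (h₃ : u.map Letter.dynamic = v.map Letter.dynamic) : u = v := by
  induction u generalizing v with
  | nil =>
    obtain rfl : v = [] := by simpa using h₂.symm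
    rfl
  | cons x u ih =>
    obtain _ | ⟨y, v⟩ := v
    · simp at h₂
    simp only [statics, List.map_cons, List.cons.injEq] at h₁ h₂ h₃
    refine List.cons_eq_cons.2 ⟨?_, ih h₁.2 h₂.2 h₃.2⟩
    have h₁ := h₁.1
    have h₂ := h₂.1
    have h₃ := h₃.1
    rcases x with ⟨a, b⟩ | ⟨s, c, d⟩ <;> rcases y with ⟨a', b'⟩ | ⟨s', c', d'⟩ <;>
      simp_all [Letter.static, Letter.col, Letter.dynamic]

theorem Color.eq_of_black_iff {c c' : Color} (h : c = .black ↔ c' = .black) : c = c' := by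
  cases c <;> cases c' <;> simp at h ⊢

namespace Layout

variable {L : Layout}

theorem dynamic_block {bits cs : List Bool} {t : ℕ} {D : Pos → CellState}
    (hlen : cs.length = bits.length) :
    (L.block bits cs t D).map Letter.dynamic = cs.map Sum.inl ++ L.cells.map fun p => .inr (D p) := by
  have : (bits.zip cs).map Prod.snd = cs := List.map_snd_zip (by omega)
  rw [block, List.map_append, List.map_map, List.map_map]
  conv_rhs => rw [← this, List.map_map]
  rfl

/-- Rewriting a word that shows a state of the verifier. -/
theorem reflTransGen_block {bits : List Bool} {c : Color}
    (hcol : columns 0 (L.cells.map L.sym) = L.cells.map fun p => (p.2 - L.o.2).toNat)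
    (hc : c = .black ↔ ∃ y ∈ L.cells, HasAnchor (· = .white) (.inr (L.sym y))) {cs : List Bool}
    {D : Pos → CellState} {t : ℕ} {v : List Letter} (hlen : cs.length = (bits ++ [true]).length)
    (h : Relation.ReflTransGen Rewrites (L.block (bits ++ [true]) cs t D) v) :
    ∃ cs' t' D', cs'.length = (bits ++ [true]).length ∧ v = L.block (bits ++ [true]) cs' t' D' ∧
      Relation.ReflTransGen (VerifierStep L.squares L.rail c) (cs, D) (cs', D') := by
  have hcol' : ∀ t : ℕ, (columns 0 (L.cells.map L.sym)).map (fun n => decide (n = t)) =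
      L.cells.map fun p => decide (p.2 = L.o.2 + t) := by
    intro t
    rw [hcol, List.map_map]
    refine List.map_congr_left fun p hp => ?_
    have := L.mem_cells.1 hp
    simp only [Function.comp_apply, decide_eq_decide]
    omega
  induction h with
  | refl => exact ⟨cs, t, D, hlen, rfl, .refl⟩
  | tail _ huv ih =>
    obtain ⟨cs₁, t₁, D₁, hlen₁, rfl, hsteps⟩ := ih
    have hstatic := statics_block (L := L) (t := t₁) (D := D₁) hlen₁
    -- A step that moves marks leads to a block again: symbols and states are kept, and
    -- `Rewrites.hasColumn` says where the marks are.
    have hmarks : ∀ z : List LetterPair, z.map Prod.fst = L.block (bits ++ [true]) cs₁ t₁ D₁ →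
        (z ∈ resetLang ∨ z ∈ shiftLang) → (∀ y ∈ z, SameState y) →
        ∃ t', z.map Prod.snd = L.block (bits ++ [true]) cs₁ t' D₁ := by
      intro z hz hz' hsame
      have hr : Rewrites (L.block (bits ++ [true]) cs₁ t₁ D₁) (z.map Prod.snd) :=
        ⟨z, .inr hz', hz, rfl⟩
      have hs : statics (L.block (bits ++ [true]) cs₁ t₁ D₁) =
          (bits ++ [true]).map Sum.inl ++ (L.cells.map L.sym).map Sum.inr := by
        rw [hstatic, List.map_map]
        rfl
      have hcl : HasColumn (bits ++ [true]) (L.cells.map L.sym)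
          (L.block (bits ++ [true]) cs₁ t₁ D₁) := ⟨t₁, by rw [col_block hlen₁, hcol']⟩
      obtain ⟨t', ht'⟩ := hr.hasColumn hs hcl
      refine ⟨t', eq_of_maps ?_ ?_ ?_⟩
      · rw [statics_eq_of_forall fun y hy => (hsame y hy).1, hz, hstatic, statics_block hlen₁]
      · rw [ht', col_block hlen₁, hcol']
      · rw [(dynamic_block hlen₁).trans (dynamic_block (t := t₁) hlen₁).symm, ← hz, List.map_map,
          List.map_map]
        exact List.map_congr_left fun y hy => (hsame y hy).2
    obtain ⟨z, ⟨c', hz, hturn, -⟩ | hz | hz, hz₁, rfl⟩ := huv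
    · obtain rfl : c' = c := by
        have h := mem_turnLang.1 hturn
        rw [hz₁, hstatic] at h
        refine Color.eq_of_black_iff ?_
        rw [h, hc]
        simp [HasAnchor]
      obtain ⟨cs', D', h₁, h₂, h₃⟩ := step_sound hz hlen₁ hz₁
      exact ⟨cs', t₁, D', h₂, h₁, hsteps.tail h₃⟩
    · obtain ⟨t', ht'⟩ := hmarks z hz₁ (.inl hz) hz.1
      exact ⟨cs₁, t', D₁, hlen₁, ht', hsteps⟩
    · obtain ⟨t', ht'⟩ := hmarks z hz₁ (.inr hz) fun y hy => (hz.1 y hy).1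
      exact ⟨cs₁, t', D₁, hlen₁, ht', hsteps⟩

theorem boardMarks_of_reflTransGen {c : Color} {x y : List Bool × (Pos → CellState)}
    (hx : BoardMarks L.squares x.2)
    (h : Relation.ReflTransGen (VerifierStep L.squares L.rail c) x y) :
    BoardMarks L.squares y.2 := by
  induction h with
  | refl => exact hx
  | tail _ h ih => exact ih.step h

theorem boardMarks_initial (sq : Set Pos) (P : Placement) :
    BoardMarks sq fun p => .initial (P p) :=
  ⟨fun _ h => by simp [CellState.initial] at h, fun _ _ h => by simp [CellState.initial] at h,
    fun _ _ h => by simp [CellState.initial] at h⟩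

theorem gameMarks_initial (s : GameState) {k : ℕ} {l : List Bool} (hl : bitsValue l ≤ k) :
    GameMarks s k l fun p => .initial (s.piece p) :=
  ⟨⟨0, s.piece, .refl _ _, .inl ⟨fun _ => rfl, fun _ => rfl, by simpa using hl⟩⟩,
    fun _ _ h => by simp [CellState.initial] at h, fun _ h => by simp [CellState.initial] at h,
    fun _ _ h => by simp [CellState.initial] at h,
    fun ⟨_, h⟩ => by simp [CellState.initial] at h⟩

theorem Describes.mateInOne {s : GameState} (hL : L.Describes s) {l l' : List Bool}
    {D : Pos → CellState} (h : Relation.ReflTransGen (VerifierStep L.squares L.rail s.turn)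
      (l, fun p => .initial (s.piece p)) (l', D)) (hD : ∃ p, (D p).won = true) :
    s.MateInOne (bitsValue l) := by
  suffices H : ∀ y, Relation.ReflTransGen (VerifierStep L.squares L.rail s.turn)
      (l, fun p => .initial (s.piece p)) y →
      GameMarks s (bitsValue l) y.1 y.2 from (H _ h).won hD
  intro y hy
  induction hy with
  | refl => exact gameMarks_initial s le_rfl
  | @tail y z hxy hyz ih =>
    rw [hL.squares, hL.rail] at hyz
    refine ih.step (fun p d hpd => ?_) hyz
    have := (boardMarks_of_reflTransGen (boardMarks_initial _ s.piece) hxy).void p d hpd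
    rwa [hL.squares] at this

/-- An array shows a game state if it satisfies all conditions on game states. -/
theorem exists_describes (hne : L.squares.Nonempty)
    (hconn : ∀ p ∈ L.squares, ∀ q ∈ L.squares,
      Relation.ReflTransGen (fun a b => Adjacent a b ∧ b ∈ L.squares) p q)
    (hrail : ∀ p ∈ L.squares, ∀ d, L.rail p d = true → p + d.vec ∉ L.squares)
    (hanchor : L.cells.Pairwise fun p q => ¬ (HasAnchor (fun _ => True) (.inr (L.sym p)) ∧
      HasAnchor (fun _ => True) (.inr (L.sym q)))) :
    ∃ s : GameState, L.Describes s := by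
  classical
  have hocc : ∀ p, (L.sym p).occupant ≠ none → p ∈ L.squares := by
    intro p hp
    cases hs : L.sym p with
    | square r a =>
      show (L.sym p).IsSquare
      rw [hs]
      trivial
    | _ => simp [hs, Symbol.occupant] at hp
  have hrail' : ∀ p d, L.rail p d = true → p ∈ L.squares := by
    intro p d hp
    unfold rail at hp
    cases hs : L.sym p with
    | square r a =>
      show (L.sym p).IsSquare
      rw [hs]
      trivial
    | _ => simp [hs, Symbol.rail] at hp
  let squares : Finset Pos := L.cells.toFinset.filter fun p => p ∈ L.squares
  have hsq : ∀ p, p ∈ squares ↔ p ∈ L.squares := by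
    intro p
    simp only [squares, Finset.mem_filter, List.mem_toFinset, and_iff_right_iff_imp]
    exact L.square_mem_cells
  let rails : Finset (Pos × Direction) :=
    (squares ×ˢ Finset.univ).filter fun e => L.rail e.1 e.2 = true
  have hrl : ∀ p d, (p, d) ∈ rails ↔ L.rail p d = true := by
    intro p d
    simp only [rails, Finset.mem_filter, Finset.mem_product, Finset.mem_univ, hsq, and_true,
      and_iff_right_iff_imp]
    exact hrail' p d
  refine ⟨⟨⟨squares, rails, ?_, ?_, ?_⟩, fun p => (L.sym p).occupant, ?_, ?_⟩, ?_, ?_, fun p => rfl⟩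
  · obtain ⟨p, hp⟩ := hne
    exact ⟨p, (hsq p).2 hp⟩
  · intro p hp q hq
    simpa only [hsq] using hconn p ((hsq p).1 hp) q ((hsq q).1 hq)
  · rintro ⟨p, d⟩ he
    have hd := (hrl p d).1 he
    have hp := hrail' p d hd
    exact ⟨(hsq p).2 hp, fun h => hrail p hp d hd ((hsq _).1 h)⟩
  · exact fun p hp => (hsq p).2 (hocc p hp)
  · intro p q a b ha hb hak hbk
    have key : ∀ p q a b, (L.sym p).occupant = some a → (L.sym q).occupant = some b →
        a.kind = Kind.anchoredKing → b.kind = Kind.anchoredKing → ¬ Before p q := by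
      intro p q a b ha hb hak hbk hpq
      have hp := L.square_mem_cells (hocc p (by simp [ha]))
      have hq := L.square_mem_cells (hocc q (by simp [hb]))
      obtain ⟨A₁, A₂, hA⟩ := List.append_of_mem hp
      have hq' := mem_right hA hq hpq
      rw [hA, List.pairwise_append, List.pairwise_cons] at hanchor
      exact hanchor.2.1.1 q hq' ⟨⟨a, ha, hak, trivial⟩, b, hb, hbk, trivial⟩
    have h₁ := key p q a b ha hb hak hbk
    have h₂ := key q p b a hb ha hbk hak
    unfold Before at h₁ h₂
    ext <;> omega
  · ext p
    exact (hsq p).symm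
  · funext p d
    rw [Bool.eq_iff_iff, decide_eq_true_eq]
    exact (hrl p d).symm

end Layout

theorem mem_shapeLang {z : List LetterPair} (hz : z ∈ shapeLang) :
    ∃ (m : List (Bool × Bool)) (b : Bool) (g : List GridLetter) (e : GridLetter),
      z.map Prod.fst = (m ++ [(true, b)]).map Sum.inl ++ (g ++ [e]).map Sum.inr ∧
      (∀ x ∈ g ++ [e], x.Checked) ∧ e.sym = .endRow := by
  obtain ⟨_, hz, _, ⟨y, rfl, e, hy, he, hes⟩, rfl⟩ := hz
  obtain ⟨α, x, β, rfl, hα, hx, hβ⟩ := mem_all_one_all.1 hz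
  obtain ⟨b, hb⟩ := eq_inl_of_static hx
  have h₁ : ∃ m : List (Bool × Bool), α.map Prod.fst = m.map Sum.inl := by
    clear hz
    induction α with
    | nil => exact ⟨[], rfl⟩
    | cons a α ih =>
      obtain ⟨m, hm⟩ := ih fun y hy => hα y (by simp [hy])
      have ha := hα a (by simp)
      obtain ⟨a₁ | a₁, a₂⟩ := a
      · exact ⟨a₁ :: m, by simp [hm]⟩
      · simp [Letter.static] at ha
  have h₂ : ∃ g : List GridLetter, β.map Prod.fst = g.map Sum.inr ∧ ∀ x ∈ g, x.Checked := by
    clear hz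
    induction β with
    | nil => exact ⟨[], rfl, by simp⟩
    | cons a β ih =>
      obtain ⟨g, hg, hg'⟩ := ih fun y hy => hβ y (by simp [hy])
      obtain ⟨x, hx, hx'⟩ := hβ a (by simp)
      refine ⟨x :: g, by simp [hg, hx], fun y hy => ?_⟩
      rcases List.mem_cons.1 hy with rfl | hy
      · exact hx'
      · exact hg' y hy
  obtain ⟨m, hm⟩ := h₁
  obtain ⟨g, hg, hg'⟩ := h₂
  refine ⟨m, b, g, e, by simp [hm, hg, hb, hy], fun x hx => ?_, hes⟩
  rcases List.mem_append.1 hx with hx | hx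
  · exact hg' x hx
  · rw [List.mem_singleton.1 hx]
    exact he

/-- `Symbol.toLetter` turns digits and only digits into left summands, so the static parts determine
the input and the place where its number ends. -/
theorem exists_of_statics_toLetter {x l : List Symbol} {bits : List Bool}
    (h : statics (x.map Symbol.toLetter) = bits.map Sum.inl ++ l.map Sum.inr) :
    x = bits.map Symbol.bit ++ l ∧ ∀ b, .bit b ∉ l := by
  induction x generalizing bits with
  | nil =>
    obtain ⟨rfl, rfl⟩ : bits = [] ∧ l = [] := by simpa [statics] using h.symm
    simp
  | cons s x ih =>
    obtain _ | ⟨b, bits⟩ := bits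
    · clear ih
      simp only [List.map_nil, List.nil_append]
      have key : ∀ (x l : List Symbol), statics (x.map Symbol.toLetter) = l.map Sum.inr →
          x = l ∧ ∀ b, .bit b ∉ l := by
        intro x
        induction x with
        | nil =>
          intro l h
          obtain rfl : l = [] := by simpa [statics] using h.symm
          simp
        | cons s x ih =>
          intro l h
          obtain _ | ⟨s', l⟩ := l
          · simp [statics] at h
          simp only [statics, List.map_cons, List.cons.injEq] at h
          obtain ⟨rfl, hl⟩ := ih l h.2
          cases s with
          | bit b => simp [Symbol.toLetter, Letter.static] at h
          | _ =>
            simp only [Symbol.toLetter, Letter.static, Sum.inr.injEq] at h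
            refine ⟨by rw [h.1], fun b hb => ?_⟩
            rcases List.mem_cons.1 hb with hb | hb
            · rw [← h.1] at hb
              simp at hb
            · exact hl b hb
      exact key _ _ h
    · simp only [statics, List.map_cons, List.cons_append, List.cons.injEq] at h
      obtain ⟨rfl, hl⟩ := ih h.2
      refine ⟨?_, hl⟩
      cases s with
      | bit b' =>
        simp only [Symbol.toLetter, Letter.static, Sum.inl.injEq] at h
        rw [h.1]
        rfl
      | _ => simp [Symbol.toLetter, Letter.static] at h

theorem hasColumn_toLetter (bits : List Bool) (l : List Symbol) :
    HasColumn bits l ((bits.map Symbol.bit ++ l).map Symbol.toLetter) := by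
  -- No symbol is as far to the right as this column, so it stands for the absence of marks.
  refine ⟨l.length, ?_⟩
  rw [List.map_append, List.map_append, List.map_map, List.map_map, List.map_map]
  congr 1
  have h₁ : l.map (Letter.col ∘ Symbol.toLetter) = List.replicate l.length false := by
    rw [List.eq_replicate_iff]
    refine ⟨by simp, fun b hb => ?_⟩
    obtain ⟨s, hs, rfl⟩ := List.mem_map.1 hb
    cases s <;> rfl
  have h₂ : (columns 0 l).map (fun n => decide (n = l.length)) =
      List.replicate l.length false := by
    rw [List.eq_replicate_iff]
    refine ⟨by simp [length_columns], fun b hb => ?_⟩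
    obtain ⟨n, hn, rfl⟩ := List.mem_map.1 hb
    have := lt_of_mem_columns hn
    simp only [decide_eq_false_iff_not]
    omega
  rw [h₁, h₂]

theorem hasColumn_of_reflTransGen {bits : List Bool} {l : List Symbol} {u v : List Letter}
    (h : Relation.ReflTransGen Rewrites u v)
    (hu : statics u = (bits ++ [true]).map Sum.inl ++ l.map Sum.inr)
    (hc : HasColumn (bits ++ [true]) l u) : HasColumn (bits ++ [true]) l v := by
  induction h with
  | refl => exact hc
  | tail huv h ih => exact h.hasColumn ((statics_eq_of_reflTransGen huv).trans hu) ih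

/-- Symbols never change, so the shape of the last word is that of the input. This yields an array;
then the rewriting is a run of the verifier on this array, and the marks at its end show that the
array is a game state and that it is won. -/
theorem mem_of_accepts {x : List Symbol} {n : ℕ}
    (h : Accepts stepLang finalLang n (x.map Symbol.toLetter)) : x ∈ kMoveMateInOne := by
  obtain ⟨z, ⟨hshape, hwon, hanchor⟩, hsteps⟩ := reflTransGen_of_accepts h
  obtain ⟨m, b, g, e, hz, hchecked, he⟩ := mem_shapeLang hshape
  set bits := m.map Prod.fst with hbits
  set l := (g ++ [e]).map GridLetter.sym with hl
  have hstat : statics (z.map Prod.fst) = (bits ++ [true]).map Sum.inl ++ l.map Sum.inr := by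
    rw [hz]
    simp [statics, hbits, hl, Function.comp_def, Letter.static]
  have hstat' := (statics_eq_of_reflTransGen hsteps).symm.trans hstat
  obtain ⟨rfl, hbit⟩ := exists_of_statics_toLetter hstat'
  -- The marked column of the last word consists exactly of the row ends, by `GridLetter.Checked`,
  -- so `w` is the common width of the rows.
  obtain ⟨w, hw⟩ := hasColumn_of_reflTransGen hsteps hstat' (hasColumn_toLetter _ _)
  have hcolg : (g ++ [e]).map GridLetter.col = (columns 0 l).map fun n => decide (n = w) := by
    rw [hz, List.map_append, List.map_map, List.map_map] at hw
    refine (List.append_inj hw ?_).2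
    simp [hbits]
  have hzip : ∀ y ∈ (columns 0 l).zip l, (y.1 = w ↔ y.2 = .endRow) := by
    intro y hy
    obtain ⟨i, hi, rfl⟩ := List.mem_iff_getElem.1 hy
    have hi' : i < (g ++ [e]).length := by simpa [length_columns, hl] using hi
    have hcol : ((g ++ [e])[i]).col = decide ((columns 0 l)[i]'(by
        simpa [length_columns, hl] using hi) = w) := by
      have := List.getElem_of_eq hcolg (i := i) (by simpa using hi')
      rwa [List.getElem_map, List.getElem_map] at this
    have hch := (hchecked _ (List.getElem_mem hi')).1
    rw [hcol, decide_eq_true_eq] at hch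
    rw [List.getElem_zip]
    simp only [hl, List.getElem_map]
    exact hch
  obtain ⟨L, hLw, hLo, hLl⟩ := exists_layout hbit hzip (l' := g.map GridLetter.sym)
    (by simp [hl, he])
  have hcol : columns 0 (L.cells.map L.sym) = L.cells.map fun p => (p.2 - L.o.2).toNat := by
    have hlen : l.length = L.h * (L.w + 1) := by
      rw [← hLl, L.cells_eq]
      simp
    rw [hLl, columns_eq (Nat.zero_le w) hzip, L.cells_eq, hlen, hLw, List.map_map]
    refine List.map_congr_left fun n _ => ?_
    simp only [Function.comp_apply, zero_add, add_sub_cancel_left, Int.toNat_natCast]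
  have hinit := L.map_toLetter (bits ++ [true])
  rw [hLl] at hinit
  rw [hinit] at hsteps
  -- There is no game state yet, so the player is read off from the symbols; later `c` turns out to
  -- be `s.turn`.
  obtain ⟨c, hc⟩ : ∃ c : Color,
      c = .black ↔ ∃ y ∈ L.cells, HasAnchor (· = .white) (.inr (L.sym y)) := by
    by_cases hy : ∃ y ∈ L.cells, HasAnchor (· = .white) (.inr (L.sym y))
    · exact ⟨.black, by simpa using hy⟩
    · exact ⟨.white, by simpa using hy⟩
  obtain ⟨cs, t, D, hlen, hfinal, hrun⟩ := Layout.reflTransGen_block hcol hc rfl hsteps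
  have hmarks := Layout.boardMarks_of_reflTransGen
    (Layout.boardMarks_initial _ fun p => (L.sym p).occupant) hrun
  have hletters : ∀ p ∈ L.cells, (L.letter t D p).Checked := by
    intro p hp
    refine hchecked _ ?_
    have hmem : (Sum.inr (L.letter t D p) : Letter) ∈ z.map Prod.fst := by
      rw [hfinal]
      exact List.mem_append_right _
        (List.mem_map_of_mem (f := fun p => Sum.inr (L.letter t D p)) hp)
    rw [hz] at hmem
    rcases List.mem_append.1 hmem with hmem | hmem
    · obtain ⟨_, -, h⟩ := List.mem_map.1 hmem
      simp at h
    · obtain ⟨_, hx, h⟩ := List.mem_map.1 hmem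
      rwa [← Sum.inr.inj h]
  have hvisited : ∀ p ∈ L.squares, (D p).visited = true := fun p hp =>
    ((hletters p (L.square_mem_cells hp)).2 hp).1
  obtain ⟨p, hp, hpw⟩ : ∃ p ∈ L.squares, (D p).won = true := by
    obtain ⟨α, y, β, rfl, -, ⟨x, hyx, hx, hxw⟩, -⟩ := mem_all_one_all.1 hwon
    have hmem : (Sum.inr x : Letter) ∈ L.block (bits ++ [true]) cs t D := by
      rw [← hfinal, ← hyx]
      simp
    rcases List.mem_append.1 hmem with hmem | hmem
    · obtain ⟨_, -, h⟩ := List.mem_map.1 hmem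
      simp at h
    · obtain ⟨p, hp, h⟩ := List.mem_map.1 hmem
      obtain rfl := Sum.inr.inj h
      exact ⟨p, hx, hxw⟩
  obtain ⟨s, hs⟩ := L.exists_describes ⟨p, hp⟩
    (fun p hp q hq => hmarks.connected p q (hvisited p hp) (hvisited q hq))
    (fun p hp d hd => hmarks.void p d
      (((hletters p (L.square_mem_cells hp)).2 hp).2 d hd))
    (by
      rw [← Layout.pairwise_statics_block_iff hlen (t := t) (D := D), ← hfinal]
      by_contra hcon
      exact hanchor (mem_twoAnchorsLang.2 hcon))
  obtain rfl := Color.eq_of_black_iff (hc.trans hs.turn_eq.symm)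
  simp only [hs.occupant] at hrun
  obtain ⟨n, hn⟩ := exists_eq_encodePosNum bits
  have hk : bitsValue (bits ++ [true]) = (n : ℕ) := by rw [← hn, bitsValue_encodePosNum]
  refine ⟨s, n, L.o, L.h, L.w, PosNum.to_nat_pos n, fun p hp => ?_, ?_, ?_⟩
  · rw [← Finset.mem_coe, ← hs.squares] at hp
    have := L.square_mem p hp
    exact ⟨(p.1 - L.o.1).toNat, by omega, (p.2 - L.o.2).toNat, by omega, by
      ext <;> simp only <;> omega⟩
  · rw [hs.describe_eq, encodeNat_posNum, hn, hLl]
  · rw [← hk]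
    exact hs.mateInOne hrun ⟨p, hpw⟩

end PushFight

theorem mainTheorem5 : PushFight.InNP PushFight.kMoveMateInOne :=
  RegularRewriting.inNP_of_accepts PushFight.Symbol.toLetter PushFight.isRegular_stepLang
    PushFight.isRegular_finalLang PushFight.stepBound (fun _ _ => PushFight.mem_of_accepts)
    fun _ => PushFight.exists_accepts
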